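/- Let $\Omega_n$ be the category of $n$-trees (chains $[k_n]\to\dots\to[k_1]\to[k_0]=[1]$ of order preserving maps of finite ordinals, with morphisms the levelwise commuting maps that preserve the order on the fibres of the structure maps). A categorical $n$-operad $A$ consists of categories $A_T$, $T\in\Omega_n$, a unit object $e\in A_{U_n}$ ($U_n=[1]\to\dots\to[1]$) and strictly associative and unital multiplication functors $m_\sigma:A_S\times A_{T_1}\times\dots\times A_{T_k}\to A_T$ for $\sigma:T\to S$ with fibres $T_1,\dots,T_k$ over the tips of $S$. It is cocomplete if every $A_T$ is cocomplete and every $m_\sigma$ preserves colimits in each variable. An internal $n$-collection in $A$ is a family of objects $x_T\in A_T$; an internal $n$-operad in $A$ is an internal $n$-collection $a$ with morphisms $m_\sigma(a_S;a_{T_1},\dots,a_{T_k})\to a_T$ for all $\sigma:T\to S$ and $e\to a_{U_n}$, satisfying associativity and unit axioms. Let $\mathbf H^n$ be the categorical $n$-operad freely generated by an internal $n$-operad $T\mapsto[T]$, and for an internal $n$-collection $x$ in $A$ let $\tilde x$ be the strict operadic functor, from the discrete operad of objects of $\mathbf H^n$ to $A$, with $\tilde x([T])=x_T$. **(1)** Let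 $A$ be a cocomplete categorical $n$-operad. Then the forgetful functor from internal $n$-operads in $A$ to internal $n$-collections in $A$ has a left adjoint. Let $\mathcal F_n$ be the resulting endofunctor (free internal $n$-operad, then forget) of the category of internal $n$-collections. Naturally in $x$, $$\mathcal F_n(x)_T\cong\coprod_{W\in\mathbf H^n_T}\tilde x(W),$$ where $W$ runs over the objects of $\mathbf H^n_T$, and more generally, for every $k\ge1$, the $k$-th iterate is $$\mathcal F_n^k(x)_T\cong\coprod_{W_1\xleftarrow{f_1}W_2\xleftarrow{f_2}\cdots\xleftarrow{f_{k-1}}W_k}\tilde x(W_k),$$ where the coproduct is over all chains of $k-1$ composable morphisms of $\mathbf H^n_T$. **(2)** Let $A$ be a cocomplete (left) symmetric categorical operad, i.e. a symmetric operad in $\mathrm{Cat}$ such that each $A_m$ is cocomplete and the multiplication preserves colimits in each variable. For a map $\sigma:[m]\to[k]$ write $\sigma=\nu(\sigma)\pi(\sigma)$ with $\nu(\sigma)$ order preserving and $\pi(\sigma)$ a bijection preserving the order on the fibres of $\sigma$. An internal symmetric operad in $A$ is a family of objects $a_m\in A_m$, $m\ge0$, with morphisms $m(a_k;a_{m_1},\dots,a_{m_k})\to\pi(\sigma)a_m$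 for all maps $\sigma:[m]\to[k]$ (order preserving or not) with fibres $[m_1],\dots,[m_k]$, and $e\to a_1$, satisfying associativity and unit axioms. Let $\mathbf H^\infty$ be the symmetric categorical operad freely generated by an internal symmetric operad, and for a (nonsymmetric) internal collection $x=(x_m)_{m\ge0}$ define $\tilde x$ on the objects of $\mathbf H^\infty$ as before. Then the forgetful functor from internal symmetric operads in $A$ to internal collections in $A$ has a left adjoint, and, with $\mathcal F_\infty$ the resulting endofunctor, naturally in $x$ and for every $k\ge 1$, $$\mathcal F_\infty(x)_m\cong\coprod_{W\in\mathbf H^\infty_m}\tilde x(W),\qquad \mathcal F_\infty^k(x)_m\cong\coprod_{W_1\xleftarrow{f_1}W_2\xleftarrow{f_2}\cdots\xleftarrow{f_{k-1}}W_k}\tilde x(W_k),$$ the second coproduct being over all chains of $k-1$ composable morphisms of $\mathbf H^\infty_m$. -/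

import Mathlib

open CategoryTheory CategoryTheory.Limits

universe v u

namespace HigherOperad

/-! ## Arities and fibres

Operads of both kinds considered here are indexed by the objects of a category `Ω` of arities: the
category `Ω_n` of `n`-trees, or the category `Ω^s` of finite ordinals and all maps.  In both
cases there is a terminal object `U` (the linear tree `U_n`, respectively `[1]`), the tips of an
arity `S` are the morphisms `U ⟶ S`, and the fibre of `σ : T ⟶ S` over a tip `i` is the pullback of
`σ` along `i`, realised by the unique arity whose inclusion into `T` is order preserving. -/

class Arities (Ω : Type) [Category.{0} Ω] where
  /-- The arity of the operad unit. -/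
  U : Ω
  isTerminal : IsTerminal U
  /-- The injective order preserving maps. -/
  incl : MorphismProperty Ω
  incl_tip : ∀ {T : Ω} (i : U ⟶ T), incl i
  incl_id : ∀ T : Ω, incl (𝟙 T)
  incl_of_comp : ∀ {R S T : Ω} (f : R ⟶ S) (g : S ⟶ T), incl g → incl (f ≫ g) → incl f

section Fibres

variable {Ω : Type} [Category.{0} Ω] [Arities Ω]

/-- The tips of an arity. -/
abbrev Tip (S : Ω) : Type := (Arities.U : Ω) ⟶ S

/-- The unique morphism to the terminal arity. -/
def bang (T : Ω) : T ⟶ (Arities.U : Ω) := Arities.isTerminal.from T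

theorem toU_ext {T : Ω} (f g : T ⟶ (Arities.U : Ω)) : f = g := Arities.isTerminal.hom_ext f g

/-- `Fibre σ i F` says that `F` is the fibre of `σ` over the tip `i`; the datum `ι` is the inclusion
of the fibre. Both `F` and `ι` are determined by `σ` and `i`. -/
structure Fibre {T S : Ω} (σ : T ⟶ S) (i : Tip S) (F : Ω) where
  ι : F ⟶ T
  isPullback : IsPullback ι (bang F) σ i
  incl : Arities.incl ι

/-- The fibre of an identity over a tip is `U`. -/
def Fibre.ofId {T : Ω} (i : Tip T) : Fibre (𝟙 T) i Arities.U where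
  ι := i
  isPullback := by
    have : bang (Arities.U : Ω) = 𝟙 _ := toU_ext _ _
    rw [this]
    exact IsPullback.of_vert_isIso ⟨by simp⟩
  incl := Arities.incl_tip i

/-- The fibre of the unique morphism `T ⟶ U` is `T`. -/
def Fibre.ofBang (T : Ω) (i : Tip (Arities.U : Ω)) : Fibre (bang T) i T where
  ι := 𝟙 T
  isPullback := by
    have : i = 𝟙 _ := toU_ext _ _
    rw [this]
    exact IsPullback.of_horiz_isIso ⟨by simp⟩
  incl := Arities.incl_id T

/-- For composable `σ : T ⟶ S`, `ω : S ⟶ R` and a tip `i` of `R`, the `i`-th fibre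
`σ_i : (σ ≫ ω)⁻¹(i) ⟶ ω⁻¹(i)` of `σ`. -/
noncomputable def Fibre.res {T S R : Ω} {σ : T ⟶ S} {ω : S ⟶ R} {i : Tip R} {G H : Ω}
    (ψ : Fibre ω i G) (χ : Fibre (σ ≫ ω) i H) : H ⟶ G :=
  ψ.isPullback.lift (χ.ι ≫ σ) (bang H) (by rw [Category.assoc]; exact χ.isPullback.w)

theorem Fibre.res_ι {T S R : Ω} {σ : T ⟶ S} {ω : S ⟶ R} {i : Tip R} {G H : Ω}
    (ψ : Fibre ω i G) (χ : Fibre (σ ≫ ω) i H) : ψ.res χ ≫ ψ.ι = χ.ι ≫ σ :=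
  ψ.isPullback.lift_fst _ _ _

/-- The fibre of `σ_i` over a tip `j` of `ω⁻¹(i)` is the fibre of `σ` over the corresponding tip
of `S`. -/
noncomputable def Fibre.resFibre {T S R : Ω} {σ : T ⟶ S} {ω : S ⟶ R} {i : Tip R} {G H F : Ω}
    (ψ : Fibre ω i G) (χ : Fibre (σ ≫ ω) i H) (j : Tip G) (φ : Fibre σ (j ≫ ψ.ι) F) :
    Fibre (ψ.res χ) j F where
  ι := χ.isPullback.lift φ.ι (bang F) (by
    have h := φ.isPullback.w
    have h' := ψ.isPullback.w
    rw [← Category.assoc, h, Category.assoc, Category.assoc, h', ← Category.assoc,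
      ← Category.assoc]
    congr 1
    exact toU_ext _ _)
  isPullback := by
    have hs : IsPullback χ.ι (ψ.res χ) σ ψ.ι :=
      IsPullback.of_bot (h₃₁ := i) (v₂₁ := bang G) (v₂₂ := ω)
        (by convert χ.isPullback using 1; exact toU_ext _ _) (ψ.res_ι χ).symm ψ.isPullback
    refine IsPullback.of_right (h₁₂ := χ.ι) (h₂₂ := ψ.ι) (v₁₃ := σ) ?_ ?_ hs
    · rw [χ.isPullback.lift_fst]; exact φ.isPullback
    · apply ψ.isPullback.hom_ext
      · rw [Category.assoc, ψ.res_ι χ, ← Category.assoc, χ.isPullback.lift_fst, φ.isPullback.w,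
          Category.assoc]
      · exact toU_ext _ _
  incl := Arities.incl_of_comp _ χ.ι χ.incl
    (by rw [χ.isPullback.lift_fst]; exact φ.incl)

end Fibres

/-! ## Categorical operads -/

set_option linter.checkUnivs false in
/-- A (strict) categorical operad with arities in `Ω`: for `Ω = Ω_n` a categorical `n`-operad, for
`Ω = Ω^s` a categorical `S`-operad. The family `φ` is the (unique) family of fibres of `σ`. -/
structure CatOperad (Ω : Type) [Category.{0} Ω] [Arities Ω] where
  obj : Ω → Type u
  [cat : ∀ T, Category.{v} (obj T)]
  unit : obj Arities.U
  mul : ∀ {T S : Ω} (σ : T ⟶ S) {F : Tip S → Ω} (_φ : ∀ i, Fibre σ i (F i)),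
    obj S × (∀ i, obj (F i)) ⥤ obj T
  /-- `m_σ(m_ω(r; s); t) = m_{σω}(r; m_{σ_i}(s_i; t))`. -/
  assoc : ∀ {T S R : Ω} (σ : T ⟶ S) (ω : S ⟶ R) {F : Tip S → Ω} (φ : ∀ j, Fibre σ j (F j))
    {G : Tip R → Ω} (ψ : ∀ i, Fibre ω i (G i)) {H : Tip R → Ω} (χ : ∀ i, Fibre (σ ≫ ω) i (H i)),
    (mul ω ψ).prod (𝟭 (∀ j, obj (F j))) ⋙ mul σ φ =
      Functor.prod' (CategoryTheory.Prod.fst _ _ ⋙ CategoryTheory.Prod.fst _ _)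
        (Functor.pi' fun i =>
          Functor.prod' (CategoryTheory.Prod.fst _ _ ⋙ CategoryTheory.Prod.snd _ _ ⋙ Pi.eval _ i)
            (Functor.pi' fun j => CategoryTheory.Prod.snd _ _ ⋙ Pi.eval _ (j ≫ (ψ i).ι)) ⋙
          mul ((ψ i).res (χ i)) (fun j => (ψ i).resFibre (χ i) j (φ (j ≫ (ψ i).ι)))) ⋙
      mul (σ ≫ ω) χ
  /-- `m_id(t; e, …, e) = t`. -/
  mul_id : ∀ T : Ω,
    Functor.prod' (𝟭 (obj T)) (Functor.pi' fun _ : Tip T => (Functor.const _).obj unit) ⋙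
      mul (𝟙 T) Fibre.ofId = 𝟭 _
  /-- `m_!(e; t) = t` for the unique `! : T ⟶ U`. -/
  mul_bang : ∀ T : Ω,
    Functor.prod' ((Functor.const _).obj unit)
        (Functor.pi' fun _ : Tip (Arities.U : Ω) => 𝟭 (obj T)) ⋙
      mul (bang T) (Fibre.ofBang T) = 𝟭 _

attribute [instance] CatOperad.cat

open Classical in
/-- The functor `y ↦ d[i ↦ y]` which varies only the `i`-th coordinate of a family. -/
noncomputable def varyCoord {I : Type} {D : I → Type u} [∀ i, Category.{v} (D i)]
    (d : ∀ i, D i) (i : I) : D i ⥤ ∀ j, D j :=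
  Functor.pi' fun j => if h : i = j then h ▸ 𝟭 (D i) else (Functor.const _).obj (d j)

/-- A functor on `C × ∏ D_i` preserves (small) colimits in each variable separately. -/
def PreservesColimitsInEachVariable {C E : Type u} [Category.{v} C] [Category.{v} E]
    {I : Type} {D : I → Type u} [∀ i, Category.{v} (D i)] (M : C × (∀ i, D i) ⥤ E) : Prop :=
  (∀ d : ∀ i, D i,
    PreservesColimits (Functor.prod' (𝟭 C) ((Functor.const C).obj d) ⋙ M)) ∧
  (∀ (c : C) (d : ∀ i, D i) (i : I),
    PreservesColimits (Functor.prod' ((Functor.const (D i)).obj c) (varyCoord d i) ⋙ M))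

section Internal

variable {Ω : Type} [Category.{0} Ω] [Arities Ω]

/-- Each category is cocomplete and the multiplication preserves colimits in each variable. -/
structure CatOperad.Cocomplete (A : CatOperad.{v, u} Ω) : Prop where
  hasColimits : ∀ T, HasColimits (A.obj T)
  preserves : ∀ {T S : Ω} (σ : T ⟶ S) {F : Tip S → Ω} (φ : ∀ i, Fibre σ i (F i)),
    PreservesColimitsInEachVariable (A.mul σ φ)

/-- The category of internal collections: families of objects `x_T` and of morphisms. -/
abbrev IColl (A : CatOperad.{v, u} Ω) := ∀ T, A.obj T

/-- The action of `m_σ` on a morphism and a family of morphisms. -/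
abbrev CatOperad.mulMap (A : CatOperad.{v, u} Ω) {T S : Ω} (σ : T ⟶ S) {F : Tip S → Ω}
    (φ : ∀ i, Fibre σ i (F i)) {s s' : A.obj S} {t t' : ∀ i, A.obj (F i)}
    (f : s ⟶ s') (g : ∀ i, t i ⟶ t' i) : (A.mul σ φ).obj (s, t) ⟶ (A.mul σ φ).obj (s', t') :=
  (A.mul σ φ).map (CategoryTheory.Prod.mkHom f g)

/-- An internal operad in a categorical operad `A`. -/
structure IOperad (A : CatOperad.{v, u} Ω) where
  obj : IColl A
  μ : ∀ {T S : Ω} (σ : T ⟶ S) {F : Tip S → Ω} (φ : ∀ i, Fibre σ i (F i)),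
    (A.mul σ φ).obj (obj S, fun i => obj (F i)) ⟶ obj T
  ε : A.unit ⟶ obj Arities.U
  assoc : ∀ {T S R : Ω} (σ : T ⟶ S) (ω : S ⟶ R) {F : Tip S → Ω} (φ : ∀ j, Fibre σ j (F j))
    {G : Tip R → Ω} (ψ : ∀ i, Fibre ω i (G i)) {H : Tip R → Ω} (χ : ∀ i, Fibre (σ ≫ ω) i (H i)),
    A.mulMap σ φ (μ ω ψ) (fun j => 𝟙 (obj (F j))) ≫ μ σ φ =
      eqToHom (Functor.congr_obj (A.assoc σ ω φ ψ χ)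
        ((obj R, fun i => obj (G i)), fun j => obj (F j))) ≫
      A.mulMap (σ ≫ ω) χ (𝟙 (obj R)) (fun i =>
        μ ((ψ i).res (χ i)) fun j => (ψ i).resFibre (χ i) j (φ (j ≫ (ψ i).ι))) ≫
      μ (σ ≫ ω) χ
  unit_right : ∀ T : Ω,
    A.mulMap (𝟙 T) Fibre.ofId (𝟙 (obj T)) (fun _ => ε) ≫ μ (𝟙 T) Fibre.ofId =
      eqToHom (Functor.congr_obj (A.mul_id T) (obj T))
  unit_left : ∀ T : Ω,
    A.mulMap (bang T) (Fibre.ofBang T) ε (fun _ => 𝟙 (obj T)) ≫ μ (bang T) (Fibre.ofBang T) =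
      eqToHom (Functor.congr_obj (A.mul_bang T) (obj T))

variable {A : CatOperad.{v, u} Ω}

/-- A morphism of internal operads. -/
@[ext]
structure IOperad.Hom (a b : IOperad A) where
  f : a.obj ⟶ b.obj
  map_μ : ∀ {T S : Ω} (σ : T ⟶ S) {F : Tip S → Ω} (φ : ∀ i, Fibre σ i (F i)),
    a.μ σ φ ≫ f T = A.mulMap σ φ (f S) (fun i => f (F i)) ≫ b.μ σ φ
  map_ε : a.ε ≫ f Arities.U = b.ε

instance : Category (IOperad A) where
  Hom := IOperad.Hom
  id a :=
    { f := 𝟙 a.obj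
      map_μ := fun {T S} σ {F} φ => by
        have : A.mulMap σ φ ((𝟙 a.obj : a.obj ⟶ a.obj) S)
            (fun i => (𝟙 a.obj : a.obj ⟶ a.obj) (F i)) = 𝟙 _ := (A.mul σ φ).map_id _
        rw [this]
        simp
      map_ε := by simp }
  comp {a b c} g h :=
    { f := g.f ≫ h.f
      map_μ := fun {T S} σ {F} φ => by
        have : A.mulMap σ φ ((g.f ≫ h.f) S) (fun i => (g.f ≫ h.f) (F i)) =
            A.mulMap σ φ (g.f S) (fun i => g.f (F i)) ≫
              A.mulMap σ φ (h.f S) (fun i => h.f (F i)) :=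
          (A.mul σ φ).map_comp
            (CategoryTheory.Prod.mkHom (g.f S) (Y₁ := fun i => a.obj (F i))
              (Y₂ := fun i => b.obj (F i)) fun i => g.f (F i))
            (CategoryTheory.Prod.mkHom (h.f S) (Y₁ := fun i => b.obj (F i))
              (Y₂ := fun i => c.obj (F i)) fun i => h.f (F i))
        rw [this, Pi.comp_apply, ← Category.assoc, g.map_μ, Category.assoc, h.map_μ,
          Category.assoc]
      map_ε := by rw [Pi.comp_apply, ← Category.assoc, g.map_ε, h.map_ε] }
  id_comp g := IOperad.Hom.ext (Category.id_comp g.f)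
  comp_id g := IOperad.Hom.ext (Category.comp_id g.f)
  assoc g h k := IOperad.Hom.ext (Category.assoc g.f h.f k.f)

/-- The forgetful functor from internal operads to internal collections. -/
def forgetColl (A : CatOperad.{v, u} Ω) : IOperad A ⥤ IColl A where
  obj a := a.obj
  map g := g.f
  map_id _ := rfl
  map_comp _ _ := rfl

end Internal

/-! ## The categorical operad `H` representing internal operads

It is the categorical operad generated by an internal operad `T ↦ [T]`.  Its objects form the free
operad of sets on one generator in every arity. -/

section Representing

variable {Ω : Type} [Category.{0} Ω] [Arities Ω]

/-- Admissible expressions. -/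
inductive Expr : Ω → Type
  | gen (T : Ω) : Expr T
  | unit : Expr Arities.U
  | mul {T S : Ω} (σ : T ⟶ S) {F : Tip S → Ω} (φ : ∀ i, Fibre σ i (F i))
      (s : Expr S) (t : ∀ i, Expr (F i)) : Expr T

/-- Equality of admissible expressions modulo the axioms of an operad. -/
inductive ExprEq : ∀ {T : Ω}, Expr T → Expr T → Prop
  | refl {T : Ω} (x : Expr T) : ExprEq x x
  | symm {T : Ω} {x y : Expr T} : ExprEq x y → ExprEq y x
  | trans {T : Ω} {x y z : Expr T} : ExprEq x y → ExprEq y z → ExprEq x z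
  | congr {T S : Ω} (σ : T ⟶ S) {F : Tip S → Ω} (φ : ∀ i, Fibre σ i (F i))
      {s s' : Expr S} {t t' : ∀ i, Expr (F i)} :
      ExprEq s s' → (∀ i, ExprEq (t i) (t' i)) → ExprEq (.mul σ φ s t) (.mul σ φ s' t')
  | assoc {T S R : Ω} (σ : T ⟶ S) (ω : S ⟶ R) {F : Tip S → Ω} (φ : ∀ j, Fibre σ j (F j))
      {G : Tip R → Ω} (ψ : ∀ i, Fibre ω i (G i)) {H : Tip R → Ω} (χ : ∀ i, Fibre (σ ≫ ω) i (H i))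
      (r : Expr R) (s : ∀ i, Expr (G i)) (t : ∀ j, Expr (F j)) :
      ExprEq (.mul σ φ (.mul ω ψ r s) t)
        (.mul (σ ≫ ω) χ r fun i => .mul ((ψ i).res (χ i))
          (fun j => (ψ i).resFibre (χ i) j (φ (j ≫ (ψ i).ι))) (s i) fun j => t (j ≫ (ψ i).ι))
  | mul_id {T : Ω} (x : Expr T) : ExprEq (.mul (𝟙 T) Fibre.ofId x fun _ => .unit) x
  | mul_bang {T : Ω} (x : Expr T) :
      ExprEq (.mul (bang T) (Fibre.ofBang T) .unit fun _ => x) x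

instance exprSetoid (T : Ω) : Setoid (Expr T) where
  r := ExprEq
  iseqv := ⟨ExprEq.refl, ExprEq.symm, ExprEq.trans⟩

/-- The objects of `H_T`. -/
def HObj (T : Ω) : Type := Quotient (exprSetoid T)

namespace HObj

/-- The generating object in arity `T`. -/
def gen (T : Ω) : HObj T := Quotient.mk _ (.gen T)

def unit : HObj (Arities.U : Ω) := Quotient.mk _ .unit

noncomputable def mul {T S : Ω} (σ : T ⟶ S) {F : Tip S → Ω} (φ : ∀ i, Fibre σ i (F i))
    (s : HObj S) (t : ∀ i, HObj (F i)) : HObj T :=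
  Quotient.mk _ (.mul σ φ (Quotient.out s) fun i => Quotient.out (t i))

theorem mul_mk {T S : Ω} (σ : T ⟶ S) {F : Tip S → Ω} (φ : ∀ i, Fibre σ i (F i))
    (s : Expr S) (t : ∀ i, Expr (F i)) :
    mul σ φ (Quotient.mk _ s) (fun i => Quotient.mk _ (t i)) = Quotient.mk _ (.mul σ φ s t) :=
  Quotient.sound (.congr σ φ (Quotient.mk_out (s := exprSetoid S) s)
    fun i => Quotient.mk_out (s := exprSetoid (F i)) (t i))

theorem assoc {T S R : Ω} (σ : T ⟶ S) (ω : S ⟶ R) {F : Tip S → Ω} (φ : ∀ j, Fibre σ j (F j))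
    {G : Tip R → Ω} (ψ : ∀ i, Fibre ω i (G i)) {H : Tip R → Ω} (χ : ∀ i, Fibre (σ ≫ ω) i (H i))
    (r : HObj R) (s : ∀ i, HObj (G i)) (t : ∀ j, HObj (F j)) :
    mul σ φ (mul ω ψ r s) t = mul (σ ≫ ω) χ r fun i => mul ((ψ i).res (χ i))
      (fun j => (ψ i).resFibre (χ i) j (φ (j ≫ (ψ i).ι))) (s i) fun j => t (j ≫ (ψ i).ι) := by
  obtain ⟨r, rfl⟩ := Quotient.exists_rep r
  obtain ⟨s, rfl⟩ : ∃ s' : ∀ i, Expr (G i), (fun i => Quotient.mk _ (s' i)) = s :=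
    ⟨fun i => (s i).out, funext fun i => Quotient.out_eq _⟩
  obtain ⟨t, rfl⟩ : ∃ t' : ∀ i, Expr (F i), (fun i => Quotient.mk _ (t' i)) = t :=
    ⟨fun i => (t i).out, funext fun i => Quotient.out_eq _⟩
  have h : ∀ i, mul ((ψ i).res (χ i)) (fun j => (ψ i).resFibre (χ i) j (φ (j ≫ (ψ i).ι)))
      (Quotient.mk _ (s i)) (fun j => Quotient.mk _ (t (j ≫ (ψ i).ι))) = _ :=
    fun i => mul_mk _ _ _ _
  simp only [h]
  rw [mul_mk, mul_mk, mul_mk]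
  exact Quotient.sound (.assoc σ ω φ ψ χ r s t)

theorem mul_id {T : Ω} (x : HObj T) : mul (𝟙 T) Fibre.ofId x (fun _ => unit) = x := by
  obtain ⟨x, rfl⟩ := Quotient.exists_rep x
  exact (mul_mk _ _ x fun _ => .unit).trans (Quotient.sound (.mul_id x))

theorem mul_bang {T : Ω} (x : HObj T) :
    mul (bang T) (Fibre.ofBang T) unit (fun _ => x) = x := by
  obtain ⟨x, rfl⟩ := Quotient.exists_rep x
  exact (mul_mk _ _ .unit fun _ => x).trans (Quotient.sound (.mul_bang x))

end HObj

/-- Formal composites of the generating morphisms `γ : μ_σ([S]; [T_1], …, [T_k]) ⟶ [T]` and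
`ε : e ⟶ [U]` of `H`. -/
inductive HPre : ∀ {T : Ω}, HObj T → HObj T → Type
  | id {T : Ω} (w : HObj T) : HPre w w
  | comp {T : Ω} {w w' w'' : HObj T} : HPre w w' → HPre w' w'' → HPre w w''
  | mul {T S : Ω} (σ : T ⟶ S) {F : Tip S → Ω} (φ : ∀ i, Fibre σ i (F i))
      {s s' : HObj S} {t t' : ∀ i, HObj (F i)} (f : HPre s s') (g : ∀ i, HPre (t i) (t' i)) :
      HPre (HObj.mul σ φ s t) (HObj.mul σ φ s' t')
  | γ {T S : Ω} (σ : T ⟶ S) {F : Tip S → Ω} (φ : ∀ i, Fibre σ i (F i)) :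
      HPre (HObj.mul σ φ (HObj.gen S) fun i => HObj.gen (F i)) (HObj.gen T)
  | ε : HPre HObj.unit (HObj.gen Arities.U)

/-- Equality of formal composites modulo the axioms of a category, functoriality of the
multiplication, the (strict) axioms of a categorical operad and the axioms of an internal operad.
Related morphisms have equal sources and equal targets, but these equalities need not hold by
definition, whence the heterogeneous form. -/
inductive HRel : ∀ {T : Ω} {w w' x x' : HObj T}, HPre w w' → HPre x x' → Prop
  | refl {T : Ω} {w w' : HObj T} (f : HPre w w') : HRel f f
  | symm {T : Ω} {w w' x x' : HObj T} {f : HPre w w'} {g : HPre x x'} : HRel f g → HRel g f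
  | trans {T : Ω} {w w' x x' y y' : HObj T} {f : HPre w w'} {g : HPre x x'} {h : HPre y y'} :
      HRel f g → HRel g h → HRel f h
  | comp_congr {T : Ω} {w w' w'' x x' x'' : HObj T} {f : HPre w w'} {g : HPre w' w''}
      {f' : HPre x x'} {g' : HPre x' x''} : HRel f f' → HRel g g' → HRel (.comp f g) (.comp f' g')
  | mul_congr {T S : Ω} (σ : T ⟶ S) {F : Tip S → Ω} (φ : ∀ i, Fibre σ i (F i))
      {s s' r r' : HObj S} {t t' q q' : ∀ i, HObj (F i)} {f : HPre s s'} {f' : HPre r r'}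
      {g : ∀ i, HPre (t i) (t' i)} {g' : ∀ i, HPre (q i) (q' i)} :
      HRel f f' → (∀ i, HRel (g i) (g' i)) → HRel (.mul σ φ f g) (.mul σ φ f' g')
  | id_comp {T : Ω} {w w' : HObj T} (f : HPre w w') : HRel (.comp (.id w) f) f
  | comp_id {T : Ω} {w w' : HObj T} (f : HPre w w') : HRel (.comp f (.id w')) f
  | comp_assoc {T : Ω} {w w' w'' w''' : HObj T} (f : HPre w w') (g : HPre w' w'')
      (h : HPre w'' w''') : HRel (.comp (.comp f g) h) (.comp f (.comp g h))
  | mul_ids {T S : Ω} (σ : T ⟶ S) {F : Tip S → Ω} (φ : ∀ i, Fibre σ i (F i))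
      (s : HObj S) (t : ∀ i, HObj (F i)) :
      HRel (.mul σ φ (.id s) fun i => .id (t i)) (.id (HObj.mul σ φ s t))
  | mul_comp {T S : Ω} (σ : T ⟶ S) {F : Tip S → Ω} (φ : ∀ i, Fibre σ i (F i))
      {s s' s'' : HObj S} {t t' t'' : ∀ i, HObj (F i)} (f : HPre s s') (f' : HPre s' s'')
      (g : ∀ i, HPre (t i) (t' i)) (g' : ∀ i, HPre (t' i) (t'' i)) :
      HRel (.mul σ φ (.comp f f') fun i => .comp (g i) (g' i))
        (.comp (.mul σ φ f g) (.mul σ φ f' g'))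
  | assoc {T S R : Ω} (σ : T ⟶ S) (ω : S ⟶ R) {F : Tip S → Ω} (φ : ∀ j, Fibre σ j (F j))
      {G : Tip R → Ω} (ψ : ∀ i, Fibre ω i (G i)) {H : Tip R → Ω} (χ : ∀ i, Fibre (σ ≫ ω) i (H i))
      {r r' : HObj R} {s s' : ∀ i, HObj (G i)} {t t' : ∀ j, HObj (F j)}
      (f : HPre r r') (g : ∀ i, HPre (s i) (s' i)) (h : ∀ j, HPre (t j) (t' j)) :
      HRel (.mul σ φ (.mul ω ψ f g) h)
        (.mul (σ ≫ ω) χ f fun i => .mul ((ψ i).res (χ i))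
          (fun j => (ψ i).resFibre (χ i) j (φ (j ≫ (ψ i).ι))) (g i) fun j => h (j ≫ (ψ i).ι))
  | mul_id {T : Ω} {w w' : HObj T} (f : HPre w w') :
      HRel (.mul (𝟙 T) Fibre.ofId f fun _ => .id HObj.unit) f
  | mul_bang {T : Ω} {w w' : HObj T} (f : HPre w w') :
      HRel (.mul (bang T) (Fibre.ofBang T) (.id HObj.unit) fun _ => f) f
  | γ_assoc {T S R : Ω} (σ : T ⟶ S) (ω : S ⟶ R) {F : Tip S → Ω} (φ : ∀ j, Fibre σ j (F j))
      {G : Tip R → Ω} (ψ : ∀ i, Fibre ω i (G i)) {H : Tip R → Ω}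
      (χ : ∀ i, Fibre (σ ≫ ω) i (H i)) :
      HRel (.comp (.mul σ φ (.γ ω ψ) fun j => .id (HObj.gen (F j))) (.γ σ φ))
        (.comp (.mul (σ ≫ ω) χ (.id (HObj.gen R)) fun i => .γ ((ψ i).res (χ i))
          (fun j => (ψ i).resFibre (χ i) j (φ (j ≫ (ψ i).ι)))) (.γ (σ ≫ ω) χ))
  | γ_id (T : Ω) :
      HRel (.comp (.mul (𝟙 T) Fibre.ofId (.id (HObj.gen T)) fun _ => .ε) (.γ (𝟙 T) Fibre.ofId))
        (.id (HObj.gen T))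
  | γ_bang (T : Ω) :
      HRel (.comp (.mul (bang T) (Fibre.ofBang T) .ε fun _ => .id (HObj.gen T))
        (.γ (bang T) (Fibre.ofBang T))) (.id (HObj.gen T))

instance hSetoid {T : Ω} (w w' : HObj T) : Setoid (HPre w w') where
  r := HRel
  iseqv := ⟨HRel.refl, HRel.symm, HRel.trans⟩

/-- The morphisms of `H_T`. -/
def HHom {T : Ω} (w w' : HObj T) : Type := Quotient (hSetoid w w')

instance (T : Ω) : Category.{0} (HObj T) where
  Hom := HHom
  id w := Quotient.mk _ (.id w)
  comp := Quotient.map₂ HPre.comp fun _ _ h _ _ h' => HRel.comp_congr h h'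
  id_comp := by rintro w w' ⟨f⟩; exact Quotient.sound (.id_comp f)
  comp_id := by rintro w w' ⟨f⟩; exact Quotient.sound (.comp_id f)
  assoc := by rintro w w' w'' w''' ⟨f⟩ ⟨g⟩ ⟨h⟩; exact Quotient.sound (.comp_assoc f g h)

/-- The class of a formal composite. -/
def HPre.toHom {T : Ω} {w w' : HObj T} (f : HPre w w') : w ⟶ w' := Quotient.mk (hSetoid w w') f

theorem HPre.toHom_heq {T : Ω} {w w' x x' : HObj T} {f : HPre w w'} {g : HPre x x'}
    (h : HRel f g) (e : w = x) (e' : w' = x') : HEq f.toHom g.toHom := by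
  subst e e'
  exact heq_of_eq (Quotient.sound h)

theorem HHom.exists_rep {T : Ω} {w w' : HObj T} (f : w ⟶ w') : ∃ g : HPre w w', g.toHom = f :=
  Quotient.exists_rep (s := hSetoid w w') f

noncomputable def HHom.rep {T : Ω} {w w' : HObj T} (f : w ⟶ w') : HPre w w' :=
  Quotient.out (s := hSetoid w w') f

theorem HHom.rep_toHom {T : Ω} {w w' : HObj T} (f : HPre w w') : HRel (HHom.rep f.toHom) f :=
  Quotient.mk_out (s := hSetoid w w') f

/-- The multiplication of `H`. -/
noncomputable def hMul {T S : Ω} (σ : T ⟶ S) {F : Tip S → Ω} (φ : ∀ i, Fibre σ i (F i)) :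
    HObj S × (∀ i, HObj (F i)) ⥤ HObj T where
  obj p := HObj.mul σ φ p.1 p.2
  map k := (HPre.mul σ φ (HHom.rep k.1) fun i => HHom.rep (k.2 i)).toHom
  map_id p := Quotient.sound (.trans (.mul_congr σ φ (HHom.rep_toHom (.id p.1))
    fun i => HHom.rep_toHom (.id (p.2 i))) (.mul_ids σ φ p.1 p.2))
  map_comp k l := Quotient.sound (by
    refine .trans (.mul_congr σ φ ?_ fun i => ?_) (.mul_comp σ φ _ _ _ _)
    · obtain ⟨f, hf⟩ := HHom.exists_rep k.1
      obtain ⟨g, hg⟩ := HHom.exists_rep l.1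
      rw [CategoryTheory.prod_comp_fst, ← hf, ← hg]
      exact .trans (HHom.rep_toHom (.comp f g))
        (.comp_congr (.symm (HHom.rep_toHom f)) (.symm (HHom.rep_toHom g)))
    · obtain ⟨f, hf⟩ := HHom.exists_rep (k.2 i)
      obtain ⟨g, hg⟩ := HHom.exists_rep (l.2 i)
      rw [CategoryTheory.prod_comp_snd, Pi.comp_apply, ← hf, ← hg]
      exact .trans (HHom.rep_toHom (.comp f g))
        (.comp_congr (.symm (HHom.rep_toHom f)) (.symm (HHom.rep_toHom g))))

theorem hMul_map {T S : Ω} (σ : T ⟶ S) {F : Tip S → Ω} (φ : ∀ i, Fibre σ i (F i))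
    {p q : HObj S × (∀ i, HObj (F i))} (k : p ⟶ q) (f : HPre p.1 q.1)
    (g : ∀ i, HPre (p.2 i) (q.2 i)) (hf : f.toHom = k.1) (hg : ∀ i, (g i).toHom = k.2 i) :
    (hMul σ φ).map k = (HPre.mul σ φ f g).toHom :=
  Quotient.sound (.mul_congr σ φ (by rw [← hf]; exact HHom.rep_toHom f)
    fun i => by rw [← hg i]; exact HHom.rep_toHom (g i))

/-- The categorical operad `H`: `H^n` for `Ω = Ω_n`, and `H^∞` for `Ω = Ω^s`. -/
noncomputable def hOperad (Ω : Type) [Category.{0} Ω] [Arities Ω] : CatOperad.{0, 0} Ω where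
  obj := HObj
  unit := HObj.unit
  mul := hMul
  assoc {T S R} σ ω {F} φ {G} ψ {H} χ := by
    refine Functor.hext (fun p => HObj.assoc σ ω φ ψ χ p.1.1 p.1.2 p.2) ?_
    intro p q k
    obtain ⟨f, hf⟩ := HHom.exists_rep k.1.1
    choose g hg using fun i => HHom.exists_rep (k.1.2 i)
    choose h hh using fun j => HHom.exists_rep (k.2 j)
    refine HEq.trans (heq_of_eq (hMul_map σ φ _ (.mul ω ψ f g) h
      (hMul_map ω ψ k.1 f g hf hg).symm hh)) (HEq.trans (HPre.toHom_heq (.assoc σ ω φ ψ χ f g h)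
        (HObj.assoc σ ω φ ψ χ p.1.1 p.1.2 p.2) (HObj.assoc σ ω φ ψ χ q.1.1 q.1.2 q.2))
      (heq_of_eq ?_))
    exact (hMul_map (σ ≫ ω) χ
      (p := (p.1.1, fun i => HObj.mul _ _ (p.1.2 i) fun j => p.2 (j ≫ (ψ i).ι)))
      (q := (q.1.1, fun i => HObj.mul _ _ (q.1.2 i) fun j => q.2 (j ≫ (ψ i).ι)))
      (CategoryTheory.Prod.mkHom k.1.1 fun i => (hMul _ _).map
        (CategoryTheory.Prod.mkHom (X₁ := p.1.2 i) (X₂ := q.1.2 i)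
          (Y₁ := fun j => p.2 (j ≫ (ψ i).ι)) (Y₂ := fun j => q.2 (j ≫ (ψ i).ι))
          (k.1.2 i) fun j => k.2 (j ≫ (ψ i).ι))) f _ hf fun i =>
      (hMul_map _ _ (p := (p.1.2 i, fun j => p.2 (j ≫ (ψ i).ι)))
        (q := (q.1.2 i, fun j => q.2 (j ≫ (ψ i).ι)))
        (CategoryTheory.Prod.mkHom (k.1.2 i) fun j => k.2 (j ≫ (ψ i).ι))
        (g i) (fun j => h (j ≫ (ψ i).ι)) (hg i) fun j => hh _).symm).symm
  mul_id T := by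
    refine Functor.hext (fun x => HObj.mul_id x) ?_
    intro x y k
    obtain ⟨f, hf⟩ := HHom.exists_rep k
    refine HEq.trans (heq_of_eq (hMul_map (𝟙 T) Fibre.ofId _ f (fun _ => .id HObj.unit) hf
      fun _ => rfl)) (HEq.trans (HPre.toHom_heq (.mul_id f) (HObj.mul_id x) (HObj.mul_id y))
        (heq_of_eq hf))
  mul_bang T := by
    refine Functor.hext (fun x => HObj.mul_bang x) ?_
    intro x y k
    obtain ⟨f, hf⟩ := HHom.exists_rep k
    refine HEq.trans (heq_of_eq (hMul_map (bang T) (Fibre.ofBang T) _ (.id HObj.unit) (fun _ => f)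
      rfl fun _ => hf)) (HEq.trans (HPre.toHom_heq (.mul_bang f) (HObj.mul_bang x)
        (HObj.mul_bang y)) (heq_of_eq hf))

/-! For an internal collection `x` in `A` let `x̃ : H_d ⟶ A` be the operadic functor from the
discrete operad of objects of `H` with `x̃([T]) = x_T`. -/

/-- The value `x̃(W)` at an expression `W`, as a functor of `x`. -/
def Expr.tilde (A : CatOperad.{v, u} Ω) : ∀ {T : Ω}, Expr T → (IColl A ⥤ A.obj T)
  | _, .gen T => Pi.eval _ T
  | _, .unit => (Functor.const _).obj A.unit
  | _, .mul σ φ s t => Functor.prod' (s.tilde A) (Functor.pi' fun i => (t i).tilde A) ⋙ A.mul σ φ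

theorem ExprEq.tilde_eq (A : CatOperad.{v, u} Ω) {T : Ω} {x y : Expr T} (h : ExprEq x y) :
    x.tilde A = y.tilde A := by
  induction h with
  | refl => rfl
  | symm _ ih => exact ih.symm
  | trans _ _ ih ih' => exact ih.trans ih'
  | congr σ φ _ _ ih ih' => simp only [Expr.tilde, ih, ih']
  | assoc σ ω φ ψ χ r s t =>
    exact congrArg (fun M => Functor.prod' (Functor.prod' (r.tilde A)
      (Functor.pi' fun i => (s i).tilde A)) (Functor.pi' fun j => (t j).tilde A) ⋙ M)
      (A.assoc σ ω φ ψ χ)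
  | mul_id x => exact congrArg (fun M => x.tilde A ⋙ M) (A.mul_id _)
  | mul_bang x => exact congrArg (fun M => x.tilde A ⋙ M) (A.mul_bang _)

/-- The functor `x ↦ x̃(W)` for an object `W` of `H_T`. -/
def tilde (A : CatOperad.{v, u} Ω) {T : Ω} (W : HObj T) : IColl A ⥤ A.obj T :=
  Quotient.lift (fun x : Expr T => x.tilde A) (fun _ _ h => ExprEq.tilde_eq A h) W

end Representing

/-- Iterates of an endofunctor. -/
def iterate {C : Type u} [Category.{v} C] (M : C ⥤ C) : ℕ → (C ⥤ C)
  | 0 => 𝟭 C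
  | k + 1 => iterate M k ⋙ M

/-! ## Trees and `n`-operads -/

/-- An `n`-tree: a chain `[k_n] ⟶ ⋯ ⟶ [k_1] ⟶ [k_0] = [1]` of order preserving maps of ordinals. -/
structure NTree (n : ℕ) where
  card : Fin (n + 1) → ℕ
  card_zero : card 0 = 1
  ρ : ∀ m : Fin n, Fin (card m.succ) →o Fin (card m.castSucc)

namespace NTree

variable {n : ℕ}

/-- A morphism of `n`-trees: levelwise maps which commute with the structure maps `ρ` and preserve
the order on the fibres of `ρ`. -/
@[ext]
structure Hom (T S : NTree n) where
  app : ∀ m : Fin (n + 1), Fin (T.card m) → Fin (S.card m)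
  comm : ∀ (m : Fin n) x, app m.castSucc (T.ρ m x) = S.ρ m (app m.succ x)
  mono : ∀ (m : Fin n) x y, T.ρ m x = T.ρ m y → x ≤ y → app m.succ x ≤ app m.succ y

/-- The category `Ω_n`. -/
instance : Category.{0} (NTree n) where
  Hom := Hom
  id T := ⟨fun _ x => x, fun _ _ => rfl, fun _ _ _ _ h => h⟩
  comp f g := ⟨fun m x => g.app m (f.app m x), fun m x => by rw [f.comm, g.comm],
    fun m x y h h' => g.mono m _ _ (by rw [← f.comm, ← f.comm, h]) (f.mono m x y h h')⟩

@[ext]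
theorem hom_ext {T S : NTree n} {f g : T ⟶ S} (h : ∀ m x, f.app m x = g.app m x) : f = g :=
  Hom.ext (funext fun m => funext fun x => h m x)

/-- The linear tree `U_n`. -/
def linear (n : ℕ) : NTree n := ⟨fun _ => 1, rfl, fun _ => OrderHom.id⟩

theorem linear_ext {m : Fin (n + 1)} (x y : Fin ((linear n).card m)) : x = y :=
  Subsingleton.elim (α := Fin 1) x y

instance : Arities (NTree n) where
  U := linear n
  isTerminal := IsTerminal.ofUniqueHom
    (fun _ => ⟨fun _ _ => (0 : Fin 1), fun _ _ => linear_ext _ _, fun _ _ _ _ _ => le_rfl⟩)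
    fun _ _ => hom_ext fun _ _ => linear_ext _ _
  incl := fun _ _ f => ∀ m, StrictMono (f.app m)
  incl_tip _ _ x y h := absurd (linear_ext x y) h.ne
  incl_id _ _ _ _ h := h
  incl_of_comp _ _ hg hfg m _ _ h := (hg m).lt_iff_lt.1 (hfg m h)

/-! Fibres in `Ω_n` exist and are unique; they are computed levelwise. -/

theorem isPullback_of {T S F : NTree n} {σ : T ⟶ S} {i : Tip S} (ι : F ⟶ T)
    (hι : ∀ m, StrictMono (ι.app m))
    (hr : ∀ m x, σ.app m x = i.app m (0 : Fin 1) ↔ x ∈ Set.range (ι.app m)) :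
    IsPullback ι (bang F) σ i := by
  have w : ι ≫ σ = bang F ≫ i := hom_ext fun m x =>
    ((hr m _).2 ⟨x, rfl⟩).trans (congrArg (i.app m) (linear_ext _ _))
  have hs : ∀ (s : PullbackCone σ i) m x, σ.app m (s.fst.app m x) = i.app m (0 : Fin 1) :=
    fun s m x => (congrArg (fun f : s.pt ⟶ S => f.app m x) s.condition).trans
      (congrArg (i.app m) (linear_ext _ _))
  let l : ∀ (s : PullbackCone σ i) m, Fin (s.pt.card m) → Fin (F.card m) :=
    fun s m x => ((hr m _).1 (hs s m x)).choose
  have hl : ∀ s m x, ι.app m (l s m x) = s.fst.app m x :=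
    fun s m x => ((hr m _).1 (hs s m x)).choose_spec
  refine ⟨⟨w⟩, ⟨PullbackCone.IsLimit.mk w (fun s => ⟨l s, ?_, ?_⟩) ?_ ?_ ?_⟩⟩
  · intro m x
    apply (hι _).injective
    rw [hl, ι.comm, hl, s.fst.comm]
  · intro m x y h hle
    rw [← (hι _).le_iff_le, hl, hl]
    exact s.fst.mono m x y h hle
  · intro s
    exact hom_ext (hl s)
  · intro s
    exact toU_ext _ _
  · intro s g hg _
    refine hom_ext fun m x => (hι m).injective ?_
    exact (congrArg (fun f : s.pt ⟶ T => f.app m x) hg).trans (hl s m x).symm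

theorem exists_fibre_range {T S : NTree n} (σ : T ⟶ S) (i : Tip S) :
    ∃ (F : NTree n) (φ : Fibre σ i F),
      ∀ m x, σ.app m x = i.app m (0 : Fin 1) ↔ x ∈ Set.range (φ.ι.app m) := by
  classical
  let s : ∀ m, Finset (Fin (T.card m)) :=
    fun m => Finset.univ.filter fun x => σ.app m x = i.app m (0 : Fin 1)
  have hs : ∀ m x, x ∈ s m ↔ σ.app m x = i.app m (0 : Fin 1) := fun m x => by simp [s]
  let e : ∀ m, Fin (s m).card ≃o s m := fun m => (s m).orderIsoOfFin rfl
  have hρ : ∀ (m : Fin n) (x : Fin (s m.succ).card), T.ρ m (e m.succ x) ∈ s m.castSucc := by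
    intro m x
    rw [hs, σ.comm, (hs _ _).1 (e m.succ x).2]
    exact (i.comm m (0 : Fin 1)).symm.trans (congrArg (i.app _) (linear_ext _ _))
  have h0 : (s 0).card = 1 := by
    have : s 0 = Finset.univ := by
      ext x
      have : Subsingleton (Fin (S.card 0)) := by rw [S.card_zero]; infer_instance
      simp only [hs, Finset.mem_univ, iff_true]
      exact Subsingleton.elim _ _
    rw [this, Finset.card_univ, Fintype.card_fin, T.card_zero]
  let F : NTree n :=
    { card := fun m => (s m).card
      card_zero := h0
      ρ := fun m => ⟨fun x => (e m.castSucc).symm ⟨T.ρ m (e m.succ x), hρ m x⟩, fun x y h =>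
        (e m.castSucc).symm.monotone ((T.ρ m).monotone ((e m.succ).monotone h))⟩ }
  let ι : F ⟶ T := ⟨fun m x => (e m x : Fin (T.card m)),
    fun m x => congrArg Subtype.val ((e m.castSucc).apply_symm_apply _),
    fun m x y _ h => (e m.succ).monotone h⟩
  have hι : ∀ m, StrictMono (ι.app m) := fun m => (e m).strictMono
  have hr : ∀ m x, σ.app m x = i.app m (0 : Fin 1) ↔ x ∈ Set.range (ι.app m) := by
    intro m x
    rw [← hs]
    constructor
    · intro h
      exact ⟨(e m).symm ⟨x, h⟩, congrArg Subtype.val ((e m).apply_symm_apply _)⟩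
    · rintro ⟨y, rfl⟩
      exact (e m y).2
  exact ⟨F, ⟨ι, isPullback_of ι hι hr, hι⟩, hr⟩

theorem exists_fibre {T S : NTree n} (σ : T ⟶ S) (i : Tip S) :
    ∃ F : NTree n, Nonempty (Fibre σ i F) :=
  let ⟨F, φ, _⟩ := exists_fibre_range σ i
  ⟨F, ⟨φ⟩⟩

theorem mem_range_iff {T S F : NTree n} {σ : T ⟶ S} {i : Tip S} (φ : Fibre σ i F)
    (m : Fin (n + 1)) (x : Fin (T.card m)) :
    σ.app m x = i.app m (0 : Fin 1) ↔ x ∈ Set.range (φ.ι.app m) := by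
  obtain ⟨E, ψ, h⟩ := exists_fibre_range σ i
  rw [h]
  have key : ∀ {E E' : NTree n} (φ : Fibre σ i E) (φ' : Fibre σ i E'),
      x ∈ Set.range (φ.ι.app m) → x ∈ Set.range (φ'.ι.app m) := by
    rintro E E' φ φ' ⟨y, rfl⟩
    refine ⟨(φ'.isPullback.lift φ.ι (bang E) φ.isPullback.w).app m y, ?_⟩
    exact congrArg (fun f : E ⟶ T => f.app m y) (φ'.isPullback.lift_fst _ _ _)
  exact ⟨key ψ φ, key φ ψ⟩

theorem fibre_unique {T S F F' : NTree n} {σ : T ⟶ S} {i : Tip S} (φ : Fibre σ i F)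
    (φ' : Fibre σ i F') : F = F' ∧ HEq φ φ' := by
  have hr : ∀ m, Set.range (φ.ι.app m) = Set.range (φ'.ι.app m) := fun m => by
    ext x
    rw [← mem_range_iff φ, ← mem_range_iff φ']
  have hc : F.card = F'.card := by
    funext m
    have h1 := Set.card_range_of_injective (φ.incl m).injective
    have h2 := Set.card_range_of_injective (φ'.incl m).injective
    rw [Fintype.card_fin] at h1 h2
    rw [← h1, ← h2]
    exact Fintype.card_congr (Equiv.setCongr (hr m))
  obtain ⟨c, h0, ρ⟩ := F
  obtain ⟨c', h0', ρ'⟩ := F'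
  obtain rfl : c = c' := hc
  have hι : φ.ι.app = φ'.ι.app := funext fun m =>
    (StrictMono.range_inj (φ.incl m) (φ'.incl m)).1 (hr m)
  have hρ : ρ = ρ' := by
    funext m
    refine OrderHom.ext _ _ (funext fun x => (φ.incl _).injective ?_)
    refine (φ.ι.comm m x).trans ?_
    rw [hι]
    exact (φ'.ι.comm m x).symm
  subst hρ
  refine ⟨rfl, heq_of_eq ?_⟩
  cases φ; cases φ'
  congr 1
  exact Hom.ext hι

end NTree

/-! ## Finite ordinals and symmetric operads -/

/-- The ordinal `[n]`. -/
structure FinOrd where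
  card : ℕ

namespace FinOrd

/-- The category `Ω^s` of finite ordinals and all maps. -/
instance : Category.{0} FinOrd where
  Hom T S := Fin T.card → Fin S.card
  id _ := fun x => x
  comp f g := fun x => g (f x)

/-- The underlying function of a morphism. -/
def fn {T S : FinOrd} (f : T ⟶ S) : Fin T.card → Fin S.card := f

instance : Arities FinOrd where
  U := ⟨1⟩
  isTerminal := IsTerminal.ofUniqueHom (fun _ => fun _ => (0 : Fin 1))
    fun _ _ => funext fun _ => Subsingleton.elim (α := Fin 1) _ _
  incl := fun _ _ f => StrictMono (fn f)
  incl_tip _ x y h := absurd (Subsingleton.elim (α := Fin 1) x y) h.ne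
  incl_id _ _ _ h := h
  incl_of_comp _ _ hg hfg _ _ h := hg.lt_iff_lt.1 (hfg h)

/-- Order preserving maps. -/
def OrdPres {T S : FinOrd} (σ : T ⟶ S) : Prop := Monotone (fn σ)

/-- `π` preserves the order on the fibres of `σ`. -/
def FibrePres {T S T' : FinOrd} (σ : T ⟶ S) (π : T ⟶ T') : Prop :=
  ∀ x y, fn σ x = fn σ y → x ≤ y → fn π x ≤ fn π y

/-- The point of `S` named by a tip. -/
def pt {S : FinOrd} (i : Tip S) : Fin S.card := fn i (0 : Fin 1)

theorem tip_ext {S : FinOrd} {i j : Tip S} (h : pt i = pt j) : i = j :=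
  funext fun x => by
    have : x = (0 : Fin 1) := Subsingleton.elim (α := Fin 1) _ _
    rw [this]; exact h

def tipOf {S : FinOrd} (x : Fin S.card) : Tip S := fun _ => x

theorem hom_ext' {T S : FinOrd} {f g : T ⟶ S} (h : ∀ x, fn f x = fn g x) : f = g := funext h

theorem fn_comp {T S R : FinOrd} (f : T ⟶ S) (g : S ⟶ R) (x : Fin T.card) :
    fn (f ≫ g) x = fn g (fn f x) := rfl

theorem isPullback_of {T S F : FinOrd} {σ : T ⟶ S} {i : Tip S} (ι : F ⟶ T)
    (hinj : Function.Injective (fn ι))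
    (hr : ∀ x, fn σ x = pt i ↔ x ∈ Set.range (fn ι)) : IsPullback ι (bang F) σ i := by
  have w : ι ≫ σ = bang F ≫ i := hom_ext' fun x => by
    rw [fn_comp, (hr _).2 ⟨x, rfl⟩]
    exact congrArg (fn i) (Subsingleton.elim (α := Fin 1) _ _)
  have hs : ∀ (s : PullbackCone σ i) (x : Fin s.pt.card), fn σ (fn s.fst x) = pt i := fun s x =>
    (congrFun s.condition x).trans (congrArg (fn i) (Subsingleton.elim (α := Fin 1) _ _))
  refine ⟨⟨w⟩, ⟨PullbackCone.IsLimit.mk w (fun s => fun x => ((hr _).1 (hs s x)).choose)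
    ?_ ?_ ?_⟩⟩
  · intro s
    exact funext fun x => ((hr _).1 (hs s x)).choose_spec
  · intro s
    exact toU_ext _ _
  · intro s m hm _
    refine funext fun x => hinj ?_
    refine Eq.trans (congrFun hm x) ?_
    exact ((hr _).1 (hs s x)).choose_spec.symm

theorem mem_range_iff {T S F : FinOrd} {σ : T ⟶ S} {i : Tip S} (φ : Fibre σ i F)
    (x : Fin T.card) : fn σ x = pt i ↔ x ∈ Set.range (fn φ.ι) := by
  constructor
  · intro h
    have w : (tipOf x : Tip T) ≫ σ = 𝟙 _ ≫ i := tip_ext h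
    refine ⟨pt (φ.isPullback.lift (tipOf x) (𝟙 _) w), ?_⟩
    exact congrFun (φ.isPullback.lift_fst (tipOf x) (𝟙 _) w) (0 : Fin 1)
  · rintro ⟨y, rfl⟩
    exact (congrFun φ.isPullback.w y).trans
      (congrArg (fn i) (Subsingleton.elim (α := Fin 1) _ _))

theorem fn_fibre {T S F : FinOrd} {σ : T ⟶ S} {i : Tip S} (φ : Fibre σ i F) (x : Fin F.card) :
    fn σ (fn φ.ι x) = pt i := (mem_range_iff φ _).2 ⟨x, rfl⟩

theorem strictMono_ι {T S F : FinOrd} {σ : T ⟶ S} {i : Tip S} (φ : Fibre σ i F) :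
    StrictMono (fn φ.ι) := φ.incl

/-- Fibres exist. -/
theorem exists_fibre {T S : FinOrd} (σ : T ⟶ S) (i : Tip S) :
    ∃ F : FinOrd, Nonempty (Fibre σ i F) := by
  classical
  let s : Finset (Fin T.card) := Finset.univ.filter fun x => fn σ x = pt i
  refine ⟨⟨s.card⟩, ⟨⟨s.orderEmbOfFin rfl, isPullback_of _ (s.orderEmbOfFin rfl).injective ?_,
    (s.orderEmbOfFin rfl).strictMono⟩⟩⟩
  intro x
  have : x ∈ Set.range (s.orderEmbOfFin rfl) ↔ x ∈ s := by
    rw [Finset.range_orderEmbOfFin, Finset.mem_coe]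
  refine Iff.trans ?_ this.symm
  simp [s]

instance {T S F : FinOrd} (σ : T ⟶ S) (i : Tip S) : Subsingleton (Fibre σ i F) where
  allEq φ φ' := by
    have h : fn φ.ι = fn φ'.ι := by
      refine (StrictMono.range_inj (strictMono_ι φ) (strictMono_ι φ')).1 ?_
      ext x
      rw [← mem_range_iff φ, ← mem_range_iff φ']
    cases φ; cases φ'
    cases h
    rfl

/-- Fibres are unique. -/
theorem fibre_unique {T S F F' : FinOrd} {σ : T ⟶ S} {i : Tip S} (φ : Fibre σ i F)
    (φ' : Fibre σ i F') : F = F' ∧ HEq φ φ' := by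
  have hr : Set.range (fn φ.ι) = Set.range (fn φ'.ι) := by
    ext x
    rw [← mem_range_iff φ, ← mem_range_iff φ']
  have h1 := Set.card_range_of_injective (strictMono_ι φ).injective
  have h2 := Set.card_range_of_injective (strictMono_ι φ').injective
  rw [Fintype.card_fin] at h1 h2
  obtain ⟨c⟩ := F
  obtain ⟨c'⟩ := F'
  obtain rfl : c = c' := by
    change Fintype.card _ = c at h1
    change Fintype.card _ = c' at h2
    rw [← h1, ← h2]
    exact Fintype.card_congr (Equiv.setCongr hr)
  exact ⟨rfl, heq_of_eq (Subsingleton.elim _ _)⟩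

theorem res_ordPres {T S R : FinOrd} {σ : T ⟶ S} {ω : S ⟶ R} {i : Tip R} {G H : FinOrd}
    (ψ : Fibre ω i G) (χ : Fibre (σ ≫ ω) i H) (hσ : OrdPres σ) : OrdPres (ψ.res χ) := by
  intro x y h
  have e : ∀ z, fn ψ.ι (fn (ψ.res χ) z) = fn σ (fn χ.ι z) := fun z => congrFun (ψ.res_ι χ) z
  rw [← (strictMono_ι ψ).le_iff_le, e, e]
  exact hσ ((strictMono_ι χ).monotone h)

theorem ordPres_id (T : FinOrd) : OrdPres (𝟙 T) := fun _ _ h => h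

theorem ordPres_bang (T : FinOrd) : OrdPres (bang T) :=
  fun _ _ _ => le_of_eq (Subsingleton.elim (α := Fin 1) _ _)

theorem ordPres_comp {T S R : FinOrd} {σ : T ⟶ S} {ω : S ⟶ R} (hσ : OrdPres σ) (hω : OrdPres ω) :
    OrdPres (σ ≫ ω) := fun _ _ h => hω (hσ h)

end FinOrd

open FinOrd

set_option linter.checkUnivs false in
/-- A left symmetric categorical operad. -/
structure SymOperad where
  obj : FinOrd → Type u
  [cat : ∀ T, Category.{v} (obj T)]
  /-- The covariant action of bijections. -/
  act : ∀ {T T' : FinOrd} (_π : T ≅ T'), obj T ⥤ obj T'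
  act_refl : ∀ T, act (Iso.refl T) = 𝟭 (obj T)
  act_trans : ∀ {T T' T'' : FinOrd} (π : T ≅ T') (ρ : T' ≅ T''), act (π ≪≫ ρ) = act π ⋙ act ρ
  unit : obj Arities.U
  mul : ∀ {T S : FinOrd} (σ : T ⟶ S) (_hσ : OrdPres σ) {F : Tip S → FinOrd}
    (_φ : ∀ i, Fibre σ i (F i)), obj S × (∀ i, obj (F i)) ⥤ obj T
  assoc : ∀ {T S R : FinOrd} (σ : T ⟶ S) (ω : S ⟶ R) (hσ : OrdPres σ) (hω : OrdPres ω)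
    {F : Tip S → FinOrd} (φ : ∀ j, Fibre σ j (F j)) {G : Tip R → FinOrd}
    (ψ : ∀ i, Fibre ω i (G i)) {H : Tip R → FinOrd} (χ : ∀ i, Fibre (σ ≫ ω) i (H i)),
    (mul ω hω ψ).prod (𝟭 (∀ j, obj (F j))) ⋙ mul σ hσ φ =
      Functor.prod' (CategoryTheory.Prod.fst _ _ ⋙ CategoryTheory.Prod.fst _ _)
        (Functor.pi' fun i =>
          Functor.prod' (CategoryTheory.Prod.fst _ _ ⋙ CategoryTheory.Prod.snd _ _ ⋙ Pi.eval _ i)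
            (Functor.pi' fun j => CategoryTheory.Prod.snd _ _ ⋙ Pi.eval _ (j ≫ (ψ i).ι)) ⋙
          mul ((ψ i).res (χ i)) (res_ordPres (ψ i) (χ i) hσ)
            (fun j => (ψ i).resFibre (χ i) j (φ (j ≫ (ψ i).ι)))) ⋙
      mul (σ ≫ ω) (ordPres_comp hσ hω) χ
  mul_id : ∀ T : FinOrd,
    Functor.prod' (𝟭 (obj T)) (Functor.pi' fun _ : Tip T => (Functor.const _).obj unit) ⋙
      mul (𝟙 T) (ordPres_id T) Fibre.ofId = 𝟭 _
  mul_bang : ∀ T : FinOrd,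
    Functor.prod' ((Functor.const _).obj unit)
        (Functor.pi' fun _ : Tip (Arities.U : FinOrd) => 𝟭 (obj T)) ⋙
      mul (bang T) (ordPres_bang T) (Fibre.ofBang T) = 𝟭 _
  /-- First equivariance condition: `π · m_{σ'}(a; b_{ρ(1)}, …) = m_σ(ρ · a; b_1, …)` if
  `ρ ∘ σ' = σ ∘ π` and `π` preserves the order on the fibres of `σ'`. -/
  equivariance_out : ∀ {T' S' T S : FinOrd} (σ' : T' ⟶ S') (σ : T ⟶ S) (hσ' : OrdPres σ')
    (hσ : OrdPres σ) (π : T' ≅ T) (ρ : S' ≅ S) (_w : σ' ≫ ρ.hom = π.hom ≫ σ)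
    (_hπ : FibrePres σ' π.hom) {F : Tip S → FinOrd} (φ : ∀ i, Fibre σ i (F i))
    (φ' : ∀ i : Tip S', Fibre σ' i (F (i ≫ ρ.hom))),
    Functor.prod' (CategoryTheory.Prod.fst _ _)
        (Functor.pi' fun i : Tip S' =>
          CategoryTheory.Prod.snd (obj S') (∀ j, obj (F j)) ⋙ Pi.eval _ (i ≫ ρ.hom)) ⋙
      mul σ' hσ' φ' ⋙ act π =
    (act ρ).prod (𝟭 (∀ j, obj (F j))) ⋙ mul σ hσ φ
  /-- Second equivariance condition:
  `σ⁻¹ · m_η(a; σ_1 · b_1, …) = σ'⁻¹ · m_{η'}(a; σ'_1 · b_1, …)` if `η ∘ σ = η' ∘ σ'`, where `σ_i`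
  and `σ'_i` are the bijections which `σ` and `σ'` induce on the `i`-th fibres. -/
  equivariance_in : ∀ {T'' T T' S : FinOrd} (σ : T'' ≅ T) (σ' : T'' ≅ T') (η : T ⟶ S)
    (η' : T' ⟶ S) (hη : OrdPres η) (hη' : OrdPres η') (_w : σ.hom ≫ η = σ'.hom ≫ η')
    {F'' F F' : Tip S → FinOrd} (φ'' : ∀ i, Fibre (σ.hom ≫ η) i (F'' i))
    (φ : ∀ i, Fibre η i (F i)) (φ' : ∀ i, Fibre η' i (F' i))
    (σi : ∀ i, F'' i ≅ F i) (σi' : ∀ i, F'' i ≅ F' i)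
    (_h : ∀ i, (σi i).hom ≫ (φ i).ι = (φ'' i).ι ≫ σ.hom)
    (_h' : ∀ i, (σi' i).hom ≫ (φ' i).ι = (φ'' i).ι ≫ σ'.hom),
    (𝟭 (obj S)).prod (Functor.pi fun i => act (σi i)) ⋙ mul η hη φ ⋙ act σ.symm =
      (𝟭 (obj S)).prod (Functor.pi fun i => act (σi' i)) ⋙ mul η' hη' φ' ⋙ act σ'.symm

attribute [instance] SymOperad.cat

/-- Each category is cocomplete and the multiplication preserves colimits in each variable. -/
structure SymOperad.Cocomplete (A : SymOperad.{v, u}) : Prop where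
  hasColimits : ∀ T, HasColimits (A.obj T)
  preserves : ∀ {T S : FinOrd} (σ : T ⟶ S) (hσ : OrdPres σ) {F : Tip S → FinOrd}
    (φ : ∀ i, Fibre σ i (F i)), PreservesColimitsInEachVariable (A.mul σ hσ φ)

/-! ### The `S`-operad of a left symmetric operad -/

namespace FinOrd

/-- The bijection `π(σ)` in the factorisation `σ = ν(σ) ∘ π(σ)` with `ν(σ)` order preserving and
`π(σ)` order preserving on the fibres of `σ`. -/
def sortIso {T S : FinOrd} (σ : T ⟶ S) : T ≅ T where
  hom := (Tuple.sort (fn σ)).symm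
  inv := Tuple.sort (fn σ)
  hom_inv_id := funext fun x => (Tuple.sort (fn σ)).apply_symm_apply x
  inv_hom_id := funext fun x => (Tuple.sort (fn σ)).symm_apply_apply x

/-- The order preserving map `ν(σ)`. -/
def sorted {T S : FinOrd} (σ : T ⟶ S) : T ⟶ S := (sortIso σ).inv ≫ σ

theorem sorted_ordPres {T S : FinOrd} (σ : T ⟶ S) : OrdPres (sorted σ) :=
  Tuple.monotone_sort (fn σ)

theorem sortIso_comp {T S : FinOrd} (σ : T ⟶ S) : (sortIso σ).hom ≫ sorted σ = σ := by
  rw [sorted, Iso.hom_inv_id_assoc]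

theorem inv_hom_apply {T T' : FinOrd} (π : T ≅ T') (x : Fin T'.card) :
    fn π.hom (fn π.inv x) = x := congrFun π.inv_hom_id x

theorem hom_inv_apply {T T' : FinOrd} (π : T ≅ T') (x : Fin T.card) :
    fn π.inv (fn π.hom x) = x := congrFun π.hom_inv_id x

theorem FibrePres.inv {T S T' : FinOrd} {σ : T ⟶ S} {π : T ≅ T'} (h : FibrePres σ π.hom) :
    FibrePres (π.inv ≫ σ) π.inv := by
  intro x y hxy hle
  by_contra hlt
  have h1 := h (fn π.inv y) (fn π.inv x) hxy.symm (le_of_not_ge hlt)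
  rw [inv_hom_apply, inv_hom_apply] at h1
  exact hlt (le_of_eq (by rw [le_antisymm hle h1]))

theorem sortIso_fibrePres {T S : FinOrd} (σ : T ⟶ S) : FibrePres σ (sortIso σ).hom := by
  have h := (Tuple.eq_sort_iff (f := fn σ) (σ := Tuple.sort (fn σ))).1 rfl
  have h' : FibrePres (sorted σ) (sortIso σ).inv := by
    intro x y hxy hle
    rcases hle.eq_or_lt with rfl | hlt
    · exact le_rfl
    · exact (h.2 x y hlt hxy).le
  have := FibrePres.inv (σ := sorted σ) (π := (sortIso σ).symm) h'
  have e : (sortIso σ).symm.inv ≫ sorted σ = σ := sortIso_comp σ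
  rwa [e] at this

end FinOrd

/-- The fibres of `σ` are the fibres of `ν` if `σ = ν ∘ π` with `π` a bijection preserving the order
on the fibres of `σ`. -/
def Fibre.push {T T' S F : FinOrd} {σ : T ⟶ S} {i : Tip S} (φ : Fibre σ i F) (π : T ≅ T')
    (ν : T' ⟶ S) (w : π.hom ≫ ν = σ) (h : FibrePres σ π.hom) : Fibre ν i F where
  ι := φ.ι ≫ π.hom
  isPullback := by
    have hinj : Function.Injective (fn π.hom) :=
      Function.LeftInverse.injective (hom_inv_apply π)
    refine isPullback_of _ (hinj.comp (strictMono_ι φ).injective) fun x => ?_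
    subst w
    have := mem_range_iff φ (fn π.inv x)
    rw [fn_comp, inv_hom_apply] at this
    rw [this]
    constructor
    · rintro ⟨y, hy⟩
      exact ⟨y, by rw [fn_comp, hy, inv_hom_apply]⟩
    · rintro ⟨y, hy⟩
      exact ⟨y, by rw [← hy, fn_comp, hom_inv_apply]⟩
  incl := by
    have hinj : Function.Injective (fn π.hom) :=
      Function.LeftInverse.injective (hom_inv_apply π)
    intro x y hxy
    exact lt_of_le_of_ne (h _ _ ((fn_fibre φ x).trans (fn_fibre φ y).symm)
      ((strictMono_ι φ).monotone hxy.le)) fun e => hxy.ne ((strictMono_ι φ).injective (hinj e))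

theorem Fibre.eqRec_ι {T S F : FinOrd} {σ σ' : T ⟶ S} (e : σ = σ') {i : Tip S}
    (φ : Fibre σ i F) : (e ▸ φ : Fibre σ' i F).ι = φ.ι := by subst e; rfl

def Fibre.post {T S S' F : FinOrd} {σ : T ⟶ S} (ρ : S ≅ S') {i : Tip S'}
    (φ : Fibre σ (i ≫ ρ.inv) F) : Fibre (σ ≫ ρ.hom) i F where
  ι := φ.ι
  isPullback := by
    refine isPullback_of _ (strictMono_ι φ).injective fun x => ?_
    rw [← mem_range_iff φ]
    constructor
    · intro h
      have := congrArg (fn ρ.inv) h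
      rwa [fn_comp, hom_inv_apply] at this
    · intro h
      have := congrArg (fn ρ.hom) h
      exact this.trans (inv_hom_apply ρ _)
  incl := φ.incl

namespace SymOperad

variable (A : SymOperad.{v, u})

/-- The multiplication `m_σ = π(σ)⁻¹ · m_{ν(σ)}` for an arbitrary map `σ`. -/
def sMul {T S : FinOrd} (σ : T ⟶ S) {F : Tip S → FinOrd} (φ : ∀ i, Fibre σ i (F i)) :
    A.obj S × (∀ i, A.obj (F i)) ⥤ A.obj T :=
  A.mul (sorted σ) (sorted_ordPres σ) (fun i =>
    (φ i).push (sortIso σ) (sorted σ) (sortIso_comp σ) (sortIso_fibrePres σ)) ⋙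
  A.act (sortIso σ).symm

/-! In the following the multiplications are applied to functors `s`, `t` into the factors. -/

variable {A} {X : Type u} [Category.{v} X]

theorem m_congr {T S : FinOrd} {σ : T ⟶ S} (hσ : OrdPres σ) {I : Type} (F : I → FinOrd)
    (t : ∀ j, X ⥤ A.obj (F j)) (s : X ⥤ A.obj S) {e e' : Tip S → I} (he : e = e')
    (φ : ∀ i, Fibre σ i (F (e i))) (φ' : ∀ i, Fibre σ i (F (e' i))) :
    Functor.prod' s (Functor.pi' fun i => t (e i)) ⋙ A.mul σ hσ φ =
      Functor.prod' s (Functor.pi' fun i => t (e' i)) ⋙ A.mul σ hσ φ' := by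
  subst he
  obtain rfl : φ = φ' := Subsingleton.elim _ _
  rfl

theorem m_assoc {T S R : FinOrd} (σ : T ⟶ S) (ω : S ⟶ R) (hσ : OrdPres σ) (hω : OrdPres ω)
    {F : Tip S → FinOrd} (φ : ∀ j, Fibre σ j (F j)) {G : Tip R → FinOrd}
    (ψ : ∀ i, Fibre ω i (G i)) {H : Tip R → FinOrd} (χ : ∀ i, Fibre (σ ≫ ω) i (H i))
    (r : X ⥤ A.obj R) (s : ∀ i, X ⥤ A.obj (G i)) (t : ∀ j, X ⥤ A.obj (F j)) :
    Functor.prod' (Functor.prod' r (Functor.pi' s) ⋙ A.mul ω hω ψ) (Functor.pi' t) ⋙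
        A.mul σ hσ φ =
      Functor.prod' r (Functor.pi' fun i =>
        Functor.prod' (s i) (Functor.pi' fun j => t (j ≫ (ψ i).ι)) ⋙
          A.mul ((ψ i).res (χ i)) (res_ordPres (ψ i) (χ i) hσ)
            (fun j => (ψ i).resFibre (χ i) j (φ (j ≫ (ψ i).ι)))) ⋙
        A.mul (σ ≫ ω) (ordPres_comp hσ hω) χ :=
  congrArg (fun M => Functor.prod' (Functor.prod' r (Functor.pi' s)) (Functor.pi' t) ⋙ M)
    (A.assoc σ ω hσ hω φ ψ χ)

theorem m_out {T' S' T S : FinOrd} (σ' : T' ⟶ S') (σ : T ⟶ S) (hσ' : OrdPres σ')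
    (hσ : OrdPres σ) (π : T' ≅ T) (ρ : S' ≅ S) (w : σ' ≫ ρ.hom = π.hom ≫ σ)
    (hπ : FibrePres σ' π.hom) {F : Tip S → FinOrd} (φ : ∀ i, Fibre σ i (F i))
    (φ' : ∀ i : Tip S', Fibre σ' i (F (i ≫ ρ.hom))) (s : X ⥤ A.obj S')
    (t : ∀ i, X ⥤ A.obj (F i)) :
    Functor.prod' s (Functor.pi' fun i : Tip S' => t (i ≫ ρ.hom)) ⋙ A.mul σ' hσ' φ' ⋙ A.act π =
      Functor.prod' (s ⋙ A.act ρ) (Functor.pi' t) ⋙ A.mul σ hσ φ :=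
  congrArg (fun M => Functor.prod' s (Functor.pi' t) ⋙ M)
    (A.equivariance_out σ' σ hσ' hσ π ρ w hπ φ φ')

theorem m_in {T'' T T' S : FinOrd} (σ : T'' ≅ T) (σ' : T'' ≅ T') (η : T ⟶ S)
    (η' : T' ⟶ S) (hη : OrdPres η) (hη' : OrdPres η') (w : σ.hom ≫ η = σ'.hom ≫ η')
    {F'' F F' : Tip S → FinOrd} (φ'' : ∀ i, Fibre (σ.hom ≫ η) i (F'' i))
    (φ : ∀ i, Fibre η i (F i)) (φ' : ∀ i, Fibre η' i (F' i))
    (σi : ∀ i, F'' i ≅ F i) (σi' : ∀ i, F'' i ≅ F' i)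
    (h : ∀ i, (σi i).hom ≫ (φ i).ι = (φ'' i).ι ≫ σ.hom)
    (h' : ∀ i, (σi' i).hom ≫ (φ' i).ι = (φ'' i).ι ≫ σ'.hom)
    (s : X ⥤ A.obj S) (t : ∀ i, X ⥤ A.obj (F'' i)) :
    Functor.prod' s (Functor.pi' fun i => t i ⋙ A.act (σi i)) ⋙ A.mul η hη φ ⋙ A.act σ.symm =
      Functor.prod' s (Functor.pi' fun i => t i ⋙ A.act (σi' i)) ⋙ A.mul η' hη' φ' ⋙
        A.act σ'.symm :=
  congrArg (fun M => Functor.prod' s (Functor.pi' t) ⋙ M)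
    (A.equivariance_in σ σ' η η' hη hη' w φ'' φ φ' σi σi' h h')

/-- Any factorisation `σ = ν ∘ π` with `ν` order preserving and `π` a bijection preserving the order
on the fibres of `σ` may be used to compute `m_σ`. -/
theorem sMul_eq {T T' S : FinOrd} (σ : T ⟶ S) {F : Tip S → FinOrd} (φ : ∀ i, Fibre σ i (F i))
    (π : T ≅ T') (ν : T' ⟶ S) (hν : OrdPres ν) (w : π.hom ≫ ν = σ) (h : FibrePres σ π.hom)
    (φ' : ∀ i, Fibre ν i (F i)) : A.sMul σ φ = A.mul ν hν φ' ⋙ A.act π.symm := by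
  have hw : sorted σ ≫ (Iso.refl S).hom = ((sortIso σ).symm ≪≫ π).hom ≫ ν := by
    simp [w, sorted]
  have hp : FibrePres (sorted σ) ((sortIso σ).symm ≪≫ π).hom := by
    intro x y hxy hle
    have h1 := FibrePres.inv (sortIso_fibrePres σ) x y hxy hle
    exact h _ _ hxy h1
  have key := A.equivariance_out (sorted σ) ν (sorted_ordPres σ) hν ((sortIso σ).symm ≪≫ π)
    (Iso.refl S) hw hp φ' (fun i =>
    (φ i).push (sortIso σ) (sorted σ) (sortIso_comp σ) (sortIso_fibrePres σ))
  rw [A.act_refl, A.act_trans] at key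
  have key' : A.mul (sorted σ) (sorted_ordPres σ) (fun i =>
    (φ i).push (sortIso σ) (sorted σ) (sortIso_comp σ) (sortIso_fibrePres σ)) ⋙
      A.act (sortIso σ).symm ⋙ A.act π = A.mul ν hν φ' := key
  rw [← key']
  have e : A.act π ⋙ A.act π.symm = 𝟭 _ := by rw [← A.act_trans, Iso.self_symm_id, A.act_refl]
  exact (congrArg (fun M => A.sMul σ φ ⋙ M) e).symm

theorem sMul_ordPres {T S : FinOrd} (σ : T ⟶ S) (hσ : OrdPres σ) {F : Tip S → FinOrd}
    (φ : ∀ i, Fibre σ i (F i)) : A.sMul σ φ = A.mul σ hσ φ := by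
  rw [sMul_eq σ φ (Iso.refl T) σ hσ (by simp) (fun _ _ _ h => h) φ]
  exact congrArg (fun M => A.mul σ hσ φ ⋙ M) (A.act_refl T)

theorem sMul_assoc {T S R : FinOrd} (σ : T ⟶ S) (ω : S ⟶ R)
    {F : Tip S → FinOrd} (φ : ∀ j, Fibre σ j (F j)) {G : Tip R → FinOrd}
    (ψ : ∀ i, Fibre ω i (G i)) {H : Tip R → FinOrd} (χ : ∀ i, Fibre (σ ≫ ω) i (H i))
    (r : X ⥤ A.obj R) (s : ∀ i, X ⥤ A.obj (G i)) (t : ∀ j, X ⥤ A.obj (F j)) :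
    Functor.prod' (Functor.prod' r (Functor.pi' s) ⋙ A.sMul ω ψ) (Functor.pi' t) ⋙ A.sMul σ φ =
      Functor.prod' r (Functor.pi' fun i =>
        Functor.prod' (s i) (Functor.pi' fun j => t (j ≫ (ψ i).ι)) ⋙
          A.sMul ((ψ i).res (χ i))
            (fun j => (ψ i).resFibre (χ i) j (φ (j ≫ (ψ i).ι)))) ⋙
        A.sMul (σ ≫ ω) χ := by
  have hκw : (sortIso (σ ≫ (sortIso ω).hom)).hom ≫ sorted (σ ≫ (sortIso ω).hom) =
      σ ≫ (sortIso ω).hom := sortIso_comp _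
  have hκp := sortIso_fibrePres (σ ≫ (sortIso ω).hom)
  have hν := sorted_ordPres (σ ≫ (sortIso ω).hom)
  generalize sortIso (σ ≫ (sortIso ω).hom) = πκ at hκw hκp
  generalize sorted (σ ≫ (sortIso ω).hom) = ν at hκw hν
  -- the fibres of the reordered maps
  let ψ1 : ∀ i, Fibre (sorted ω) i (G i) := fun i =>
    (ψ i).push (sortIso ω) (sorted ω) (sortIso_comp ω) (sortIso_fibrePres ω)
  let φ1 : ∀ i : Tip S, Fibre ν i (F (i ≫ (sortIso ω).symm.hom)) := fun i =>
    Fibre.push (Fibre.post (sortIso ω) (φ (i ≫ (sortIso ω).inv))) πκ ν hκw hκp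
  choose H' χ0 using fun i => exists_fibre (ν ≫ sorted ω) i
  let χ1 : ∀ i, Fibre (ν ≫ sorted ω) i (H' i) := fun i => (χ0 i).some
  have hκω : πκ.hom ≫ ν ≫ sorted ω = σ ≫ ω := by
    rw [← Category.assoc, hκw, Category.assoc, sortIso_comp]
  -- the comparison with the order preserving case
  have hleft : Functor.prod' (Functor.prod' r (Functor.pi' s) ⋙ A.sMul ω ψ) (Functor.pi' t) ⋙
      A.sMul σ φ =
      (Functor.prod' (Functor.prod' r (Functor.pi' s) ⋙ A.mul (sorted ω) (sorted_ordPres ω) ψ1)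
        (Functor.pi' fun i : Tip S => t (i ≫ (sortIso ω).symm.hom)) ⋙ A.mul ν hν φ1) ⋙
        A.act πκ.symm := by
    have hw : ν ≫ (sortIso ω).symm.hom = (πκ.symm ≪≫ sortIso σ).hom ≫ sorted σ := by
      rw [Iso.trans_hom, Category.assoc, sortIso_comp, Iso.symm_hom, Iso.symm_hom,
        Iso.eq_inv_comp, ← Category.assoc, hκw, Category.assoc, Iso.hom_inv_id, Category.comp_id]
    have hp : FibrePres ν (πκ.symm ≪≫ sortIso σ).hom := by
      intro x y hxy hle
      have e : ∀ z, fn ν z = fn (sortIso ω).hom (fn σ (fn πκ.inv z)) := fun z => by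
        have := congrFun hκw (fn πκ.inv z)
        refine Eq.trans ?_ this
        exact congrArg (fn ν) (inv_hom_apply πκ z).symm
      refine sortIso_fibrePres σ _ _ ?_ ?_
      · have := hxy
        rw [e, e] at this
        exact Function.LeftInverse.injective (hom_inv_apply (sortIso ω)) this
      · refine FibrePres.inv hκp x y ?_ hle
        have h2 : πκ.inv ≫ σ ≫ (sortIso ω).hom = ν := by rw [Iso.inv_comp_eq, hκw]
        rw [h2]; exact hxy
    have key := A.m_out ν (sorted σ) hν (sorted_ordPres σ) (πκ.symm ≪≫ sortIso σ) (sortIso ω).symm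
      hw hp (fun i => (φ i).push (sortIso σ) (sorted σ) (sortIso_comp σ) (sortIso_fibrePres σ)) φ1
      (Functor.prod' r (Functor.pi' s) ⋙ A.mul (sorted ω) (sorted_ordPres ω) ψ1) t
    have e : A.act (πκ.symm ≪≫ sortIso σ) ⋙ A.act (sortIso σ).symm = A.act πκ.symm := by
      rw [← A.act_trans, Iso.trans_assoc, Iso.self_symm_id, Iso.trans_refl]
    rw [← e]
    exact (congrArg (fun M => M ⋙ A.act (sortIso σ).symm) key).symm
  have hτ : ∀ i, ∃ τ : H i ≅ H' i, τ.hom ≫ (χ1 i).ι = (χ i).ι ≫ πκ.hom := by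
    intro i
    have hp : IsPullback ((χ i).ι ≫ πκ.hom) (bang (H i)) (ν ≫ sorted ω) i := by
      have hinj : Function.Injective (fn πκ.hom) :=
        Function.LeftInverse.injective (hom_inv_apply πκ)
      refine isPullback_of _ (hinj.comp (strictMono_ι (χ i)).injective) fun x => ?_
      have h1 := mem_range_iff (χ i) (fn πκ.inv x)
      have h2 : fn (σ ≫ ω) (fn πκ.inv x) = fn (ν ≫ sorted ω) x := by
        rw [← hκω, fn_comp, inv_hom_apply]
      rw [h2] at h1
      rw [h1]
      constructor
      · rintro ⟨y, hy⟩
        exact ⟨y, by rw [fn_comp, hy, inv_hom_apply]⟩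
      · rintro ⟨y, hy⟩
        exact ⟨y, by rw [← hy, fn_comp, hom_inv_apply]⟩
    exact ⟨hp.isoIsPullback _ _ (χ1 i).isPullback, hp.isoIsPullback_hom_fst _ _ _⟩
  choose τ hτ using hτ
  have hin : ∀ i, Functor.prod' (s i) (Functor.pi' fun j =>
        t ((j ≫ (ψ1 i).ι) ≫ (sortIso ω).symm.hom)) ⋙
      A.mul ((ψ1 i).res (χ1 i)) (res_ordPres (ψ1 i) (χ1 i) hν)
        (fun j => (ψ1 i).resFibre (χ1 i) j (φ1 (j ≫ (ψ1 i).ι))) =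
      (Functor.prod' (s i) (Functor.pi' fun j => t (j ≫ (ψ i).ι)) ⋙
          A.sMul ((ψ i).res (χ i)) (fun j => (ψ i).resFibre (χ i) j (φ (j ≫ (ψ i).ι)))) ⋙
        A.act (τ i) := by
    intro i
    have hψ : (ψ1 i).ι = (ψ i).ι ≫ (sortIso ω).hom := rfl
    have hw : (τ i).hom ≫ (ψ1 i).res (χ1 i) = (ψ i).res (χ i) := by
      apply (ψ1 i).isPullback.hom_ext
      · rw [Category.assoc, Fibre.res_ι, ← Category.assoc, hτ, Category.assoc, hκw, hψ,
          ← Category.assoc, ← Category.assoc, Fibre.res_ι]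
      · exact toU_ext _ _
    have hp : FibrePres ((ψ i).res (χ i)) (τ i).hom := by
      intro x y hxy hle
      rw [← (strictMono_ι (χ1 i)).le_iff_le]
      have e1 : ∀ z, fn (χ1 i).ι (fn (τ i).hom z) = fn πκ.hom (fn (χ i).ι z) :=
        fun z => congrFun (hτ i) z
      have e2 : ∀ z, fn (ψ i).ι (fn ((ψ i).res (χ i)) z) = fn σ (fn (χ i).ι z) :=
        fun z => congrFun ((ψ i).res_ι (χ i)) z
      rw [e1, e1]
      refine hκp _ _ ?_ ((strictMono_ι (χ i)).monotone hle)
      rw [fn_comp, fn_comp, ← e2, ← e2, hxy]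
    have he : (fun j : Tip (G i) => (j ≫ (ψ1 i).ι) ≫ (sortIso ω).symm.hom) =
        fun j => j ≫ (ψ i).ι := by
      funext j
      rw [hψ, Category.assoc, Category.assoc, Iso.symm_hom, Iso.hom_inv_id, Category.comp_id]
    have hφ2 : ∀ j : Tip (G i), Nonempty (Fibre ((ψ1 i).res (χ1 i)) j (F (j ≫ (ψ i).ι))) :=
      fun j => by
        have ej : (j ≫ (ψ1 i).ι) ≫ (sortIso ω).symm.hom = j ≫ (ψ i).ι := congrFun he j
        rw [← ej]
        exact ⟨(ψ1 i).resFibre (χ1 i) j (φ1 (j ≫ (ψ1 i).ι))⟩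
    let φ2 : ∀ j : Tip (G i), Fibre ((ψ1 i).res (χ1 i)) j (F (j ≫ (ψ i).ι)) :=
      fun j => (hφ2 j).some
    rw [m_congr (res_ordPres (ψ1 i) (χ1 i) hν) F t (s i) he
      (fun j => (ψ1 i).resFibre (χ1 i) j (φ1 (j ≫ (ψ1 i).ι))) φ2]
    rw [sMul_eq _ _ (τ i) ((ψ1 i).res (χ1 i)) (res_ordPres (ψ1 i) (χ1 i) hν) hw hp φ2]
    have e : A.act (τ i).symm ⋙ A.act (τ i) = 𝟭 _ := by
      rw [← A.act_trans, Iso.symm_self_id, A.act_refl]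
    exact (congrArg (fun M => (Functor.prod' (s i) (Functor.pi' fun j => t (j ≫ (ψ i).ι)) ⋙
      A.mul ((ψ1 i).res (χ1 i)) (res_ordPres (ψ1 i) (χ1 i) hν) φ2) ⋙ M) e).symm
  rw [hleft, A.m_assoc ν (sorted ω) hν (sorted_ordPres ω) φ1 ψ1 χ1 r s
    (fun i : Tip S => t (i ≫ (sortIso ω).symm.hom))]
  simp only [hin]
  have key := A.m_in (sortIso (σ ≫ ω)) πκ (sorted (σ ≫ ω)) (ν ≫ sorted ω) (sorted_ordPres _)
    (ordPres_comp hν (sorted_ordPres ω)) (by rw [sortIso_comp, hκω])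
    (fun i => (sortIso_comp (σ ≫ ω)).symm ▸ χ i)
    (fun i => (χ i).push (sortIso (σ ≫ ω)) (sorted (σ ≫ ω)) (sortIso_comp _)
      (sortIso_fibrePres _)) χ1 (fun i => Iso.refl (H i)) τ
    (fun i => by
      rw [Fibre.eqRec_ι]
      exact Category.id_comp _) (fun i => by rw [Fibre.eqRec_ι]; exact hτ i) r
    (fun i => Functor.prod' (s i) (Functor.pi' fun j => t (j ≫ (ψ i).ι)) ⋙
      A.sMul ((ψ i).res (χ i)) (fun j => (ψ i).resFibre (χ i) j (φ (j ≫ (ψ i).ι))))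
  simp only [A.act_refl] at key
  exact key.symm

/-- The categorical `S`-operad `A^s` of a left symmetric categorical operad `A`. -/
def toS (A : SymOperad.{v, u}) : CatOperad.{v, u} FinOrd where
  obj := A.obj
  unit := A.unit
  mul := A.sMul
  assoc σ ω _ φ _ ψ _ χ := A.sMul_assoc σ ω φ ψ χ
    (CategoryTheory.Prod.fst _ _ ⋙ CategoryTheory.Prod.fst _ _)
    (fun i => CategoryTheory.Prod.fst _ _ ⋙ CategoryTheory.Prod.snd _ _ ⋙ Pi.eval _ i)
    (fun j => CategoryTheory.Prod.snd _ _ ⋙ Pi.eval _ j)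
  mul_id T := by rw [A.sMul_ordPres _ (ordPres_id T)]; exact A.mul_id T
  mul_bang T := by rw [A.sMul_ordPres _ (ordPres_bang T)]; exact A.mul_bang T

end SymOperad

end HigherOperad

open HigherOperad

/-! Both parts are instances of one statement about a category of arities in which every arity has
finitely many tips and every fibre exists and is unique; for symmetric operads it is applied to the
associated `S`-operad `A.toS`.

Objects. Every object of `H_T` has a unique normal form: a tree whose nodes are generators, the
subtrees being grafted over the tips of the root. Grafting (`Tr.mul`) satisfies the operad axioms
strictly, so normalisation is well defined (`HObj.nf_mul`, `Tr.nf_toH`, `HObj.toH_nf`).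

Free operads. Put `y_T = ∐ x̃(w)` over all trees `w` of arity `T`. Multiplication in `A` distributes
over coproducts, so a multiplication on `y` may be prescribed summand by summand, and grafting of
trees prescribes it. The axioms reduce to those of grafting, and the universal property holds
because a map from `x` to an operad extends to each tree in just one way (`IOperad.exists_free`,
`IOperad.existsUnique_hom`).

Morphisms. The generator `[S]` is terminal in `H_S`, so decorating every generator `[S]` of `W` by
an object of `H_S` gives a morphism into `W`, whose source is the grafted decoration. Every morphism
into `W` arises from exactly one decoration (`HObj.homOf_bijective`). Existence holds because these
morphisms contain the generating ones and are closed under multiplication and composition. For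
uniqueness, `H` acts on labelled trees by multiplying labels, and the morphism of a decoration
carries the tautological labelling of its source to that decoration.

Iterates. By distributivity, the value at `W` of the free operad on `x` is a coproduct over all
choices of a tree for each generator of `W`, that is, over decorations of `W`, that is, over
morphisms `W' ⟶ W`, with summands `x̃(W')`. Induction on the length of chains then gives the formula
for all iterates. -/

namespace HigherOperad

/-! ## Arities with finitely many tips and unique fibres -/

/-- Every arity has finitely many tips and every fibre exists and is unique. -/
class UniqueFibres (Ω : Type) [Category.{0} Ω] [Arities Ω] : Prop where
  finite_tip : ∀ S : Ω, Finite (Tip S)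
  exists_fibre : ∀ {T S : Ω} (σ : T ⟶ S) (i : Tip S), ∃ F : Ω, Nonempty (Fibre σ i F)
  fibre_unique : ∀ {T S : Ω} {σ : T ⟶ S} {i : Tip S} {F F' : Ω} (φ : Fibre σ i F)
    (φ' : Fibre σ i F'), F = F' ∧ HEq φ φ'

attribute [instance] UniqueFibres.finite_tip

/-! ### Combinatorics of tips and fibres. -/

section Fibres

variable {Ω : Type} [Category.{0} Ω] [Arities Ω]

/-- A fibre of `σ` is a fibre of any map equal to `σ`. -/
def Fibre.ofEq {T S F : Ω} {σ σ' : T ⟶ S} (e : σ = σ') {i : Tip S} (φ : Fibre σ i F) :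
    Fibre σ' i F where
  ι := φ.ι
  isPullback := e ▸ φ.isPullback
  incl := φ.incl

theorem Fibre.hom_ext {T S F E : Ω} {σ : T ⟶ S} {i : Tip S} (φ : Fibre σ i F) {f g : E ⟶ F}
    (h : f ≫ φ.ι = g ≫ φ.ι) : f = g :=
  φ.isPullback.hom_ext h (toU_ext _ _)

theorem Fibre.resFibre_ι {T S R : Ω} {σ : T ⟶ S} {ω : S ⟶ R} {i : Tip R} {G H F : Ω}
    (ψ : Fibre ω i G) (χ : Fibre (σ ≫ ω) i H) (j : Tip G) (φ : Fibre σ (j ≫ ψ.ι) F) :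
    (ψ.resFibre χ j φ).ι ≫ χ.ι = φ.ι :=
  χ.isPullback.lift_fst _ _ _

/-- Two tips of fibres which name the same tip of the total arity agree. -/
theorem Fibre.tip_injective {S R : Ω} {ω : S ⟶ R} {G : Tip R → Ω} (ψ : ∀ i, Fibre ω i (G i))
    {i i' : Tip R} {j : Tip (G i)} {j' : Tip (G i')} (h : j ≫ (ψ i).ι = j' ≫ (ψ i').ι) :
    (⟨i, j⟩ : Σ i, Tip (G i)) = ⟨i', j'⟩ := by
  have key : ∀ (i : Tip R) (j : Tip (G i)), (j ≫ (ψ i).ι) ≫ ω = i := fun i j => by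
    have : bang (G i) ≫ i = (ψ i).ι ≫ ω := (ψ i).isPullback.w.symm
    rw [Category.assoc, ← this, ← Category.assoc, toU_ext (j ≫ bang (G i)) (𝟙 _),
      Category.id_comp]
  obtain rfl : i = i' := by rw [← key i j, h, key]
  rw [(ψ i).hom_ext h]

/-- A tip `k` lies in the fibre over its image `k ≫ ω`. With `Fibre.tip_injective`, the tips of the
source are the disjoint union of the tips of the fibres. -/
theorem Fibre.exists_tip {S R : Ω} {ω : S ⟶ R} {G : Tip R → Ω} (ψ : ∀ i, Fibre ω i (G i))
    (k : Tip S) : ∃ (i : Tip R) (j : Tip (G i)), j ≫ (ψ i).ι = k :=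
  ⟨k ≫ ω, (ψ (k ≫ ω)).isPullback.lift k (𝟙 _) (by simp), (ψ (k ≫ ω)).isPullback.lift_fst _ _ _⟩

/-- A family over the tips of `S` may be prescribed on the fibres of a map out of `S`. -/
theorem Fibre.exists_glue {S R : Ω} {ω : S ⟶ R} {G : Tip R → Ω} (ψ : ∀ i, Fibre ω i (G i))
    {B : Tip S → Type*} (u : ∀ (i : Tip R) (j : Tip (G i)), B (j ≫ (ψ i).ι)) :
    ∃ b : ∀ k, B k, ∀ i j, b (j ≫ (ψ i).ι) = u i j := by
  choose p q hpq using Fibre.exists_tip ψ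
  refine ⟨fun k => hpq k ▸ u (p k) (q k), fun i j => ?_⟩
  -- The chosen position of a tip need not be literally `(i, j)`; with that position as a variable,
  -- injectivity removes the transport.
  have key : ∀ (i' : Tip R) (j' : Tip (G i')) (h : j' ≫ (ψ i').ι = j ≫ (ψ i).ι),
      (h ▸ u i' j' : B (j ≫ (ψ i).ι)) = u i j := by
    intro i' j' h
    obtain ⟨rfl, h'⟩ := Sigma.mk.inj (Fibre.tip_injective ψ h)
    obtain rfl := eq_of_heq h'
    rfl
  exact key _ _ _

variable [UniqueFibres Ω]

theorem Fibre.eq_arity {T S : Ω} {σ : T ⟶ S} {i : Tip S} {F F' : Ω} (φ : Fibre σ i F)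
    (φ' : Fibre σ i F') : F = F' := (UniqueFibres.fibre_unique φ φ').1

/-- Once the arities of two families of fibres are identified, the families themselves may be
exchanged freely in the dependent statements below. -/
instance {T S F : Ω} (σ : T ⟶ S) (i : Tip S) : Subsingleton (Fibre σ i F) :=
  ⟨fun φ φ' => eq_of_heq (UniqueFibres.fibre_unique φ φ').2⟩

theorem Fibre.eq_arities {T S : Ω} {σ : T ⟶ S} {F F' : Tip S → Ω} (φ : ∀ i, Fibre σ i (F i))
    (φ' : ∀ i, Fibre σ i (F' i)) : F = F' := funext fun i => (φ i).eq_arity (φ' i)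

/-- The fibre of `σ` over `i`. -/
noncomputable def fib {T S : Ω} (σ : T ⟶ S) (i : Tip S) : Ω :=
  (UniqueFibres.exists_fibre σ i).choose

/-- The inclusion of the fibre of `σ` over `i`. -/
noncomputable def isFib {T S : Ω} (σ : T ⟶ S) (i : Tip S) : Fibre σ i (fib σ i) :=
  (UniqueFibres.exists_fibre σ i).choose_spec.some

instance : Subsingleton (Tip (Arities.U : Ω)) := ⟨fun _ _ => toU_ext _ _⟩

/-- Families of fibres of a map to the terminal arity are constant. -/
theorem Fibre.bang_cases {T : Ω} {P : ∀ (σ : T ⟶ (Arities.U : Ω)) (F : Tip (Arities.U : Ω) → Ω),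
    (∀ i, Fibre σ i (F i)) → Prop} (h : P (bang T) (fun _ => T) (Fibre.ofBang T))
    (σ : T ⟶ (Arities.U : Ω)) (F : Tip (Arities.U : Ω) → Ω) (φ : ∀ i, Fibre σ i (F i)) :
    P σ F φ := by
  obtain rfl : bang T = σ := toU_ext _ _
  obtain rfl : (fun _ => T) = F := Fibre.eq_arities (Fibre.ofBang T) φ
  rwa [Subsingleton.elim φ (Fibre.ofBang T)]

end Fibres

/-! ## Trees of generators

The free operad of sets on a collection `X`, in terms of normal forms. -/

variable {Ω : Type} [Category.{0} Ω] [Arities Ω]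

/-- A tree of generators: the unit, or a generator with a family of trees grafted to it. -/
inductive Tr (X : Ω → Type) : Ω → Type
  | unit : Tr X Arities.U
  | node {T S : Ω} (x : X S) (σ : T ⟶ S) {F : Tip S → Ω} (φ : ∀ i, Fibre σ i (F i))
      (t : ∀ i, Tr X (F i)) : Tr X T

namespace Tr

variable {X : Ω → Type}

/-- The tree with one generator. -/
def gen {T : Ω} (x : X T) : Tr X T := .node x (𝟙 T) Fibre.ofId fun _ => .unit

/-- Forget the labels of the generators. -/
def erase : ∀ {T : Ω}, Tr X T → Tr (fun _ => Unit) T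
  | _, .unit => .unit
  | _, .node _ σ φ t => .node () σ φ fun i => (t i).erase

theorem node_inj {T S : Ω} {x y : X S} {σ : T ⟶ S} {F : Tip S → Ω} {φ : ∀ i, Fibre σ i (F i)}
    {t t' : ∀ i, Tr X (F i)} (h : node x σ φ t = node y σ φ t') : x = y ∧ t = t' := by
  cases h
  exact ⟨rfl, rfl⟩

theorem erase_eq_node {T S : Ω} {z : Tr X T} {u : Unit} {σ : T ⟶ S} {F : Tip S → Ω}
    {φ : ∀ i, Fibre σ i (F i)} {t : ∀ i, Tr (fun _ => Unit) (F i)}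
    (h : z.erase = .node u σ φ t) :
    ∃ (x : X S) (z' : ∀ i, Tr X (F i)), z = .node x σ φ z' ∧ ∀ i, (z' i).erase = t i := by
  cases z with
  | unit => cases h
  | node x σ' φ' z' =>
    simp only [erase] at h
    cases h
    exact ⟨x, z', rfl, fun _ => rfl⟩

theorem erase_eq_unit {z : Tr X (Arities.U : Ω)} (h : z.erase = .unit) : z = .unit := by
  -- The arity is made a variable before the case analysis on the tree.
  have key : ∀ {T : Ω} (z : Tr X T) (e : T = Arities.U), z.erase = e ▸ .unit → z = e ▸ .unit := by
    intro T z e h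
    cases z with
    | unit => rfl
    | node x σ φ t => subst e; cases h
  exact key z rfl h

theorem erase_eq_gen {T : Ω} {z : Tr X T} (h : z.erase = gen ()) : ∃ x, z = gen x := by
  obtain ⟨x, z', rfl, h'⟩ := erase_eq_node h
  exact ⟨x, congrArg _ (funext fun i => erase_eq_unit (h' i))⟩

variable [UniqueFibres Ω]

/-- Fibres of equal maps have arities that are only provably equal, so the subtrees have to be
compared heterogeneously. -/
theorem node_congr {T S : Ω} (x : X S) {σ σ' : T ⟶ S} (e : σ = σ') {F F' : Tip S → Ω}
    (φ : ∀ i, Fibre σ i (F i)) (φ' : ∀ i, Fibre σ' i (F' i)) {t : ∀ i, Tr X (F i)}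
    {t' : ∀ i, Tr X (F' i)} (h : ∀ i, HEq (t i) (t' i)) : node x σ φ t = node x σ' φ' t' := by
  subst e
  obtain rfl := Fibre.eq_arities φ φ'
  obtain rfl : t = t' := funext fun i => eq_of_heq (h i)
  rw [Subsingleton.elim φ φ']

/-- Grafting of trees. -/
noncomputable def mul : ∀ {T S : Ω} (σ : T ⟶ S) {F : Tip S → Ω} (_φ : ∀ i, Fibre σ i (F i))
    (_s : Tr X S) (_t : ∀ i, Tr X (F i)), Tr X T
  | _, _, σ, _, φ, .unit, t =>
    -- The only fibre of a map to the terminal arity is its source, so the single grafted tree is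
    -- returned, up to transport.
    (φ (𝟙 _)).eq_arity ((Fibre.ofBang _ (𝟙 _)).ofEq (toU_ext (bang _) σ)) ▸ t (𝟙 _)
  | _, _, σ, _, φ, .node x ω ψ s, t =>
    .node x (σ ≫ ω) (isFib (σ ≫ ω)) fun i => mul ((ψ i).res (isFib (σ ≫ ω) i))
      (fun j => (ψ i).resFibre _ j (φ (j ≫ (ψ i).ι))) (s i) fun j => t (j ≫ (ψ i).ι)

theorem mul_unit {T : Ω} (t : Tip (Arities.U : Ω) → Tr X T) (i : Tip (Arities.U : Ω)) :
    mul (bang T) (Fibre.ofBang T) .unit t = t i := by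
  rw [Subsingleton.elim i (𝟙 _)]
  simp only [mul]

theorem mul_congr {T S : Ω} {σ σ' : T ⟶ S} (e : σ = σ') {F F' : Tip S → Ω}
    (φ : ∀ i, Fibre σ i (F i)) (φ' : ∀ i, Fibre σ' i (F' i)) (s : Tr X S) {t : ∀ i, Tr X (F i)}
    {t' : ∀ i, Tr X (F' i)} (h : ∀ i, HEq (t i) (t' i)) : mul σ φ s t = mul σ' φ' s t' := by
  subst e
  obtain rfl := Fibre.eq_arities φ φ'
  obtain rfl : t = t' := funext fun i => eq_of_heq (h i)
  rw [Subsingleton.elim φ φ']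

/-- The recursive clause uses chosen fibres of the composite; uniqueness of fibres permits any
family `χ` instead, which is the form needed for comparing iterated graftings. -/
theorem mul_node {T S R : Ω} (σ : T ⟶ S) (ω : S ⟶ R) {F : Tip S → Ω} (φ : ∀ j, Fibre σ j (F j))
    {G : Tip R → Ω} (ψ : ∀ i, Fibre ω i (G i)) {H : Tip R → Ω} (χ : ∀ i, Fibre (σ ≫ ω) i (H i))
    (x : X R) (s : ∀ i, Tr X (G i)) (t : ∀ j, Tr X (F j)) :
    mul σ φ (.node x ω ψ s) t = .node x (σ ≫ ω) χ fun i => mul ((ψ i).res (χ i))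
      (fun j => (ψ i).resFibre _ j (φ (j ≫ (ψ i).ι))) (s i) fun j => t (j ≫ (ψ i).ι) := by
  rw [mul]
  obtain rfl : fib (σ ≫ ω) = H := Fibre.eq_arities (isFib (σ ≫ ω)) χ
  obtain rfl : isFib (σ ≫ ω) = χ := Subsingleton.elim _ _
  rfl

/-- One subtree of the node case of `mul_id`, isolated so that the arities `H` and `G` of the fibres
of `𝟙 T ≫ ω` and `ω` are variables and can be identified. -/
theorem res_id_aux {T S G H : Ω} {ω : T ⟶ S} {i : Tip S} (ψ : Fibre ω i G)
    (χ : Fibre (𝟙 T ≫ ω) i H) (s : Tr X G) (φ : ∀ _ : Tip G, Fibre (ψ.res χ) _ Arities.U)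
    (ih : mul (𝟙 G) Fibre.ofId s (fun _ => .unit) = s) :
    HEq (mul (ψ.res χ) φ s fun _ => .unit) s := by
  obtain rfl : H = G := (χ.ofEq (Category.id_comp ω)).eq_arity ψ
  obtain rfl : χ = ψ.ofEq (Category.id_comp ω).symm := Subsingleton.elim _ _
  refine heq_of_eq (Eq.trans ?_ ih)
  refine mul_congr (ψ.hom_ext ?_) _ _ _ fun _ => HEq.rfl
  rw [Fibre.res_ι]
  exact (Category.comp_id _).trans (Category.id_comp _).symm

theorem mul_id {T : Ω} (s : Tr X T) : mul (𝟙 T) Fibre.ofId s (fun _ => .unit) = s := by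
  induction s with
  | unit =>
    exact (mul_congr (toU_ext _ _) _ _ _ fun _ => HEq.rfl).trans
      (mul_unit (fun _ => .unit) (𝟙 _))
  | node x ω ψ s ih =>
    rw [mul_node (𝟙 _) ω _ ψ (isFib _)]
    exact node_congr x (Category.id_comp ω) _ _ fun i => res_id_aux _ _ _ _ (ih i)

/-- By induction on the bottom tree. At a node both sides have the same root over the threefold
composite, and over each of its tips the claim is associativity for the restricted maps between
fibres. -/
theorem mul_assoc {T S R : Ω} (σ : T ⟶ S) (ω : S ⟶ R) {F : Tip S → Ω} (φ : ∀ j, Fibre σ j (F j))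
    {G : Tip R → Ω} (ψ : ∀ i, Fibre ω i (G i)) {H : Tip R → Ω} (χ : ∀ i, Fibre (σ ≫ ω) i (H i))
    (r : Tr X R) (s : ∀ i, Tr X (G i)) (t : ∀ j, Tr X (F j)) :
    mul σ φ (mul ω ψ r s) t = mul (σ ≫ ω) χ r fun i => mul ((ψ i).res (χ i))
      (fun j => (ψ i).resFibre (χ i) j (φ (j ≫ (ψ i).ι))) (s i) fun j => t (j ≫ (ψ i).ι) := by
  induction r generalizing T S with
  | unit =>
    revert s χ
    refine Fibre.bang_cases (P := fun ω G ψ => ∀ (χ : ∀ i, Fibre (σ ≫ ω) i (H i))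
      (s : ∀ i, Tr X (G i)), mul σ φ (mul ω ψ .unit s) t = mul (σ ≫ ω) χ .unit fun i =>
      mul ((ψ i).res (χ i)) (fun j => (ψ i).resFibre (χ i) j (φ (j ≫ (ψ i).ι))) (s i)
        fun j => t (j ≫ (ψ i).ι)) ?_ ω G ψ
    intro χ s
    obtain rfl : (fun _ => T) = H :=
      Fibre.eq_arities (fun i => (Fibre.ofBang T i).ofEq (toU_ext _ _)) χ
    rw [mul_unit s (𝟙 _)]
    refine Eq.symm ((mul_congr (toU_ext _ (bang T)) _ (Fibre.ofBang T) _ fun _ => HEq.rfl).trans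
      ((mul_unit _ (𝟙 _)).trans ?_))
    obtain rfl : χ = fun i => (Fibre.ofBang T i).ofEq (toU_ext _ _) := Subsingleton.elim _ _
    refine mul_congr ((Fibre.ofBang S (𝟙 _)).hom_ext ?_) _ _ _ fun j => ?_
    · rw [Fibre.res_ι]
      exact (Category.id_comp σ).trans (Category.comp_id σ).symm
    · have : j ≫ (Fibre.ofBang S (𝟙 _)).ι = j := Category.comp_id j
      rw [this]
  | @node R Q x ρ K θ r ih =>
    let θ' := isFib (ω ≫ ρ)
    obtain ⟨K₃, ⟨θ₃⟩⟩ : ∃ K₃ : Tip Q → Ω, Nonempty (∀ i, Fibre ((σ ≫ ω) ≫ ρ) i (K₃ i)) :=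
      ⟨_, ⟨isFib _⟩⟩
    -- The same fibres serve for both bracketings, so corresponding subtrees have the same arity.
    let θ₂ : ∀ i, Fibre (σ ≫ ω ≫ ρ) i _ := fun i => (θ₃ i).ofEq (Category.assoc σ ω ρ)
    rw [mul_node ω ρ ψ θ θ', mul_node σ (ω ≫ ρ) φ θ' θ₂, mul_node (σ ≫ ω) ρ χ θ θ₃]
    refine node_congr x (Category.assoc σ ω ρ).symm _ _ fun q => heq_of_eq ?_
    -- Restriction to fibres is functorial; this brings the subtree into the form of the induction
    -- hypothesis.
    have e : (θ q).res (θ₃ q) = (θ' q).res (θ₂ q) ≫ (θ q).res (θ' q) := by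
      apply (θ q).hom_ext
      refine ((θ q).res_ι (θ₃ q)).trans (Eq.symm ?_)
      rw [Category.assoc, Fibre.res_ι, ← Category.assoc, Fibre.res_ι, Category.assoc]
      rfl
    rw [ih q ((θ' q).res (θ₂ q)) ((θ q).res (θ' q)) _ _ (fun j =>
      ((θ q).resFibre (θ₃ q) j (χ (j ≫ (θ q).ι))).ofEq e)]
    refine mul_congr e.symm _ _ _ fun j => heq_of_eq ?_
    have e' : ((θ q).resFibre (θ' q) j (ψ (j ≫ (θ q).ι))).ι ≫ (θ' q).ι = (ψ (j ≫ (θ q).ι)).ι :=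
      Fibre.resFibre_ι _ _ _ _
    refine mul_congr ((ψ (j ≫ (θ q).ι)).hom_ext ?_) _ _ _ fun k => ?_
    · rw [Fibre.res_ι, ← e', ← Category.assoc, Fibre.res_ι, Category.assoc, Fibre.res_ι,
        ← Category.assoc, ← Fibre.resFibre_ι (θ q) (θ₃ q) j (χ (j ≫ (θ q).ι))]
      rfl
    · have : (k ≫ ((θ q).resFibre (θ' q) j (ψ (j ≫ (θ q).ι))).ι) ≫ (θ' q).ι =
          k ≫ (ψ (j ≫ (θ q).ι)).ι := by rw [Category.assoc, e']
      rw [this]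

/-- A generator carries a unit at each tip, and grafting onto a unit changes nothing. Every node is
thereby a product, so facts about grafting apply to nodes. -/
theorem mul_gen {T S : Ω} (x : X S) (σ : T ⟶ S) {F : Tip S → Ω} (φ : ∀ i, Fibre σ i (F i))
    (t : ∀ i, Tr X (F i)) : mul σ φ (gen x) t = .node x σ φ t := by
  rw [gen, mul_node σ (𝟙 S) φ Fibre.ofId fun i => (φ i).ofEq (Category.comp_id σ).symm]
  refine node_congr x (Category.comp_id σ) _ _ fun i => ?_
  have hi : ((𝟙 _ : Tip (Arities.U : Ω)) ≫ (Fibre.ofId i).ι : Tip S) = i := Category.id_comp i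
  have key : ∀ (σ' : F i ⟶ Arities.U) (F' : Tip (Arities.U : Ω) → Ω)
      (φ' : ∀ j, Fibre σ' j (F' j)) (t' : ∀ j, Tr X (F' j)),
      HEq (mul σ' φ' .unit t') (t' (𝟙 _)) := by
    intro σ' F' φ'
    refine Fibre.bang_cases (P := fun σ' F' φ' => ∀ t' : ∀ j, Tr X (F' j),
      HEq (mul σ' φ' .unit t') (t' (𝟙 _))) ?_ σ' F' φ'
    exact fun t' => heq_of_eq (mul_unit t' _)
  refine (key _ _ _ _).trans ?_
  rw [hi]

theorem erase_mul {T S : Ω} (σ : T ⟶ S) {F : Tip S → Ω} (φ : ∀ i, Fibre σ i (F i))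
    (s : Tr X S) (t : ∀ i, Tr X (F i)) :
    (mul σ φ s t).erase = mul σ φ s.erase fun i => (t i).erase := by
  induction s generalizing T with
  | unit =>
    revert t
    refine Fibre.bang_cases (P := fun σ F φ => ∀ t : ∀ i, Tr X (F i),
      (mul σ φ .unit t).erase = mul σ φ (erase .unit) fun i => (t i).erase) ?_ σ F φ
    intro t
    rw [mul_unit t (𝟙 _), erase, mul_unit _ (𝟙 _)]
  | node x ω ψ s ih =>
    rw [mul_node σ ω φ ψ (isFib _), erase, erase, mul_node σ ω φ ψ (isFib _)]
    simp only [ih]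

/-- A labelling of a grafting is a grafting of labellings. -/
theorem exists_of_erase_eq_mul {T S : Ω} (σ : T ⟶ S) {F : Tip S → Ω} (φ : ∀ i, Fibre σ i (F i))
    (s : Tr (fun _ => Unit) S) (t : ∀ i, Tr (fun _ => Unit) (F i)) (z : Tr X T)
    (h : z.erase = mul σ φ s t) :
    ∃ (y : Tr X S) (w : ∀ i, Tr X (F i)), y.erase = s ∧ (∀ i, (w i).erase = t i) ∧
      z = mul σ φ y w := by
  induction s generalizing T with
  | unit =>
    revert t
    refine Fibre.bang_cases (P := fun σ F φ => ∀ t : ∀ i, Tr (fun _ => Unit) (F i),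
      z.erase = mul σ φ .unit t → ∃ (y : Tr X Arities.U) (w : ∀ i, Tr X (F i)),
        y.erase = .unit ∧ (∀ i, (w i).erase = t i) ∧ z = mul σ φ y w) ?_ σ F φ
    intro t h
    rw [mul_unit t (𝟙 _)] at h
    exact ⟨.unit, fun _ => z, rfl, fun i => by rw [h, Subsingleton.elim i (𝟙 _)],
      (mul_unit (fun _ => z) (𝟙 _)).symm⟩
  | node x ω ψ s ih =>
    rw [mul_node σ ω φ ψ (isFib _)] at h
    obtain ⟨x, z', rfl, h'⟩ := erase_eq_node h
    choose y w hy hw hz using fun i => ih i _ _ _ _ (h' i)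
    -- The induction hypothesis labels the grafted trees separately over each fibre of `ω`; together
    -- they form one family over all tips.
    obtain ⟨b, hb⟩ := Fibre.exists_glue ψ (B := fun k => Tr X (F k)) w
    refine ⟨.node x ω ψ y, b, ?_, ?_, ?_⟩
    · simp only [erase, hy]
    · intro k
      obtain ⟨i, j, rfl⟩ := Fibre.exists_tip ψ k
      rw [hb, hw]
    · rw [mul_node σ ω φ ψ (isFib _)]
      simp only [hb, ← hz]

/-- A tree can be cut at different heights, so grafting alone is not injective. Fixing the shapes of
the factors fixes the cut, and the labels can then be read off. -/
theorem mul_inj {T S : Ω} (σ : T ⟶ S) {F : Tip S → Ω} (φ : ∀ i, Fibre σ i (F i))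
    {y y' : Tr X S} {w w' : ∀ i, Tr X (F i)} (h : mul σ φ y w = mul σ φ y' w')
    (hy : y.erase = y'.erase) (hw : ∀ i, (w i).erase = (w' i).erase) : y = y' ∧ w = w' := by
  induction y generalizing T with
  | unit =>
    obtain rfl := erase_eq_unit hy.symm
    clear hw
    refine ⟨rfl, ?_⟩
    revert w w'
    suffices H : ∀ w w' : ∀ i, Tr X (F i), mul σ φ .unit w = mul σ φ .unit w' → w = w' from
      fun {w w'} => H w w'
    refine Fibre.bang_cases (P := fun σ F φ => ∀ w w' : ∀ i, Tr X (F i),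
      mul σ φ .unit w = mul σ φ .unit w' → w = w') ?_ σ F φ
    intro w w' h
    rw [mul_unit w (𝟙 _), mul_unit w' (𝟙 _)] at h
    exact funext fun i => by rw [Subsingleton.elim i (𝟙 _), h]
  | node x ω ψ s ih =>
    obtain ⟨x', s', rfl, h'⟩ := erase_eq_node hy.symm
    rw [mul_node σ ω φ ψ (isFib _), mul_node σ ω φ ψ (isFib _)] at h
    obtain ⟨rfl, hs⟩ := node_inj h
    have key := fun i => ih i _ _ (congrFun hs i) (h' i).symm fun j => hw _
    refine ⟨congrArg _ (funext fun i => (key i).1), funext fun k => ?_⟩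
    obtain ⟨i, j, rfl⟩ := Fibre.exists_tip ψ k
    exact congrFun (key i).2 j

end Tr

end HigherOperad

namespace HigherOperad

variable {Ω : Type} [Category.{0} Ω] [Arities Ω]

/-! ## Normal forms of the objects of `H` -/

/-- Normal forms of the objects of `H_T`. -/
abbrev Nf (T : Ω) : Type := Tr (fun _ => Unit) T

/-- The object of `H_T` with a given normal form. -/
noncomputable def Tr.toH : ∀ {T : Ω}, Nf T → HObj T
  | _, .unit => HObj.unit
  | _, .node _ σ φ t => HObj.mul σ φ (HObj.gen _) fun i => (t i).toH

theorem Tr.toH_gen (T : Ω) : (Tr.gen () : Nf T).toH = HObj.gen T := HObj.mul_id _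

/-- The objects of `H` are generated by the unit and the generators under multiplication. -/
theorem HObj.induction {P : ∀ {T : Ω}, HObj T → Prop} (gen : ∀ T, P (HObj.gen T))
    (unit : P HObj.unit) (mul : ∀ {T S : Ω} (σ : T ⟶ S) {F : Tip S → Ω}
      (φ : ∀ i, Fibre σ i (F i)) (s : HObj S) (t : ∀ i, HObj (F i)), P s → (∀ i, P (t i)) →
      P (HObj.mul σ φ s t)) {T : Ω} (w : HObj T) : P w := by
  obtain ⟨x, rfl⟩ := Quotient.exists_rep w
  induction x with
  | gen T => exact gen T
  | unit => exact unit
  | mul σ φ s t ihs iht =>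
    rw [← HObj.mul_mk]
    exact mul σ φ _ _ ihs iht

/-- This allows the heterogeneous relation to be turned back into equality of morphisms after
substituting endpoints. -/
theorem HRel.src_tgt_eq {T : Ω} {w w' x x' : HObj T} {f : HPre w w'} {g : HPre x x'}
    (h : HRel f g) : w = x ∧ w' = x' := by
  induction h with
  | refl => exact ⟨rfl, rfl⟩
  | symm _ ih => exact ⟨ih.1.symm, ih.2.symm⟩
  | trans _ _ ih ih' => exact ⟨ih.1.trans ih'.1, ih.2.trans ih'.2⟩
  | comp_congr _ _ ih ih' => exact ⟨ih.1, ih'.2⟩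
  | mul_congr σ φ _ _ ih ih' =>
    exact ⟨by rw [ih.1, funext fun i => (ih' i).1], by rw [ih.2, funext fun i => (ih' i).2]⟩
  | id_comp => exact ⟨rfl, rfl⟩
  | comp_id => exact ⟨rfl, rfl⟩
  | comp_assoc => exact ⟨rfl, rfl⟩
  | mul_ids => exact ⟨rfl, rfl⟩
  | mul_comp => exact ⟨rfl, rfl⟩
  | assoc σ ω φ ψ χ => exact ⟨HObj.assoc _ _ _ _ _ _ _ _, HObj.assoc _ _ _ _ _ _ _ _⟩
  | mul_id => exact ⟨HObj.mul_id _, HObj.mul_id _⟩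
  | mul_bang => exact ⟨HObj.mul_bang _, HObj.mul_bang _⟩
  | γ_assoc => exact ⟨HObj.assoc _ _ _ _ _ _ _ _, rfl⟩
  | γ_id => exact ⟨HObj.mul_id _, rfl⟩
  | γ_bang => exact ⟨HObj.mul_bang _, rfl⟩

/-! ## Normal forms of the morphisms of `H`

A morphism of `H` with target `w` is given by a labelling of the generators of `w` by objects. -/

/-- Trees labelled by objects of `H`. -/
abbrev Lab (T : Ω) : Type := Tr (fun S : Ω => Nf S) T

/-- The source of the morphism with a given normal form. -/
noncomputable def Tr.src : ∀ {T : Ω}, Lab T → HObj T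
  | _, .unit => HObj.unit
  | _, .node x σ φ t => HObj.mul σ φ x.toH fun i => (t i).src

/-- Label every generator of an object by itself. -/
def Tr.diag : ∀ {T : Ω}, Nf T → Lab T
  | _, .unit => .unit
  | _, .node _ σ φ t => .node (Tr.gen ()) σ φ fun i => (t i).diag

/-- The formal morphism from an object to the generator of its arity. -/
noncomputable def Tr.can : ∀ {T : Ω} (t : Nf T), HPre t.toH (HObj.gen T)
  | _, .unit => .ε
  | _, .node _ σ φ t => .comp (.mul σ φ (.id (HObj.gen _)) fun i => (t i).can) (.γ σ φ)

/-- The formal morphism given by a labelled tree. -/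
noncomputable def Tr.hom : ∀ {T : Ω} (z : Lab T), HPre z.src z.erase.toH
  | _, .unit => .id HObj.unit
  | _, .node x σ φ t => .mul σ φ x.can fun i => (t i).hom

theorem Tr.can_gen (T : Ω) : HRel (Tr.gen () : Nf T).can (.id (HObj.gen T)) := .γ_id T

theorem Tr.hom_gen {T : Ω} (x : Nf T) : HRel (Tr.gen x : Lab T).hom x.can := .mul_id _

theorem Tr.hom_diag {T : Ω} (t : Nf T) : HRel t.diag.hom (.id t.toH) := by
  induction t with
  | unit => exact .refl _
  | node x σ φ t ih => exact .trans (.mul_congr σ φ (Tr.can_gen _) ih) (.mul_ids σ φ _ _)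

/-- Composition of grafted formal morphisms. -/
theorem HRel.mul_comp_mul {T S : Ω} (σ : T ⟶ S) {F : Tip S → Ω} (φ : ∀ i, Fibre σ i (F i))
    {s s' s'' : HObj S} {t t' t'' : ∀ i, HObj (F i)} (f : HPre s s') (f' : HPre s' s'')
    (g : ∀ i, HPre (t i) (t' i)) (g' : ∀ i, HPre (t' i) (t'' i)) :
    HRel (.comp (.mul σ φ f g) (.mul σ φ f' g'))
      (.mul σ φ (.comp f f') fun i => .comp (g i) (g' i)) := .symm (.mul_comp σ φ f f' g g')

variable [UniqueFibres Ω]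

theorem Tr.toH_mul {T S : Ω} (σ : T ⟶ S) {F : Tip S → Ω} (φ : ∀ i, Fibre σ i (F i))
    (s : Nf S) (t : ∀ i, Nf (F i)) :
    (Tr.mul σ φ s t).toH = HObj.mul σ φ s.toH fun i => (t i).toH := by
  induction s generalizing T with
  | unit =>
    revert t
    refine Fibre.bang_cases (P := fun σ F φ => ∀ t : ∀ i, Nf (F i), (Tr.mul σ φ .unit t).toH =
      HObj.mul σ φ (Tr.toH .unit) fun i => (t i).toH) ?_ σ F φ
    intro t
    have : t = fun _ => t (𝟙 _) := funext fun i => by rw [Subsingleton.elim i (𝟙 _)]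
    rw [Tr.mul_unit t (𝟙 _), this, Tr.toH, HObj.mul_bang]
  | node x ω ψ s ih =>
    rw [Tr.mul_node σ ω φ ψ (isFib _), Tr.toH, Tr.toH, HObj.assoc σ ω φ ψ (isFib _)]
    simp only [ih]

/-- The normal form of an expression. -/
noncomputable def Expr.nf : ∀ {T : Ω}, Expr T → Nf T
  | _, .gen _ => Tr.gen ()
  | _, .unit => .unit
  | _, .mul σ φ s t => Tr.mul σ φ s.nf fun i => (t i).nf

theorem ExprEq.nf_eq {T : Ω} {x y : Expr T} (h : ExprEq x y) : x.nf = y.nf := by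
  induction h with
  | refl => rfl
  | symm _ ih => exact ih.symm
  | trans _ _ ih ih' => exact ih.trans ih'
  | congr σ φ _ _ ih ih' => simp only [Expr.nf, ih, ih']
  | assoc σ ω φ ψ χ r s t => exact Tr.mul_assoc σ ω φ ψ χ _ _ _
  | mul_id x => exact Tr.mul_id _
  | mul_bang x => exact Tr.mul_unit _ (𝟙 _)

/-- The normal form of an object of `H`. -/
noncomputable def HObj.nf {T : Ω} (w : HObj T) : Nf T :=
  Quotient.lift Expr.nf (fun _ _ h => ExprEq.nf_eq h) w

theorem HObj.nf_mul {T S : Ω} (σ : T ⟶ S) {F : Tip S → Ω} (φ : ∀ i, Fibre σ i (F i))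
    (s : HObj S) (t : ∀ i, HObj (F i)) :
    (HObj.mul σ φ s t).nf = Tr.mul σ φ s.nf fun i => (t i).nf := by
  have h : ∀ {T : Ω} (w : HObj T), (Quotient.out w).nf = w.nf := fun w => by
    conv_rhs => rw [← Quotient.out_eq w]
    rfl
  change Tr.mul σ φ (Quotient.out s).nf (fun i => (Quotient.out (t i)).nf) = _
  simp only [h]

theorem HObj.nf_gen (T : Ω) : (HObj.gen T).nf = Tr.gen () := rfl

/-- Distinct trees name distinct objects: the operad axioms impose no relations beyond those holding
strictly for grafting. With `HObj.toH_nf`, objects and normal forms are in bijection. -/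
theorem Tr.nf_toH {T : Ω} (t : Nf T) : t.toH.nf = t := by
  induction t with
  | unit => rfl
  | node x σ φ t ih => simp only [Tr.toH, HObj.nf_mul, ih, HObj.nf_gen, Tr.mul_gen]

theorem HObj.toH_nf {T : Ω} (w : HObj T) : w.nf.toH = w := by
  induction w using HObj.induction with
  | gen T => exact Tr.toH_gen T
  | unit => rfl
  | mul σ φ s t ihs iht => rw [HObj.nf_mul, Tr.toH_mul, ihs, funext iht]

/-- Graft the labels of a labelled tree. -/
noncomputable def Tr.flat : ∀ {T : Ω}, Lab T → Nf T
  | _, .unit => .unit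
  | _, .node x σ φ t => Tr.mul σ φ x fun i => (t i).flat

/-- The source of a morphism in normal form is obtained by substituting each label for its
generator. -/
theorem Tr.src_eq {T : Ω} (z : Lab T) : z.src = z.flat.toH := by
  induction z with
  | unit => rfl
  | node x σ φ t ih => simp only [Tr.src, Tr.flat, ih, Tr.toH_mul]

theorem Tr.diag_mul {T S : Ω} (σ : T ⟶ S) {F : Tip S → Ω} (φ : ∀ i, Fibre σ i (F i))
    (s : Nf S) (t : ∀ i, Nf (F i)) :
    (Tr.mul σ φ s t).diag = Tr.mul σ φ s.diag fun i => (t i).diag := by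
  induction s generalizing T with
  | unit =>
    revert t
    refine Fibre.bang_cases (P := fun σ F φ => ∀ t : ∀ i, Nf (F i), (Tr.mul σ φ .unit t).diag =
      Tr.mul σ φ (Tr.diag .unit) fun i => (t i).diag) ?_ σ F φ
    intro t
    rw [Tr.mul_unit t (𝟙 _), Tr.diag, Tr.mul_unit _ (𝟙 _)]
  | node x ω ψ s ih =>
    rw [Tr.mul_node σ ω φ ψ (isFib _), Tr.diag, Tr.diag, Tr.mul_node σ ω φ ψ (isFib _)]
    simp only [ih]

theorem Tr.hom_mul {T S : Ω} (σ : T ⟶ S) {F : Tip S → Ω} (φ : ∀ i, Fibre σ i (F i))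
    (s : Lab S) (t : ∀ i, Lab (F i)) :
    HRel (Tr.mul σ φ s t).hom (.mul σ φ s.hom fun i => (t i).hom) := by
  induction s generalizing T with
  | unit =>
    revert t
    refine Fibre.bang_cases (P := fun σ F φ => ∀ t : ∀ i, Lab (F i),
      HRel (Tr.mul σ φ .unit t).hom (.mul σ φ (Tr.hom .unit) fun i => (t i).hom)) ?_ σ F φ
    intro t
    obtain ⟨t, rfl⟩ : ∃ t', t = fun _ => t' :=
      ⟨t (𝟙 _), funext fun i => by rw [Subsingleton.elim i (𝟙 _)]⟩
    rw [Tr.mul_unit _ (𝟙 _)]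
    exact .symm (.mul_bang _)
  | node x ω ψ s ih =>
    rw [Tr.mul_node σ ω φ ψ (isFib _)]
    exact .trans (.mul_congr _ _ (.refl _) fun i => ih i _ _ _) (.symm (.assoc σ ω φ ψ _ _ _ _))

/-- The canonical morphisms are coherent because of the internal operad axioms: the unit case is
`γ_bang`, the node case `γ_assoc` combined with the interchange of composition and multiplication.
-/
theorem Tr.can_mul {T S : Ω} (σ : T ⟶ S) {F : Tip S → Ω} (φ : ∀ i, Fibre σ i (F i))
    (s : Nf S) (t : ∀ i, Nf (F i)) :
    HRel (Tr.mul σ φ s t).can (.comp (.mul σ φ s.can fun i => (t i).can) (.γ σ φ)) := by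
  induction s generalizing T with
  | unit =>
    revert t
    refine Fibre.bang_cases (P := fun σ F φ => ∀ t : ∀ i, Nf (F i),
      HRel (Tr.mul σ φ .unit t).can
        (.comp (.mul σ φ (Tr.can .unit) fun i => (t i).can) (.γ σ φ))) ?_ σ F φ
    intro t
    obtain ⟨t, rfl⟩ : ∃ t', t = fun _ => t' :=
      ⟨t (𝟙 _), funext fun i => by rw [Subsingleton.elim i (𝟙 _)]⟩
    rw [Tr.mul_unit _ (𝟙 _)]
    -- `mul(ε; t) ≫ γ = mul(id; t) ≫ mul(ε; id) ≫ γ`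
    refine .symm (.trans (.comp_congr (.trans (.mul_congr _ _ (.symm (.id_comp _))
      fun _ => .symm (.comp_id _)) (.mul_comp _ _ _ _ _ _)) (.refl _)) ?_)
    refine .trans (.comp_assoc _ _ _) (.trans (.comp_congr (.mul_bang _) (.γ_bang _)) ?_)
    exact .comp_id _
  | node x ω ψ s ih =>
    rw [Tr.mul_node σ ω φ ψ (isFib _)]
    refine .trans (.comp_congr (.mul_congr _ _ (.refl _) fun i => ih i _ _ _) (.refl _)) ?_
    refine .trans (.comp_congr (.trans (.mul_congr _ _ (.symm (.id_comp _)) fun _ => .refl _)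
      (.mul_comp _ _ _ _ _ _)) (.refl _)) ?_
    refine .trans (.comp_assoc _ _ _) ?_
    refine .trans (.comp_congr (.symm (.assoc σ ω φ ψ _
      (.id (HObj.gen _)) (fun i => (s i).can) fun j => (t j).can)) (.symm (.γ_assoc σ ω φ ψ _))) ?_
    refine .trans (.symm (.comp_assoc _ _ _)) (.comp_congr ?_ (.refl _))
    exact .trans (.mul_comp_mul _ _ _ _ _ _) (.mul_congr _ _ (.refl _) fun _ => .comp_id _)

/-- The generators are terminal. -/
theorem HPre.comp_can {T : Ω} {w w' : HObj T} (f : HPre w w') (c : HPre w' (HObj.gen T))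
    (hc : HRel c w'.nf.can) : HRel (.comp f c) w.nf.can := by
  induction f with
  | id w => exact .trans (.id_comp _) hc
  | comp f g ihf ihg =>
    exact .trans (.comp_assoc _ _ _) (ihf _ (ihg c hc))
  | @mul T S σ F φ s s' t t' f g ihf ihg =>
    -- `w` and `w.nf.toH` are equal but not definitionally so; a representative starting at `w`
    -- itself is needed for composition.
    have key : ∀ {T : Ω} (w : HObj T), ∃ c : HPre w (HObj.gen T), HRel c w.nf.can := by
      intro T w
      have := w.nf.can
      have h := w.toH_nf
      generalize w.nf = n at h
      subst h
      exact ⟨n.can, .refl _⟩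
    obtain ⟨a, ha⟩ := key s'
    choose b hb using fun i => key (t' i)
    rw [HObj.nf_mul] at hc ⊢
    -- The canonical morphism out of a product is the product of canonical morphisms followed by
    -- `γ`; interchange then leaves one claim for each factor.
    refine .trans (.comp_congr (.refl _) (.trans hc (.trans (Tr.can_mul _ _ _ _)
      (.comp_congr (.mul_congr _ _ (.symm ha) fun i => .symm (hb i)) (.refl _))))) ?_
    refine .trans (.symm (.comp_assoc _ _ _)) (.trans (.comp_congr ?_ (.refl _))
      (.symm (Tr.can_mul _ _ _ _)))
    exact .trans (.mul_comp_mul _ _ _ _ _ _) (.mul_congr _ _ (ihf a ha) fun i => ihg i _ (hb i))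
  | γ σ φ =>
    refine .trans (.comp_congr (.refl _) (.trans hc (Tr.can_gen _))) (.trans (.comp_id _) ?_)
    rw [HObj.nf_mul]
    refine .symm (.trans (Tr.can_mul _ _ _ _) ?_)
    refine .trans (.comp_congr (.trans (.mul_congr _ _ (Tr.can_gen _) fun _ => Tr.can_gen _)
      (.mul_ids _ _ _ _)) (.refl _)) (.id_comp _)
  | ε => exact .trans (.comp_congr (.refl _) (.trans hc (Tr.can_gen _))) (.comp_id _)

/-- Formal morphisms given by labelled trees are closed under composition. -/
theorem Tr.exists_comp {T : Ω} (y z : Lab T) (h : z.erase = y.flat) :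
    ∃ u : Lab T, ∀ {w w' w'' : HObj T} (f : HPre w w') (g : HPre w' w''),
      HRel f z.hom → HRel g y.hom → HRel u.hom (.comp f g) := by
  induction y with
  | unit =>
    obtain rfl := Tr.erase_eq_unit h
    exact ⟨.unit, fun f g hf hg => .symm (.trans (.comp_congr hf hg) (.id_comp _))⟩
  | node x σ φ t ih =>
    -- The middle object is the label `x` with the flattened subtrees grafted to it, so its
    -- labelling splits accordingly.
    obtain ⟨z, v, hz, hv, rfl⟩ := Tr.exists_of_erase_eq_mul σ φ _ _ _ h
    choose p hp using fun i => ih i _ (hv i)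
    -- The composite of `z.hom` with `x.can` ends at a generator, hence is the canonical morphism
    -- from the source of `z`; so the new root label is `z.flat`.
    refine ⟨.node z.flat σ φ p, fun f g hf hg => ?_⟩
    have e : ∀ i, (v i).erase.toH = (t i).src := fun i => by rw [hv, Tr.src_eq]
    -- composable representatives
    obtain ⟨f₀, hf₀⟩ : ∃ f₀ : HPre z.src x.toH, HRel f₀ z.hom := by
      subst hz
      exact ⟨z.hom, .refl _⟩
    obtain ⟨f₁, hf₁⟩ : ∃ f₁ : ∀ i, HPre (v i).src (t i).src, ∀ i, HRel (f₁ i) (v i).hom := by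
      have : ∀ i, ∃ f₁ : HPre (v i).src (t i).src, HRel f₁ (v i).hom := by
        intro i
        rw [← e i]
        exact ⟨_, .refl _⟩
      choose f₁ hf₁ using this
      exact ⟨f₁, hf₁⟩
    refine .symm (.trans (.comp_congr (.trans hf (.trans (Tr.hom_mul _ _ _ _)
      (.mul_congr _ _ (.symm hf₀) fun i => .symm (hf₁ i)))) hg) ?_)
    refine .trans (.mul_comp_mul _ _ _ _ _ _) (.mul_congr _ _ ?_ fun i => ?_)
    · have := HPre.comp_can f₀ x.can (by rw [Tr.nf_toH]; exact .refl _)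
      rwa [show z.src.nf = z.flat by rw [Tr.src_eq, Tr.nf_toH]] at this
    · exact .symm (hp i _ _ (hf₁ i) (.refl _))

/-- Every formal morphism is given by a labelled tree. -/
theorem HPre.exists_hom {T : Ω} {w w' : HObj T} (f : HPre w w') : ∃ z : Lab T, HRel z.hom f := by
  induction f with
  | id w =>
    refine ⟨w.nf.diag, ?_⟩
    have := w.nf.hom_diag
    rwa [HObj.toH_nf] at this
  | comp f g ihf ihg =>
    obtain ⟨z, hz⟩ := ihf
    obtain ⟨y, hy⟩ := ihg
    obtain ⟨u, hu⟩ := Tr.exists_comp y z (by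
      rw [← Tr.nf_toH z.erase, ← Tr.nf_toH y.flat, ← Tr.src_eq, hz.src_tgt_eq.2,
        hy.src_tgt_eq.1])
    exact ⟨u, hu f g (.symm hz) (.symm hy)⟩
  | mul σ φ f g ihf ihg =>
    obtain ⟨z, hz⟩ := ihf
    choose y hy using ihg
    exact ⟨_, .trans (Tr.hom_mul σ φ z y) (.mul_congr _ _ hz hy)⟩
  | γ σ φ =>
    -- `γ` is the canonical morphism from a product of generators, so its target carries that
    -- product as its single label.
    refine ⟨Tr.gen (Tr.mul σ φ (Tr.gen ()) fun _ => Tr.gen ()), ?_⟩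
    refine .trans (Tr.hom_gen _) (.trans (Tr.can_mul _ _ _ _) ?_)
    exact .trans (.comp_congr (.trans (.mul_congr _ _ (Tr.can_gen _) fun _ => Tr.can_gen _)
      (.mul_ids _ _ _ _)) (.refl _)) (.id_comp _)
  | ε => exact ⟨Tr.gen .unit, Tr.hom_gen _⟩

end HigherOperad

/-! ### Decorations, and uniqueness of the normal form of a morphism. -/

namespace HigherOperad

variable {Ω : Type} [Category.{0} Ω] [Arities Ω]

/-- The decorations of the generators of a tree by objects. -/
def Tr.Dec : ∀ {T : Ω}, Nf T → Type
  | _, .unit => Unit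
  | _, .node (S := S) _ _ _ t => Nf S × ∀ i, (t i).Dec

/-- The labelled tree of a decoration. -/
def Tr.lab : ∀ {T : Ω} (t : Nf T), t.Dec → Lab T
  | _, .unit, _ => .unit
  | _, .node _ σ φ t, d => .node d.1 σ φ fun i => (t i).lab (d.2 i)

theorem Tr.erase_lab {T : Ω} (t : Nf T) (d : t.Dec) : (t.lab d).erase = t := by
  induction t with
  | unit => rfl
  | node x σ φ t ih => simp only [Tr.lab, Tr.erase, ih]

theorem Tr.lab_injective {T : Ω} (t : Nf T) : Function.Injective t.lab := by
  induction t with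
  | unit => exact fun _ _ _ => rfl
  | node x σ φ t ih =>
    intro d d' h
    obtain ⟨h₁, h₂⟩ := Tr.node_inj h
    exact Prod.ext h₁ (funext fun i => ih i (congrFun h₂ i))

theorem Tr.exists_lab {T : Ω} (t : Nf T) (z : Lab T) (h : z.erase = t) : ∃ d, t.lab d = z := by
  induction t with
  | unit => exact ⟨(), (Tr.erase_eq_unit h).symm⟩
  | node x σ φ t ih =>
    obtain ⟨y, z', rfl, h'⟩ := Tr.erase_eq_node h
    choose d hd using fun i => ih i _ (h' i)
    exact ⟨(y, d), congrArg _ (funext hd)⟩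

theorem Tr.gen_injective {T : Ω} {x y : Nf T} (h : (Tr.gen x : Lab T) = Tr.gen y) : x = y :=
  (Tr.node_inj h).1

variable [UniqueFibres Ω]

/-! The set of labellings of an object is covariant in the object, since a formal morphism
multiplies labels. -/

/-- The graph of the map of labellings induced by a formal morphism. -/
def HPre.rel : ∀ {T : Ω} {w w' : HObj T}, HPre w w' → Lab T → Lab T → Prop
  | _, _, _, .id w, z, y => z = y ∧ z.erase = w.nf
  | _, _, _, .comp f g, z, y => ∃ u, f.rel z u ∧ g.rel u y
  | _, _, _, .mul (S := S) σ (F := F) φ f g, z, y =>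
    ∃ (z₀ y₀ : Lab S) (z₁ y₁ : ∀ i, Lab (F i)), f.rel z₀ y₀ ∧ (∀ i, (g i).rel (z₁ i) (y₁ i)) ∧
      z = Tr.mul σ φ z₀ z₁ ∧ y = Tr.mul σ φ y₀ y₁
  | _, _, _, .γ (S := S) σ (F := F) φ, z, y => ∃ (x : Nf S) (x' : ∀ i, Nf (F i)),
    z = Tr.mul σ φ (Tr.gen x) (fun i => Tr.gen (x' i)) ∧ y = Tr.gen (Tr.mul σ φ x x')
  | _, _, _, .ε, z, y => z = .unit ∧ y = Tr.gen .unit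

theorem HPre.rel_erase {T : Ω} {w w' : HObj T} (f : HPre w w') {z y : Lab T} (h : f.rel z y) :
    z.erase = w.nf ∧ y.erase = w'.nf := by
  induction f with
  | id w => exact ⟨h.2, h.1 ▸ h.2⟩
  | comp f g ihf ihg =>
    obtain ⟨u, hf, hg⟩ := h
    exact ⟨(ihf hf).1, (ihg hg).2⟩
  | mul σ φ f g ihf ihg =>
    obtain ⟨z₀, y₀, z₁, y₁, hf, hg, rfl, rfl⟩ := h
    constructor
    · rw [Tr.erase_mul, HObj.nf_mul, (ihf hf).1, funext fun i => (ihg i (hg i)).1]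
    · rw [Tr.erase_mul, HObj.nf_mul, (ihf hf).2, funext fun i => (ihg i (hg i)).2]
  | γ σ φ =>
    obtain ⟨x, x', rfl, rfl⟩ := h
    exact ⟨by rw [Tr.erase_mul, HObj.nf_mul]; rfl, rfl⟩
  | ε =>
    obtain ⟨rfl, rfl⟩ := h
    exact ⟨rfl, rfl⟩

/-- The graph is that of a partial function. For a product, the factors of a labelling are recovered
by `Tr.mul_inj`, their shapes being prescribed by the endpoints of the formal morphisms. -/
theorem HPre.rel_unique {T : Ω} {w w' : HObj T} (f : HPre w w') {z y y' : Lab T}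
    (h : f.rel z y) (h' : f.rel z y') : y = y' := by
  induction f with
  | id w => exact h.1.symm.trans h'.1
  | comp f g ihf ihg =>
    obtain ⟨u, hf, hg⟩ := h
    obtain ⟨u', hf', hg'⟩ := h'
    obtain rfl := ihf hf hf'
    exact ihg hg hg'
  | mul σ φ f g ihf ihg =>
    obtain ⟨z₀, y₀, z₁, y₁, hf, hg, rfl, rfl⟩ := h
    obtain ⟨z₀', y₀', z₁', y₁', hf', hg', e, rfl⟩ := h'
    obtain ⟨rfl, rfl⟩ := Tr.mul_inj σ φ e
      ((f.rel_erase hf).1.trans (f.rel_erase hf').1.symm)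
      fun i => ((g i).rel_erase (hg i)).1.trans ((g i).rel_erase (hg' i)).1.symm
    rw [ihf hf hf', funext fun i => ihg i (hg i) (hg' i)]
  | γ σ φ =>
    obtain ⟨x, x', rfl, rfl⟩ := h
    obtain ⟨y, y', e, rfl⟩ := h'
    obtain ⟨h₁, h₂⟩ := Tr.mul_inj σ φ e rfl fun _ => rfl
    rw [Tr.gen_injective h₁, funext fun i => Tr.gen_injective (congrFun h₂ i)]
  | ε => exact h.2.trans h'.2.symm

/-- Labelled trees carry an action of the formal morphisms satisfying every relation of `H`, the
operad axioms being those of grafting. The induced map of labellings is therefore an invariant of a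
morphism of `H`. -/
theorem HRel.rel_iff {T : Ω} {w w' x x' : HObj T} {f : HPre w w'} {g : HPre x x'}
    (h : HRel f g) (z y : Lab T) : f.rel z y ↔ g.rel z y := by
  induction h with
  | refl => exact Iff.rfl
  | symm _ ih => exact (ih z y).symm
  | trans _ _ ih ih' => exact (ih z y).trans (ih' z y)
  | comp_congr _ _ ih ih' => simp only [HPre.rel, ih, ih']
  | mul_congr σ φ _ _ ih ih' => simp only [HPre.rel, ih, ih']
  | id_comp f =>
    constructor
    · rintro ⟨_, ⟨rfl, _⟩, h⟩
      exact h
    · exact fun h => ⟨z, ⟨rfl, (f.rel_erase h).1⟩, h⟩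
  | comp_id f =>
    constructor
    · rintro ⟨_, h, ⟨rfl, _⟩⟩
      exact h
    · exact fun h => ⟨y, h, ⟨rfl, (f.rel_erase h).2⟩⟩
  | comp_assoc f g h =>
    constructor
    · rintro ⟨u, ⟨u', hf, hg⟩, hh⟩
      exact ⟨u', hf, u, hg, hh⟩
    · rintro ⟨u', hf, u, hg, hh⟩
      exact ⟨u, ⟨u', hf, hg⟩, hh⟩
  | mul_ids σ φ s t =>
    constructor
    · rintro ⟨z₀, y₀, z₁, y₁, ⟨rfl, hs⟩, ht, rfl, rfl⟩
      refine ⟨by rw [funext fun i => (ht i).1], ?_⟩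
      rw [Tr.erase_mul, HObj.nf_mul, hs, funext fun i => (ht i).2]
    · rintro ⟨rfl, h⟩
      rw [HObj.nf_mul] at h
      obtain ⟨z₀, z₁, h₀, h₁, rfl⟩ := Tr.exists_of_erase_eq_mul _ _ _ _ _ h
      exact ⟨z₀, z₀, z₁, z₁, ⟨rfl, h₀⟩, fun i => ⟨rfl, h₁ i⟩, rfl, rfl⟩
  | mul_comp σ φ f f' g g' =>
    constructor
    · rintro ⟨z₀, y₀, z₁, y₁, ⟨u, hf, hf'⟩, hg, rfl, rfl⟩
      choose v hg hg' using hg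
      exact ⟨Tr.mul σ φ u v, ⟨z₀, u, z₁, v, hf, hg, rfl, rfl⟩, ⟨u, y₀, v, y₁, hf', hg', rfl, rfl⟩⟩
    · rintro ⟨_, ⟨z₀, u, z₁, v, hf, hg, rfl, rfl⟩, ⟨u', y₀, v', y₁, hf', hg', e, rfl⟩⟩
      -- The intermediate labelling is presented twice as a grafting; the shapes at `s'` and `t'`
      -- agree, so the factors agree.
      obtain ⟨rfl, rfl⟩ := Tr.mul_inj σ φ e
        ((f.rel_erase hf).2.trans (f'.rel_erase hf').1.symm)
        fun i => ((g i).rel_erase (hg i)).2.trans ((g' i).rel_erase (hg' i)).1.symm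
      exact ⟨z₀, y₀, z₁, y₁, ⟨u, hf, hf'⟩, fun i => ⟨v i, hg i, hg' i⟩, rfl, rfl⟩
  | assoc σ ω φ ψ χ f g h =>
    constructor
    · rintro ⟨_, _, z₁, y₁, ⟨z₀, y₀, z₂, y₂, hf, hg, rfl, rfl⟩, hh, rfl, rfl⟩
      exact ⟨z₀, y₀, _, _, hf, fun i => ⟨z₂ i, y₂ i, _, _, hg i, fun j => hh _, rfl, rfl⟩,
        Tr.mul_assoc σ ω φ ψ χ _ _ _, Tr.mul_assoc σ ω φ ψ χ _ _ _⟩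
    · rintro ⟨z₀, y₀, z₁, y₁, hf, hg, rfl, rfl⟩
      choose z₂ y₂ z₃ y₃ hg hh hz hy using hg
      -- The labellings found over the fibres of `ω` are assembled into families over all tips of
      -- its source.
      obtain ⟨z₄, hz₄⟩ := Fibre.exists_glue ψ (B := fun k => Lab _) z₃
      obtain ⟨y₄, hy₄⟩ := Fibre.exists_glue ψ (B := fun k => Lab _) y₃
      refine ⟨_, _, z₄, y₄, ⟨z₀, y₀, z₂, y₂, hf, hg, rfl, rfl⟩, fun k => ?_, ?_, ?_⟩
      · obtain ⟨i, j, rfl⟩ := Fibre.exists_tip ψ k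
        rw [hz₄, hy₄]
        exact hh i j
      · rw [Tr.mul_assoc σ ω φ ψ χ, funext hz]
        simp only [hz₄]
      · rw [Tr.mul_assoc σ ω φ ψ χ, funext hy]
        simp only [hy₄]
  | mul_id f =>
    constructor
    · rintro ⟨z₀, y₀, z₁, y₁, hf, h, rfl, rfl⟩
      obtain rfl : z₁ = fun _ => .unit := funext fun i => Tr.erase_eq_unit (h i).2
      obtain rfl : y₁ = fun _ => .unit := funext fun i => (h i).1.symm
      rwa [Tr.mul_id, Tr.mul_id]
    · exact fun h => ⟨z, y, fun _ => .unit, fun _ => .unit, h, fun _ => ⟨rfl, rfl⟩,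
        (Tr.mul_id z).symm, (Tr.mul_id y).symm⟩
  | mul_bang f =>
    constructor
    · rintro ⟨z₀, _, z₁, y₁, ⟨rfl, h⟩, hf, rfl, rfl⟩
      obtain rfl := Tr.erase_eq_unit h
      rw [Tr.mul_unit z₁ (𝟙 _), Tr.mul_unit y₁ (𝟙 _)]
      exact hf _
    · exact fun h => ⟨.unit, .unit, fun _ => z, fun _ => y, ⟨rfl, rfl⟩, fun _ => h,
        (Tr.mul_unit (fun _ => z) (𝟙 _)).symm, (Tr.mul_unit (fun _ => y) (𝟙 _)).symm⟩
  | γ_assoc σ ω φ ψ χ =>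
    constructor
    · rintro ⟨_, ⟨_, _, z₁, _, ⟨x, x', rfl, rfl⟩, h, rfl, rfl⟩, ⟨a, a', e, rfl⟩⟩
      obtain rfl := funext fun i => (h i).1
      choose b hb using fun i => Tr.erase_eq_gen (h i).2
      obtain rfl := funext hb
      -- The intermediate labelling is a product of single generators in two ways, so the labels can
      -- be matched one by one.
      obtain ⟨h₁, h₂⟩ := Tr.mul_inj σ φ e rfl fun _ => rfl
      obtain rfl := Tr.gen_injective h₁
      obtain rfl := funext fun i => Tr.gen_injective (congrFun h₂ i)
      exact ⟨_, ⟨_, _, _, _, ⟨rfl, rfl⟩, fun i => ⟨x' i, _, rfl, rfl⟩,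
        Tr.mul_assoc σ ω φ ψ χ _ _ _, rfl⟩, x, _, rfl,
        congrArg _ (Tr.mul_assoc σ ω φ ψ χ _ _ _)⟩
    · rintro ⟨_, ⟨z₀, _, z₁, y₁, ⟨rfl, h₀⟩, h, rfl, rfl⟩, ⟨a, a', e, rfl⟩⟩
      choose x x' hz hy using h
      obtain ⟨x₁, hx₁⟩ := Fibre.exists_glue ψ (B := fun k => Nf _) x'
      obtain rfl := funext hz
      obtain rfl := funext hy
      obtain ⟨b, rfl⟩ := Tr.erase_eq_gen h₀
      obtain ⟨h₁, h₂⟩ := Tr.mul_inj _ _ e rfl fun _ => rfl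
      obtain rfl := Tr.gen_injective h₁
      obtain rfl := funext fun i => Tr.gen_injective (congrFun h₂ i)
      refine ⟨_, ⟨_, _, fun k => Tr.gen (x₁ k), _, ⟨b, x, rfl, rfl⟩, fun i => ⟨rfl, rfl⟩,
        ?_, rfl⟩, _, x₁, rfl, ?_⟩
      · rw [Tr.mul_assoc σ ω φ ψ χ]
        simp only [hx₁]
      · rw [Tr.mul_assoc σ ω φ ψ χ]
        simp only [hx₁]
  | γ_id T =>
    constructor
    · rintro ⟨_, ⟨z₀, _, z₁, y₁, ⟨rfl, h₀⟩, h, rfl, rfl⟩, ⟨a, a', e, rfl⟩⟩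
      obtain rfl : z₁ = fun _ => .unit := funext fun i => (h i).1
      obtain rfl : y₁ = fun _ => Tr.gen .unit := funext fun i => (h i).2
      obtain ⟨b, rfl⟩ := Tr.erase_eq_gen h₀
      obtain ⟨h₁, h₂⟩ := Tr.mul_inj _ _ e rfl fun _ => rfl
      obtain rfl := Tr.gen_injective h₁
      obtain rfl := funext fun i => Tr.gen_injective (congrFun h₂ i)
      rw [Tr.mul_id, Tr.mul_id]
      exact ⟨rfl, rfl⟩
    · rintro ⟨rfl, h⟩
      obtain ⟨b, rfl⟩ := Tr.erase_eq_gen h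
      exact ⟨_, ⟨Tr.gen b, _, fun _ => .unit, fun _ => Tr.gen .unit, ⟨rfl, rfl⟩,
        fun i => ⟨rfl, rfl⟩, (Tr.mul_id _).symm, rfl⟩, b, fun _ => .unit, rfl,
        by rw [Tr.mul_id]⟩
  | γ_bang T =>
    constructor
    · rintro ⟨_, ⟨z₀, y₀, z₁, y₁, ⟨rfl, rfl⟩, h, rfl, rfl⟩, ⟨a, a', e, rfl⟩⟩
      obtain rfl := funext fun i => (h i).1
      choose b hb using fun i => Tr.erase_eq_gen (h i).2
      obtain rfl := funext hb
      obtain ⟨h₁, h₂⟩ := Tr.mul_inj _ _ e rfl fun _ => rfl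
      obtain rfl := Tr.gen_injective h₁
      obtain rfl := funext fun i => Tr.gen_injective (congrFun h₂ i)
      rw [Tr.mul_unit _ (𝟙 _), Tr.mul_unit b (𝟙 _)]
      exact ⟨rfl, rfl⟩
    · rintro ⟨rfl, h⟩
      obtain ⟨b, rfl⟩ := Tr.erase_eq_gen h
      exact ⟨_, ⟨.unit, Tr.gen .unit, fun _ => Tr.gen b, _, ⟨rfl, rfl⟩, fun _ => ⟨rfl, rfl⟩,
        (Tr.mul_unit (fun _ => Tr.gen b) (𝟙 _)).symm, rfl⟩, .unit, fun _ => b, rfl,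
        by rw [Tr.mul_unit (fun _ => b) (𝟙 _)]⟩

theorem Tr.rel_can {T : Ω} (x : Nf T) : x.can.rel x.diag (Tr.gen x) := by
  induction x with
  | unit => exact ⟨rfl, rfl⟩
  | node x σ φ t ih =>
    exact ⟨_, ⟨Tr.gen (Tr.gen ()), _, fun i => (t i).diag, fun i => Tr.gen (t i), ⟨rfl, rfl⟩, ih,
      (Tr.mul_gen _ σ φ _).symm, rfl⟩, _, t, rfl, by rw [Tr.mul_gen]⟩

/-- Applied to the tautological labelling of its source, the morphism reassembles at each generator
of the target the part of the source lying over it. This recovers `z`. -/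
theorem Tr.rel_hom {T : Ω} (z : Lab T) : z.hom.rel z.flat.diag z := by
  induction z with
  | unit => exact ⟨rfl, rfl⟩
  | node x σ φ t ih =>
    exact ⟨x.diag, Tr.gen x, _, t, x.rel_can, ih, Tr.diag_mul _ _ _ _, (Tr.mul_gen _ _ _ _).symm⟩

/-- Related morphisms have the same source and act alike on its tautological labelling; the results
are `z` and `y`. -/
theorem Tr.eq_of_hom_rel {T : Ω} {z y : Lab T} (h : HRel z.hom y.hom) : z = y := by
  have e : z.flat = y.flat := by
    rw [← Tr.nf_toH z.flat, ← Tr.nf_toH y.flat, ← Tr.src_eq, ← Tr.src_eq, h.src_tgt_eq.1]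
  refine y.hom.rel_unique ((h.rel_iff _ _).1 z.rel_hom) ?_
  rw [e]
  exact y.rel_hom

theorem Tr.src_tgt_lab {T : Ω} (W : HObj T) (d : W.nf.Dec) :
    (W.nf.lab d).erase.toH = W := by
  rw [Tr.erase_lab, HObj.toH_nf]

/-- The morphism with target `W` given by a decoration. -/
noncomputable def HObj.homOf {T : Ω} (W : HObj T) (d : W.nf.Dec) : Σ W' : HObj T, W' ⟶ W :=
  ⟨(W.nf.lab d).src, (W.nf.lab d).hom.toHom ≫ eqToHom (Tr.src_tgt_lab W d)⟩

/-- This turns sums over choices of trees at the generators of `W` into sums over morphisms into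
`W`. Injectivity is `Tr.eq_of_hom_rel`, surjectivity `HPre.exists_hom`. -/
theorem HObj.homOf_bijective {T : Ω} (W : HObj T) : Function.Bijective W.homOf := by
  constructor
  · have key : ∀ {w w' x x' : HObj T} (a : HPre w x) (b : HPre w' x') (ea : x = W) (eb : x' = W),
        (⟨w, a.toHom ≫ eqToHom ea⟩ : Σ W' : HObj T, W' ⟶ W) = ⟨w', b.toHom ≫ eqToHom eb⟩ →
        HRel a b := by
      intro w w' x x' a b ea eb h
      subst ea eb
      simp only [eqToHom_refl, Category.comp_id] at h
      obtain ⟨rfl, h⟩ := Sigma.mk.inj h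
      exact Quotient.exact (s := hSetoid _ _) (eq_of_heq h)
    exact fun d d' h => W.nf.lab_injective (Tr.eq_of_hom_rel (key _ _ _ _ h))
  · rintro ⟨W', f⟩
    obtain ⟨g, rfl⟩ := HHom.exists_rep f
    obtain ⟨z, hz⟩ := g.exists_hom
    have e := hz.src_tgt_eq.2
    obtain ⟨d, rfl⟩ := Tr.exists_lab W.nf z (by rw [← Tr.nf_toH z.erase, e])
    refine ⟨d, ?_⟩
    have key : ∀ {w x : HObj T} (a : HPre w x) (ea : x = W), HRel a g →
        (⟨w, a.toHom ≫ eqToHom ea⟩ : Σ W' : HObj T, W' ⟶ W) = ⟨W', g.toHom⟩ := by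
      intro w x a ea h
      obtain ⟨rfl, rfl⟩ := h.src_tgt_eq
      simp only [eqToHom_refl, Category.comp_id]
      congr 1
      exact Quotient.sound h
    exact key _ _ hz

end HigherOperad

namespace HigherOperad

/-! ## Coproducts -/

section Coproducts

variable {C : Type u} [Category.{v} C] {J K : Type} {X : J → C} {c : C}

/-- The morphisms `f j` exhibit `c` as the coproduct of their sources. -/
def IsCoprod (f : ∀ j, X j ⟶ c) : Prop :=
  ∀ Z : C, Function.Bijective fun (g : c ⟶ Z) j => f j ≫ g

theorem isCoprod_iff (f : ∀ j, X j ⟶ c) : IsCoprod f ↔ Nonempty (IsColimit (Cofan.mk c f)) := by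
  constructor
  · intro h
    refine ⟨Cofan.IsColimit.mk _ (fun s => ((h s.pt).2 s.inj).choose)
      (fun s j => congrFun ((h s.pt).2 s.inj).choose_spec j) fun s m hm => (h s.pt).1 ?_⟩
    exact (funext hm).trans ((h s.pt).2 s.inj).choose_spec.symm
  · rintro ⟨h⟩ Z
    refine ⟨fun g g' e => Cofan.IsColimit.hom_ext h _ _ fun j => congrFun e j, fun t => ?_⟩
    exact ⟨Cofan.IsColimit.desc h t, funext fun j => Cofan.IsColimit.fac h t j⟩

namespace IsCoprod

theorem hom_ext {f : ∀ j, X j ⟶ c} (h : IsCoprod f) {Z : C} {g g' : c ⟶ Z}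
    (e : ∀ j, f j ≫ g = f j ≫ g') : g = g' := (h Z).1 (funext e)

/-- The morphism out of a coproduct with given components. -/
noncomputable def desc {f : ∀ j, X j ⟶ c} (h : IsCoprod f) {Z : C} (t : ∀ j, X j ⟶ Z) : c ⟶ Z :=
  ((h Z).2 t).choose

theorem fac {f : ∀ j, X j ⟶ c} (h : IsCoprod f) {Z : C} (t : ∀ j, X j ⟶ Z) (j : J) :
    f j ≫ h.desc t = t j := congrFun ((h Z).2 t).choose_spec j

theorem congr {f g : ∀ j, X j ⟶ c} (h : IsCoprod f) (e : ∀ j, f j = g j) : IsCoprod g :=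
  funext e ▸ h

theorem comp_isIso {f : ∀ j, X j ⟶ c} (h : IsCoprod f) {c' : C} (a : c ⟶ c') [IsIso a] :
    IsCoprod fun j => f j ≫ a := by
  intro Z
  refine ⟨fun g g' e => ?_, fun t => ?_⟩
  · have : a ≫ g = a ≫ g' := h.hom_ext fun j => by simpa using congrFun e j
    rwa [cancel_epi] at this
  · exact ⟨inv a ≫ h.desc t, funext fun j => by simp [h.fac]⟩

theorem isIso_comp {f : ∀ j, X j ⟶ c} (h : IsCoprod f) {X' : J → C} (a : ∀ j, X' j ⟶ X j)
    [∀ j, IsIso (a j)] : IsCoprod fun j => a j ≫ f j := by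
  intro Z
  refine ⟨fun g g' e => h.hom_ext fun j => ?_, fun t => ?_⟩
  · have := congrFun e j
    simp only [Category.assoc, cancel_epi] at this
    exact this
  · exact ⟨h.desc fun j => inv (a j) ≫ t j, funext fun j => by simp [h.fac]⟩

theorem reindex {f : ∀ j, X j ⟶ c} (h : IsCoprod f) {e : K → J} (he : Function.Bijective e) :
    IsCoprod fun k => f (e k) := by
  intro Z
  refine ⟨fun g g' eq => h.hom_ext fun j => ?_, fun t => ?_⟩
  · obtain ⟨k, rfl⟩ := he.2 j
    exact congrFun eq k
  · have : ∃ t' : ∀ j, X j ⟶ Z, ∀ k, t' (e k) = t k := by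
      choose p hp using he.2
      refine ⟨fun j => eqToHom (congrArg X (hp j)).symm ≫ t (p j), fun k => ?_⟩
      have key : ∀ k', (hk : k' = k) → eqToHom (by rw [hk]) ≫ t k' = t k := by
        rintro _ rfl
        simp
      exact key _ (he.1 (hp (e k)))
    obtain ⟨t', ht'⟩ := this
    exact ⟨h.desc t', funext fun k => by simp [h.fac, ht']⟩

theorem of_reindex {f : ∀ j, X j ⟶ c} {e : K → J} (he : Function.Bijective e)
    (h : IsCoprod fun k => f (e k)) : IsCoprod f := by
  intro Z
  refine ⟨fun g g' eq => h.hom_ext fun k => congrFun eq (e k), fun t => ?_⟩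
  refine ⟨h.desc fun k => t (e k), funext fun j => ?_⟩
  obtain ⟨k, rfl⟩ := he.2 j
  exact h.fac (fun k => t (e k)) k

theorem of_isIso {f : ∀ j, X j ⟶ c} [Unique J] (h : IsIso (f default)) : IsCoprod f := by
  intro Z
  refine ⟨fun g g' e => ?_, fun t => ⟨inv (f default) ≫ t default, funext fun j => ?_⟩⟩
  · have := congrFun e default
    simpa only [cancel_epi] using this
  · rw [Unique.eq_default j]
    simp

/-- A coproduct of coproducts. -/
theorem sigma {f : ∀ j, X j ⟶ c} (h : IsCoprod f) {L : J → Type} {Y : ∀ j, L j → C}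
    {g : ∀ j l, Y j l ⟶ X j} (hg : ∀ j, IsCoprod (g j)) :
    IsCoprod (J := Σ j, L j) fun p => g p.1 p.2 ≫ f p.1 := by
  intro Z
  refine ⟨fun a a' e => h.hom_ext fun j => (hg j).hom_ext fun l => ?_, fun t => ?_⟩
  · simpa using congrFun e ⟨j, l⟩
  · exact ⟨h.desc fun j => (hg j).desc fun l => t ⟨j, l⟩, funext fun ⟨j, l⟩ => by
      simp [h.fac, (hg j).fac]⟩

theorem map {E : Type u} [Category.{v} E] {f : ∀ j, X j ⟶ c} (h : IsCoprod f) (M : C ⥤ E)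
    (hM : PreservesColimits M) : IsCoprod fun j => M.map (f j) := by
  rw [isCoprod_iff] at h ⊢
  -- Index types live in universe `0`, while `M` is known to preserve colimits of size `v`.
  have := preservesSmallestColimits_of_preservesColimits M
  exact ⟨isColimitCofanMkObjOfIsColimit M _ _ h.some⟩

end IsCoprod

/-- Coproducts exist in cocomplete categories. -/
theorem exists_isCoprod (hC : HasColimits C) (X : J → C) :
    ∃ (c : C) (f : ∀ j, X j ⟶ c), IsCoprod f := by
  have : HasColimitsOfSize.{0, 0} C := hasSmallestColimitsOfHasColimits C
  exact ⟨∐ X, Sigma.ι X, (isCoprod_iff _).2 ⟨coproductIsCoproduct X⟩⟩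

end Coproducts

/-! ### Distributivity of functors that preserve colimits in each variable. -/

section EachVariable

variable {C E : Type u} [Category.{v} C] [Category.{v} E] {I : Type} {D : I → Type u}
  [∀ i, Category.{v} (D i)] {M : C × (∀ i, D i) ⥤ E}

theorem PreservesColimitsInEachVariable.isCoprod_fst (hM : PreservesColimitsInEachVariable M)
    {J : Type} {X : J → C} {c : C} {f : ∀ j, X j ⟶ c} (h : IsCoprod f) (d : ∀ i, D i) :
    IsCoprod fun j => M.map (CategoryTheory.Prod.mkHom (f j) (𝟙 d)) :=
  h.map _ (hM.1 d)

theorem varyCoord_eval (d : ∀ i, D i) (i : I) : varyCoord d i ⋙ Pi.eval _ i = 𝟭 (D i) := by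
  classical
  exact (dif_pos rfl : (if h : i = i then h ▸ 𝟭 (D i) else (Functor.const _).obj (d i)) = 𝟭 (D i))

theorem varyCoord_eval_ne (d : ∀ i, D i) {i k : I} (h : i ≠ k) :
    varyCoord d i ⋙ Pi.eval _ k = (Functor.const _).obj (d k) := by
  classical
  exact (dif_neg h : (if h : i = k then h ▸ 𝟭 (D i) else (Functor.const (D i)).obj (d k)) = _)

/-- A morphism into `d` all whose components except for the `i`-th are invertible arises by varying
the `i`-th coordinate of `d`. -/
theorem exists_varyCoord (d : ∀ i, D i) (i : I) : ∃ (a : (varyCoord d i).obj (d i) ⟶ d),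
    IsIso a ∧ ∀ (P : ∀ i, D i) (p : P ⟶ d), (∀ k, k ≠ i → IsIso (p k)) →
      ∃ b : P ⟶ (varyCoord d i).obj (P i), IsIso b ∧ p = b ≫ (varyCoord d i).map (p i) ≫ a := by
  classical
  have e₁ : ∀ y, (varyCoord d i).obj y i = y := Functor.congr_obj (varyCoord_eval d i)
  have e₂ : ∀ k, i ≠ k → ∀ y, (varyCoord d i).obj y k = d k :=
    fun k h => Functor.congr_obj (varyCoord_eval_ne d h)
  have m₁ : ∀ {y y'} (g : y ⟶ y'), (varyCoord d i).map g i =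
      eqToHom (e₁ y) ≫ g ≫ eqToHom (e₁ y').symm := Functor.congr_hom (varyCoord_eval d i)
  have m₂ : ∀ k (h : i ≠ k) {y y'} (g : y ⟶ y'), (varyCoord d i).map g k =
      eqToHom (e₂ k h y) ≫ 𝟙 _ ≫ eqToHom (e₂ k h y').symm :=
    fun k h => Functor.congr_hom (varyCoord_eval_ne d h)
  refine ⟨fun k => eqToHom (by
    by_cases h : i = k
    · subst h; exact e₁ _
    · exact e₂ k h _), ?_, fun P p hp => ⟨fun k => if h : i = k then eqToHom (by
      subst h; exact (e₁ _).symm) else p k ≫ eqToHom (e₂ k h _).symm, ?_, ?_⟩⟩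
  · rw [isIso_pi_iff]
    intro k
    infer_instance
  · rw [isIso_pi_iff]
    intro k
    by_cases h : i = k
    · simp only [h, dite_true]
      infer_instance
    · have := hp k (Ne.symm h)
      simp only [h, dite_false]
      infer_instance
  · funext k
    by_cases h : i = k
    · subst h
      simp [m₁]
    · simp [h, m₂ k h]

/-- Off the coordinate `i` the components need only be invertible: `varyCoord` fixes those
coordinates up to transport only, and isomorphisms absorb the difference. -/
theorem PreservesColimitsInEachVariable.isCoprod_snd (hM : PreservesColimitsInEachVariable M)
    (c : C) {J : Type} {P : J → ∀ i, D i} {d : ∀ i, D i} {p : ∀ j, P j ⟶ d} (i : I)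
    (hp : ∀ j k, k ≠ i → IsIso (p j k)) (h : IsCoprod fun j => p j i) :
    IsCoprod fun j => M.map (CategoryTheory.Prod.mkHom (𝟙 c) (p j)) := by
  obtain ⟨a, ha, hb⟩ := exists_varyCoord d i
  choose b hb hbp using fun j => hb (P j) (p j) (hp j)
  have hc := h.map _ (hM.2 c d i)
  have iso₁ : IsIso (M.map (CategoryTheory.Prod.mkHom (𝟙 c) a)) := by
    have : IsIso (CategoryTheory.Prod.mkHom (𝟙 c) a) := by
      rw [isIso_prod_iff]
      exact ⟨inferInstance, ha⟩
    infer_instance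
  have iso₂ : ∀ j, IsIso (M.map (CategoryTheory.Prod.mkHom (𝟙 c) (b j))) := fun j => by
    have : IsIso (CategoryTheory.Prod.mkHom (𝟙 c) (b j)) := by
      rw [isIso_prod_iff]
      exact ⟨inferInstance, hb j⟩
    infer_instance
  convert (hc.isIso_comp fun j => M.map (CategoryTheory.Prod.mkHom (𝟙 c) (b j))).comp_isIso
    (M.map (CategoryTheory.Prod.mkHom (𝟙 c) a)) using 2 with j
  simp only [Functor.comp_map]
  rw [← Functor.map_comp, ← Functor.map_comp]
  congr 1
  refine CategoryTheory.Prod.hom_ext ?_ ?_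
  · simp
  · simp only [CategoryTheory.prod_comp_snd, Functor.prod'_map, Category.assoc]
    exact hbp j

/-- A summand of a coproduct, or the whole coproduct. -/
def optObj {C : Type u} {J : Type} (X : J → C) (c : C) : Option J → C
  | none => c
  | some j => X j

/-- The morphism from a summand, or from the whole coproduct. -/
def optInj {C : Type u} [Category.{v} C] {J : Type} {X : J → C} {c : C} (f : ∀ j, X j ⟶ c) :
    ∀ o : Option J, optObj X c o ⟶ c
  | none => 𝟙 c
  | some j => f j

theorem exists_optObj_hom {C : Type u} [Category.{v} C] {J : Type} {X : J → C} {c : C}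
    (f : ∀ j, X j ⟶ c) (o' o : Option J) (h : o = none ∨ o' = o) :
    ∃ g : optObj X c o' ⟶ optObj X c o, g ≫ optInj f o = optInj f o' ∧ (o' = o → IsIso g) := by
  by_cases e : o' = o
  · subst e
    exact ⟨𝟙 _, Category.id_comp _, fun _ => inferInstance⟩
  · obtain rfl := h.resolve_right e
    exact ⟨optInj f o', Category.comp_id _, fun h => absurd h e⟩

/-- A functor which preserves colimits in each of finitely many variables distributes over
coproducts. -/
theorem PreservesColimitsInEachVariable.isCoprod_pi [Finite I]
    (hM : PreservesColimitsInEachVariable M) (c : C) {J : I → Type} {X : ∀ i, J i → D i}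
    {d : ∀ i, D i} {f : ∀ i j, X i j ⟶ d i} (h : ∀ i, IsCoprod (f i)) :
    IsCoprod (J := ∀ i, J i) fun κ => M.map (CategoryTheory.Prod.mkHom (𝟙 c)
      (show (fun i => X i (κ i)) ⟶ d from fun i => f i (κ i))) := by
  classical
  have := Fintype.ofFinite I
  let Y : (∀ i, Option (J i)) → ∀ i, D i := fun κ i => optObj (X i) (d i) (κ i)
  let inj : ∀ κ, Y κ ⟶ d := fun κ i => optInj (f i) (κ i)
  -- The coordinates are expanded one at a time: those in `s` are replaced by a summand (`some j`),
  -- the others keep the whole coproduct (`none`).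
  have key : ∀ s : Finset I, IsCoprod (J := {κ : ∀ i, Option (J i) // ∀ i, (κ i).isSome ↔ i ∈ s})
      fun κ => M.map (CategoryTheory.Prod.mkHom (𝟙 c) (inj κ.1)) := by
    intro s
    induction s using Finset.induction_on with
    | empty =>
      let U : Unique {κ : ∀ i, Option (J i) // ∀ i, (κ i).isSome ↔ i ∈ (∅ : Finset I)} :=
        { default := ⟨fun _ => none, by simp⟩
          uniq := fun κ => Subtype.ext (funext fun i => by simpa using κ.2 i) }
      refine IsCoprod.of_isIso ?_
      have : (inj fun _ => none) = 𝟙 d := rfl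
      change IsIso (M.map (CategoryTheory.Prod.mkHom (𝟙 c) (inj fun _ => none)))
      rw [this]
      change IsIso (M.map (𝟙 (c, d)))
      infer_instance
    | insert i s hi ih =>
      have hκ : ∀ κ : {κ : ∀ i, Option (J i) // ∀ i, (κ i).isSome ↔ i ∈ s}, κ.1 i = none :=
        fun κ => by
          have := (κ.2 i).not.2 hi
          simpa using this
      let up : ∀ κ : {κ : ∀ i, Option (J i) // ∀ i, (κ i).isSome ↔ i ∈ s}, J i →
          ∀ i, Option (J i) := fun κ j => Function.update κ.1 i (some j)
      have hup : ∀ κ j k, k ≠ i → up κ j k = κ.1 k := fun κ j k hk =>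
        Function.update_of_ne hk _ _
      have hup' : ∀ κ j, up κ j i = some j := fun κ j => Function.update_self _ _ _
      -- At coordinate `i` this includes the summand `j` into the whole coproduct; elsewhere it is
      -- invertible, as `isCoprod_snd` requires.
      choose g hg hgi using fun κ j k => exists_optObj_hom (f k) (up κ j k) (κ.1 k) (by
        by_cases hk : k = i
        · subst hk; exact Or.inl (hκ κ)
        · exact Or.inr (hup κ j k hk))
      have hcop : ∀ κ, IsCoprod fun j => M.map (CategoryTheory.Prod.mkHom (𝟙 c)
          (show Y (up κ j) ⟶ Y κ.1 from fun k => g κ j k)) := by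
        intro κ
        refine hM.isCoprod_snd c i (fun j k hk => hgi κ j k (hup κ j k hk)) ?_
        have e₁ : IsIso (optInj (f i) (κ.1 i)) := by
          rw [hκ]; exact (inferInstance : IsIso (𝟙 (d i)))
        have e : ∀ j, g κ j i = optInj (f i) (up κ j i) ≫ inv (optInj (f i) (κ.1 i)) := fun j => by
          rw [IsIso.eq_comp_inv]; exact hg κ j i
        have e₂ : IsCoprod fun j => optInj (f i) (up κ j i) := by
          have : ∀ o : J i → Option (J i), (∀ j, o j = some j) →
              IsCoprod fun j => optInj (f i) (o j) := by
            intro o ho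
            obtain rfl : o = some := funext ho
            exact h i
          exact this _ (hup' κ)
        simp only [e]
        exact e₂.comp_isIso _
      refine IsCoprod.of_reindex (K := Σ _ : {κ : ∀ i, Option (J i) //
        ∀ i, (κ i).isSome ↔ i ∈ s}, J i) (e := fun p => ⟨up p.1 p.2, fun k => ?_⟩) ⟨?_, ?_⟩ ?_
      · by_cases hk : k = i
        · subst hk; simp [hup']
        · rw [hup _ _ _ hk, p.1.2]; simp [hk]
      · rintro ⟨κ, j⟩ ⟨κ', j'⟩ e
        have e' : up κ j = up κ' j' := congrArg Subtype.val e
        have hj := congrFun e' i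
        rw [hup', hup'] at hj
        obtain rfl := Option.some.inj hj
        obtain rfl : κ = κ' := Subtype.ext (funext fun k => by
          by_cases hk : k = i
          · subst hk; rw [hκ, hκ]
          · rw [← hup κ j k hk, e', hup κ' j k hk])
        rfl
      · rintro ⟨κ, hk⟩
        obtain ⟨j, hj⟩ := Option.isSome_iff_exists.1 ((hk i).2 (by simp))
        refine ⟨⟨⟨Function.update κ i none, fun k => ?_⟩, j⟩, Subtype.ext ?_⟩
        · by_cases e : k = i
          · subst e; simp [hi]
          · rw [Function.update_of_ne e, hk]; simp [e]
        · change Function.update (Function.update κ i none) i (some j) = κ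
          rw [Function.update_idem, ← hj, Function.update_eq_self]
      · convert ih.sigma hcop using 2 with p
        rw [← Functor.map_comp]
        congr 1
        refine CategoryTheory.Prod.hom_ext ?_ ?_
        · simp
        · funext k
          exact (hg p.1 p.2 k).symm
  -- With every coordinate expanded, no `none` remains and the index is a plain choice function.
  have huniv := key Finset.univ
  refine huniv.reindex (e := fun κ : ∀ i, J i => ⟨fun i => some (κ i), by simp⟩) ⟨fun κ κ' e => ?_, fun κ => ?_⟩
  · funext i
    exact Option.some.inj (congrFun (congrArg Subtype.val e) i)
  · choose j hj using fun i => Option.isSome_iff_exists.1 ((κ.2 i).2 (Finset.mem_univ i))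
    exact ⟨j, Subtype.ext (funext fun i => (hj i).symm)⟩

theorem PreservesColimitsInEachVariable.isCoprod [Finite I]
    (hM : PreservesColimitsInEachVariable M) {J₀ : Type} {X₀ : J₀ → C} {c : C}
    {f₀ : ∀ j, X₀ j ⟶ c} (h₀ : IsCoprod f₀) {J : I → Type} {X : ∀ i, J i → D i}
    {d : ∀ i, D i} {f : ∀ i j, X i j ⟶ d i} (h : ∀ i, IsCoprod (f i)) :
    IsCoprod (J := J₀ × ∀ i, J i) fun κ => M.map (CategoryTheory.Prod.mkHom (f₀ κ.1)
      (show (fun i => X i (κ.2 i)) ⟶ d from fun i => f i (κ.2 i))) := by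
  have := ((hM.isCoprod_fst h₀ d).sigma fun j => hM.isCoprod_pi (X₀ j) h).reindex
    (Equiv.sigmaEquivProd J₀ (∀ i, J i)).symm.bijective
  refine this.congr fun κ => ?_
  refine (M.map_comp _ _).symm.trans ?_
  congr 1
  refine CategoryTheory.Prod.hom_ext ?_ ?_
  · exact Category.id_comp _
  · exact Category.comp_id _

end EachVariable

end HigherOperad

namespace HigherOperad

variable {Ω : Type} [Category.{0} Ω] [Arities Ω]

/-! ## Multiplication of morphisms -/

namespace CatOperad

variable (A : CatOperad.{v, u} Ω)

theorem mulMap_comp {T S : Ω} (σ : T ⟶ S) {F : Tip S → Ω} (φ : ∀ i, Fibre σ i (F i))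
    {s s' s'' : A.obj S} {t t' t'' : ∀ i, A.obj (F i)} (f : s ⟶ s') (f' : s' ⟶ s'')
    (g : ∀ i, t i ⟶ t' i) (g' : ∀ i, t' i ⟶ t'' i) :
    A.mulMap σ φ (f ≫ f') (fun i => g i ≫ g' i) = A.mulMap σ φ f g ≫ A.mulMap σ φ f' g' :=
  (A.mul σ φ).map_comp (CategoryTheory.Prod.mkHom f (show t ⟶ t' from g))
    (CategoryTheory.Prod.mkHom f' (show t' ⟶ t'' from g'))

/-- The strict axioms equate functors whose values on objects are only provably equal, so on
morphisms they become heterogeneous equalities. -/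
theorem mulMap_assoc {T S R : Ω} (σ : T ⟶ S) (ω : S ⟶ R) {F : Tip S → Ω}
    (φ : ∀ j, Fibre σ j (F j)) {G : Tip R → Ω} (ψ : ∀ i, Fibre ω i (G i)) {H : Tip R → Ω}
    (χ : ∀ i, Fibre (σ ≫ ω) i (H i)) {r r' : A.obj R} {s s' : ∀ i, A.obj (G i)}
    {t t' : ∀ j, A.obj (F j)} (f : r ⟶ r') (g : ∀ i, s i ⟶ s' i) (h : ∀ j, t j ⟶ t' j) :
    HEq (A.mulMap σ φ (A.mulMap ω ψ f g) h)
      (A.mulMap (σ ≫ ω) χ f (fun i => A.mulMap ((ψ i).res (χ i))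
        (fun j => (ψ i).resFibre (χ i) j (φ (j ≫ (ψ i).ι))) (g i) fun j => h (j ≫ (ψ i).ι))) :=
  Functor.hcongr_hom (A.assoc σ ω φ ψ χ)
    (CategoryTheory.Prod.mkHom (CategoryTheory.Prod.mkHom f (show s ⟶ s' from g))
      (show t ⟶ t' from h))

theorem mulMap_unit_right {T : Ω} {s s' : A.obj T} (f : s ⟶ s') :
    HEq (A.mulMap (𝟙 T) Fibre.ofId f (fun _ => 𝟙 A.unit)) f :=
  Functor.hcongr_hom (A.mul_id T) f

theorem mulMap_unit_left {T : Ω} {s s' : A.obj T} (f : s ⟶ s') :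
    HEq (A.mulMap (bang T) (Fibre.ofBang T) (𝟙 A.unit) (fun _ => f)) f :=
  Functor.hcongr_hom (A.mul_bang T) f

theorem mulMap_heq {T S : Ω} (σ : T ⟶ S) {F : Tip S → Ω} (φ : ∀ i, Fibre σ i (F i))
    {s s' r r' : A.obj S} {t t' q q' : ∀ i, A.obj (F i)} {f : s ⟶ s'} {f' : r ⟶ r'}
    {g : ∀ i, t i ⟶ t' i} {g' : ∀ i, q i ⟶ q' i} (h₁ : s = r) (h₂ : s' = r')
    (h₃ : ∀ i, t i = q i) (h₄ : ∀ i, t' i = q' i) (hf : HEq f f') (hg : ∀ i, HEq (g i) (g' i)) :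
    HEq (A.mulMap σ φ f g) (A.mulMap σ φ f' g') := by
  obtain rfl := h₁
  obtain rfl := h₂
  obtain rfl : t = q := funext h₃
  obtain rfl : t' = q' := funext h₄
  obtain rfl := eq_of_heq hf
  obtain rfl : g = g' := funext fun i => eq_of_heq (hg i)
  rfl

end CatOperad

/-! ## Evaluation of trees -/

namespace Tr

/-- The value of a tree in a categorical operad, given values of the labels. -/
def val (A : CatOperad.{v, u} Ω) {X : Ω → Type} (e : ∀ S, X S → (IColl A ⥤ A.obj S)) :
    ∀ {T : Ω}, Tr X T → (IColl A ⥤ A.obj T)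
  | _, .unit => (Functor.const _).obj A.unit
  | _, .node x σ φ t => Functor.prod' (e _ x) (Functor.pi' fun i => (t i).val A e) ⋙ A.mul σ φ

/-- The value of a normal form at a collection. -/
abbrev tl (A : CatOperad.{v, u} Ω) {T : Ω} (t : Nf T) : IColl A ⥤ A.obj T :=
  t.val A fun S _ => Pi.eval _ S

theorem tl_gen (A : CatOperad.{v, u} Ω) (T : Ω) : (gen () : Nf T).tl A = Pi.eval _ T :=
  congrArg (fun M => (Pi.eval _ T : IColl A ⥤ A.obj T) ⋙ M) (A.mul_id T)

variable [UniqueFibres Ω]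

/-- Evaluation is a strict operadic functor: the unit case is `A.mul_bang`, the node case `A.assoc`.
-/
theorem val_mul (A : CatOperad.{v, u} Ω) {X : Ω → Type} (e : ∀ S, X S → (IColl A ⥤ A.obj S))
    {T S : Ω} (σ : T ⟶ S) {F : Tip S → Ω} (φ : ∀ i, Fibre σ i (F i)) (s : Tr X S)
    (t : ∀ i, Tr X (F i)) : (mul σ φ s t).val A e =
      Functor.prod' (s.val A e) (Functor.pi' fun i => (t i).val A e) ⋙ A.mul σ φ := by
  induction s generalizing T with
  | unit =>
    revert t
    refine Fibre.bang_cases (P := fun σ F φ => ∀ t : ∀ i, Tr X (F i),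
      (mul σ φ .unit t).val A e = Functor.prod' (val A e .unit)
        (Functor.pi' fun i => (t i).val A e) ⋙ A.mul σ φ) ?_ σ F φ
    intro t
    obtain ⟨t, rfl⟩ : ∃ t', t = fun _ => t' :=
      ⟨t (𝟙 _), funext fun i => by rw [Subsingleton.elim i (𝟙 _)]⟩
    rw [mul_unit _ (𝟙 _)]
    exact (congrArg (fun M => t.val A e ⋙ M) (A.mul_bang _)).symm
  | node x ω ψ s ih =>
    rw [mul_node σ ω φ ψ (isFib _), val]
    simp only [ih]
    exact (congrArg (fun M => Functor.prod' (Functor.prod' (e _ x)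
      (Functor.pi' fun i => (s i).val A e)) (Functor.pi' fun j => (t j).val A e) ⋙ M)
      (A.assoc σ ω φ ψ (isFib _))).symm

/-- Evaluating labels inside a tree amounts to evaluating the grafted tree. Hence the summand
attached to a decoration is the value at the source of its morphism. -/
theorem val_flat (A : CatOperad.{v, u} Ω) {T : Ω} (z : Lab T) :
    z.val A (fun _ x => x.tl A) = z.flat.tl A := by
  induction z with
  | unit => rfl
  | node x σ φ t ih =>
    simp only [val, ih]
    exact (val_mul A _ σ φ _ _).symm

theorem tl_nf (A : CatOperad.{v, u} Ω) {T : Ω} (W : HObj T) : tilde A W = W.nf.tl A := by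
  obtain ⟨x, rfl⟩ := Quotient.exists_rep W
  change x.tilde A = x.nf.tl A
  induction x with
  | gen T => exact (tl_gen A T).symm
  | unit => rfl
  | mul σ φ s t ihs iht => simp only [Expr.tilde, Expr.nf, tl, val_mul, ihs, iht]

end Tr

/-! ## The action of a tree on an internal operad -/

section Ext

variable {A : CatOperad.{v, u} Ω}

/-- The action of an internal operad on morphisms into it is associative. -/
theorem IOperad.mulMap_comp_assoc (a : IOperad A) {T S R : Ω} (σ : T ⟶ S) (ω : S ⟶ R)
    {F : Tip S → Ω} (φ : ∀ j, Fibre σ j (F j)) {G : Tip R → Ω} (ψ : ∀ i, Fibre ω i (G i))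
    {H : Tip R → Ω} (χ : ∀ i, Fibre (σ ≫ ω) i (H i)) {r : A.obj R} {s : ∀ i, A.obj (G i)}
    {t : ∀ j, A.obj (F j)} (f : r ⟶ a.obj R) (g : ∀ i, s i ⟶ a.obj (G i))
    (h : ∀ j, t j ⟶ a.obj (F j)) :
    HEq (A.mulMap σ φ (A.mulMap ω ψ f g ≫ a.μ ω ψ) h ≫ a.μ σ φ)
      (A.mulMap (σ ≫ ω) χ f (fun i => A.mulMap ((ψ i).res (χ i))
        (fun j => (ψ i).resFibre (χ i) j (φ (j ≫ (ψ i).ι))) (g i)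
          (fun j => h (j ≫ (ψ i).ι)) ≫ a.μ _ _) ≫ a.μ (σ ≫ ω) χ) := by
  have e₁ := A.mulMap_comp σ φ (A.mulMap ω ψ f g) (a.μ ω ψ) h fun j => 𝟙 _
  have e₂ := A.mulMap_comp (σ ≫ ω) χ f (𝟙 _) (fun i => A.mulMap ((ψ i).res (χ i))
    (fun j => (ψ i).resFibre (χ i) j (φ (j ≫ (ψ i).ι))) (g i) fun j => h (j ≫ (ψ i).ι))
    fun i => a.μ ((ψ i).res (χ i)) fun j => (ψ i).resFibre (χ i) j (φ (j ≫ (ψ i).ι))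
  simp only [Category.comp_id] at e₁ e₂
  rw [e₁, e₂, Category.assoc, Category.assoc, a.assoc σ ω φ ψ χ]
  exact heq_comp (Functor.congr_obj (A.assoc σ ω φ ψ χ) ((r, s), t))
    (Functor.congr_obj (A.assoc σ ω φ ψ χ) ((a.obj R, fun i => a.obj (G i)), fun j => a.obj (F j)))
    rfl (A.mulMap_assoc σ ω φ ψ χ f g h) (eqToHom_comp_heq _ _)

theorem IOperad.mulMap_comp_unit_left (a : IOperad A) {T : Ω} {s : A.obj T} (f : s ⟶ a.obj T) :
    HEq (A.mulMap (bang T) (Fibre.ofBang T) a.ε (fun _ => f) ≫ a.μ (bang T) (Fibre.ofBang T))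
      f := by
  have e₁ := A.mulMap_comp (bang T) (Fibre.ofBang T) (𝟙 A.unit) a.ε (fun _ => f) fun _ => 𝟙 _
  simp only [Category.comp_id, Category.id_comp] at e₁
  rw [e₁, Category.assoc, a.unit_left]
  exact (comp_eqToHom_heq _ _).trans (A.mulMap_unit_left f)

theorem IOperad.mulMap_comp_unit_right (a : IOperad A) {T : Ω} {s : A.obj T} (f : s ⟶ a.obj T) :
    HEq (A.mulMap (𝟙 T) Fibre.ofId f (fun _ => a.ε) ≫ a.μ (𝟙 T) Fibre.ofId) f := by
  have e₁ := A.mulMap_comp (𝟙 T) Fibre.ofId f (𝟙 _) (fun _ => 𝟙 A.unit) fun _ => a.ε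
  simp only [Category.comp_id, Category.id_comp] at e₁
  rw [e₁, Category.assoc, a.unit_right]
  exact (comp_eqToHom_heq _ _).trans (A.mulMap_unit_right f)

/-- The morphism `x̃(w) ⟶ a_T` induced by a morphism of collections from `x` to the internal
operad `a`. -/
def IOperad.ext (a : IOperad A) {x : IColl A} (f : x ⟶ a.obj) :
    ∀ {T : Ω} (w : Nf T), (w.tl A).obj x ⟶ a.obj T
  | _, .unit => a.ε
  | _, .node _ σ φ t => A.mulMap σ φ (f _) (fun i => a.ext f (t i)) ≫ a.μ σ φ

theorem IOperad.ext_comp {a b : IOperad A} {x : IColl A} (f : x ⟶ a.obj) (g : a ⟶ b)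
    {T : Ω} (w : Nf T) :
    a.ext f w ≫ (forgetColl A).map g T = b.ext (f ≫ (forgetColl A).map g) w := by
  induction w with
  | unit => exact g.map_ε
  | node x σ φ t ih =>
    refine (Category.assoc _ _ _).trans ((congrArg _ (g.map_μ σ φ)).trans ?_)
    refine (Category.assoc _ _ _).symm.trans (congrArg (· ≫ b.μ σ φ) ?_)
    refine (A.mulMap_comp σ φ _ _ _ _).symm.trans ?_
    exact congrArg (fun k => A.mulMap σ φ _ k) (funext ih)

theorem IOperad.map_ext (a : IOperad A) {x y : IColl A} (k : x ⟶ y) (f : y ⟶ a.obj)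
    {T : Ω} (w : Nf T) : (w.tl A).map k ≫ a.ext f w = a.ext (k ≫ f) w := by
  induction w with
  | unit => exact Category.id_comp _
  | node x σ φ t ih =>
    refine (Category.assoc _ _ _).symm.trans (congrArg (· ≫ a.μ σ φ) ?_)
    refine (A.mulMap_comp σ φ _ _ _ _).symm.trans ?_
    exact congrArg (fun k => A.mulMap σ φ _ k) (funext ih)

variable [UniqueFibres Ω]

theorem Tr.tl_mul_obj (x : IColl A) {T S : Ω} (σ : T ⟶ S) {F : Tip S → Ω}
    (φ : ∀ i, Fibre σ i (F i)) (s : Nf S) (t : ∀ i, Nf (F i)) :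
    (A.mul σ φ).obj ((s.tl A).obj x, fun i => ((t i).tl A).obj x) =
      ((Tr.mul σ φ s t).tl A).obj x :=
  (Functor.congr_obj (Tr.val_mul A _ σ φ s t) x).symm

/-- The action of an operad on trees respects grafting, by its unit and associativity axioms and
induction on the bottom tree. The sources on the two sides are identified by `Tr.tl_mul_obj`, hence
the heterogeneous form. -/
theorem IOperad.ext_mul (a : IOperad A) {x : IColl A} (f : x ⟶ a.obj) {T S : Ω} (σ : T ⟶ S)
    {F : Tip S → Ω} (φ : ∀ i, Fibre σ i (F i)) (s : Nf S) (t : ∀ i, Nf (F i)) :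
    HEq (A.mulMap σ φ (a.ext f s) (fun i => a.ext f (t i)) ≫ a.μ σ φ)
      (a.ext f (Tr.mul σ φ s t)) := by
  induction s generalizing T with
  | unit =>
    revert t
    refine Fibre.bang_cases (P := fun σ F φ => ∀ t : ∀ i, Nf (F i),
      HEq (A.mulMap σ φ (a.ext f .unit) (fun i => a.ext f (t i)) ≫ a.μ σ φ)
        (a.ext f (Tr.mul σ φ .unit t))) ?_ σ F φ
    intro t
    obtain ⟨t, rfl⟩ : ∃ t', t = fun _ => t' :=
      ⟨t (𝟙 _), funext fun i => by rw [Subsingleton.elim i (𝟙 _)]⟩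
    rw [Tr.mul_unit (fun _ => t) (𝟙 _)]
    exact a.mulMap_comp_unit_left (a.ext f t)
  | node u ω ψ s ih =>
    rw [Tr.mul_node σ ω φ ψ (isFib _) u s t]
    refine (a.mulMap_comp_assoc σ ω φ ψ (isFib _) (f _) (fun i => a.ext f (s i))
      fun j => a.ext f (t j)).trans ?_
    have e := fun i => Tr.tl_mul_obj x ((ψ i).res (isFib (σ ≫ ω) i))
      (fun j => (ψ i).resFibre (isFib (σ ≫ ω) i) j (φ (j ≫ (ψ i).ι))) (s i)
      fun j => t (j ≫ (ψ i).ι)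
    refine heq_comp (by rw [funext e]; rfl) rfl rfl
      (A.mulMap_heq _ _ rfl rfl e (fun _ => rfl) HEq.rfl fun i => ih i _ _ _) HEq.rfl

end Ext

end HigherOperad

namespace HigherOperad

variable {Ω : Type} [Category.{0} Ω] [Arities Ω] {A : CatOperad.{v, u} Ω}

/-! ## Free internal operads -/

theorem IOperad.ext_gen (a : IOperad A) {x : IColl A} (f : x ⟶ a.obj) (T : Ω) :
    HEq (a.ext f (Tr.gen () : Nf T)) (f T) := a.mulMap_comp_unit_right (f T)

variable {𝓕 : IColl A ⥤ IOperad A}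

/-- The inclusion of the summand of the free internal operad given by a tree. -/
def extUnit (adj : 𝓕 ⊣ forgetColl A) {T : Ω} (w : Nf T) :
    w.tl A ⟶ 𝓕 ⋙ forgetColl A ⋙ Pi.eval _ T where
  app x := (𝓕.obj x).ext (adj.unit.app x) w
  naturality x y k := by
    -- Both composites are the action of `𝓕.obj y` on `w` along the same map out of `x`, by
    -- naturality of the unit.
    refine ((𝓕.obj y).map_ext k (adj.unit.app y) w).trans ?_
    refine Eq.trans ?_ ((𝓕.obj x).ext_comp (adj.unit.app x) (𝓕.map k) w).symm
    exact congrArg (fun f => (𝓕.obj y).ext f w) (adj.unit.naturality k)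

/-- The inclusion of the summand of the value of a tree at a free internal operad which is given
by a decoration. -/
def decUnit (adj : 𝓕 ⊣ forgetColl A) (x : IColl A) : ∀ {T : Ω} (w : Nf T) (d : w.Dec),
    ((w.lab d).val A fun _ V => V.tl A).obj x ⟶ (w.tl A).obj (𝓕.obj x).obj
  | _, .unit, _ => 𝟙 A.unit
  | _, .node _ σ φ t, d => A.mulMap σ φ ((extUnit adj d.1).app x) fun i =>
    decUnit adj x (t i) (d.2 i)

theorem decUnit_naturality (adj : 𝓕 ⊣ forgetColl A) {x y : IColl A} (k : x ⟶ y) {T : Ω}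
    (w : Nf T) (d : w.Dec) :
    ((w.lab d).val A fun _ V => V.tl A).map k ≫ decUnit adj y w d =
      decUnit adj x w d ≫ (w.tl A).map ((𝓕 ⋙ forgetColl A).map k) := by
  induction w with
  | unit => rfl
  | node u σ φ t ih =>
    refine (A.mulMap_comp σ φ _ _ _ _).symm.trans (Eq.trans ?_ (A.mulMap_comp σ φ _ _ _ _))
    exact congrArg₂ (fun f g => A.mulMap σ φ f g) ((extUnit adj d.1).naturality k)
      (funext fun i => ih i (d.2 i))

variable [UniqueFibres Ω]

theorem IsCoprod.mulMap (hA : A.Cocomplete) {T S : Ω} (σ : T ⟶ S) {F : Tip S → Ω}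
    (φ : ∀ i, Fibre σ i (F i)) {J₀ : Type} {X₀ : J₀ → A.obj S} {c : A.obj S}
    {f₀ : ∀ j, X₀ j ⟶ c} (h₀ : IsCoprod f₀) {J : Tip S → Type} {X : ∀ i, J i → A.obj (F i)}
    {d : ∀ i, A.obj (F i)} {f : ∀ i j, X i j ⟶ d i} (h : ∀ i, IsCoprod (f i)) :
    IsCoprod (J := J₀ × ∀ i, J i) fun κ => A.mulMap σ φ (f₀ κ.1) fun i => f i (κ.2 i) :=
  (hA.preserves σ φ).isCoprod h₀ h

theorem IsCoprod.single {C : Type u} [Category.{v} C] (c : C) :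
    IsCoprod (J := Unit) fun _ => 𝟙 c :=
  IsCoprod.of_isIso (inferInstance : IsIso (𝟙 c))

/-- An internal operad which is the coproduct of the values of trees at `x` is free on `x`. -/
theorem IOperad.existsUnique_hom (hA : A.Cocomplete) {a : IOperad A} {x : IColl A}
    {η : x ⟶ a.obj} (h : ∀ T : Ω, IsCoprod fun w : Nf T => a.ext η w) (b : IOperad A)
    (f : x ⟶ b.obj) : ∃! g : a ⟶ b, η ≫ (forgetColl A).map g = f := by
  have fac : ∀ {T : Ω} (w : Nf T), a.ext η w ≫ (h T).desc (fun w => b.ext f w) = b.ext f w :=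
    fun {T} w => (h T).fac _ w
  let g : a ⟶ b :=
    { f := fun T => (h T).desc fun w => b.ext f w
      map_μ := by
        intro T S σ F φ
        -- By distributivity it suffices to compare on a summand, given by a tree for each factor;
        -- there both sides are `b.ext f` at the grafted tree.
        refine (IsCoprod.mulMap hA σ φ (h S) fun i => h (F i)).hom_ext fun κ => ?_
        refine eq_of_heq ?_
        have e := a.ext_mul η σ φ κ.1 κ.2
        have e' := b.ext_mul f σ φ κ.1 κ.2
        rw [← Category.assoc, ← Category.assoc, ← A.mulMap_comp]
        refine (heq_comp (Tr.tl_mul_obj x σ φ κ.1 κ.2) rfl rfl e HEq.rfl).trans ?_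
        rw [fac]
        simp only [fac]
        exact e'.symm
      map_ε := fac .unit }
  refine ⟨g, ?_, fun g' hg' => ?_⟩
  · funext T
    refine eq_of_heq ?_
    have hT := Functor.congr_obj (Tr.tl_gen A T) x
    refine HEq.trans ?_ (b.ext_gen f T)
    rw [← fac (Tr.gen ())]
    exact heq_comp hT.symm rfl rfl (a.ext_gen η T).symm HEq.rfl
  -- An operad morphism commutes with the actions on trees, so its restriction to `x` determines it
  -- on every summand.
  · refine IOperad.Hom.ext (funext fun T => (h T).hom_ext fun w => ?_)
    refine Eq.trans ?_ (fac w).symm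
    rw [← hg']
    exact a.ext_comp η g' w

/-- On the coproducts of the values of all trees, multiplication sends the summand of a family of
trees to the summand of their grafting. Each axiom may be checked on summands, where it is the
corresponding identity for grafting. -/
theorem IOperad.exists_free (hA : A.Cocomplete) (x : IColl A) :
    ∃ (a : IOperad A) (η : x ⟶ a.obj), ∀ T : Ω, IsCoprod fun w : Nf T => a.ext η w := by
  choose y ι hι using fun T : Ω => exists_isCoprod (hA.hasColimits T) fun w : Nf T =>
    (w.tl A).obj x
  have hm := fun {T S : Ω} (σ : T ⟶ S) {F : Tip S → Ω} (φ : ∀ i, Fibre σ i (F i)) =>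
    IsCoprod.mulMap hA σ φ (hι S) fun i => hι (F i)
  let μ : ∀ {T S : Ω} (σ : T ⟶ S) {F : Tip S → Ω} (φ : ∀ i, Fibre σ i (F i)),
      (A.mul σ φ).obj (y S, fun i => y (F i)) ⟶ y T := fun {T S} σ {F} φ =>
    (hm σ φ).desc fun κ => eqToHom (Tr.tl_mul_obj x σ φ κ.1 κ.2) ≫ ι T (Tr.mul σ φ κ.1 κ.2)
  have fac : ∀ {T S : Ω} (σ : T ⟶ S) {F : Tip S → Ω} (φ : ∀ i, Fibre σ i (F i)) (s : Nf S)
      (t : ∀ i, Nf (F i)), HEq (A.mulMap σ φ (ι S s) (fun i => ι (F i) (t i)) ≫ μ σ φ)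
        (ι T (Tr.mul σ φ s t)) := fun {T S} σ {F} φ s t =>
    (heq_of_eq ((hm σ φ).fac _ (s, t))).trans (eqToHom_comp_heq _ _)
  -- An equality of trees changes the source of the inclusion, so it gives only a heterogeneous
  -- equality.
  have ι_congr : ∀ {T : Ω} {w w' : Nf T}, w = w' → HEq (ι T w) (ι T w') := by
    rintro T w _ rfl
    rfl
  let a : IOperad A :=
    { obj := y
      μ := μ
      ε := ι _ .unit
      assoc := by
        intro T S R σ ω F φ G ψ H χ
        refine (IsCoprod.mulMap hA σ φ (hm ω ψ) fun j => hι (F j)).hom_ext fun κ => ?_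
        obtain ⟨⟨r, s⟩, t⟩ := κ
        refine eq_of_heq (HEq.trans (b := ι T (Tr.mul σ φ (Tr.mul ω ψ r s) t)) ?_
          (HEq.trans (ι_congr (Tr.mul_assoc σ ω φ ψ χ r s t)) (HEq.symm ?_)))
        · have e := A.mulMap_comp σ φ (A.mulMap ω ψ (ι R r) fun i => ι (G i) (s i)) (μ ω ψ)
            (fun j => ι (F j) (t j)) fun j => 𝟙 _
          simp only [Category.comp_id] at e
          rw [← Category.assoc, ← e]
          refine HEq.trans (heq_comp ?_ rfl rfl (A.mulMap_heq σ φ (Tr.tl_mul_obj x ω ψ r s) rfl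
            (fun _ => rfl) (fun _ => rfl) (fac ω ψ r s) fun _ => HEq.rfl) HEq.rfl)
            (fac σ φ (Tr.mul ω ψ r s) t)
          rw [Tr.tl_mul_obj]
        · have e := A.mulMap_comp (σ ≫ ω) χ (ι R r) (𝟙 _) (fun i => A.mulMap ((ψ i).res (χ i))
            (fun j => (ψ i).resFibre (χ i) j (φ (j ≫ (ψ i).ι))) (ι (G i) (s i))
            fun j => ι _ (t (j ≫ (ψ i).ι))) fun i => μ ((ψ i).res (χ i))
            fun j => (ψ i).resFibre (χ i) j (φ (j ≫ (ψ i).ι))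
          simp only [Category.comp_id] at e
          refine (heq_comp (Functor.congr_obj (A.assoc σ ω φ ψ χ) ((_, _), _))
            (Functor.congr_obj (A.assoc σ ω φ ψ χ) ((_, _), _)) rfl
            (A.mulMap_assoc σ ω φ ψ χ (ι R r) (fun i => ι (G i) (s i)) fun j => ι (F j) (t j))
            (eqToHom_comp_heq _ _)).trans ?_
          refine (heq_of_eq ((Category.assoc _ _ _).symm.trans
            (congrArg (· ≫ μ (σ ≫ ω) χ) e.symm))).trans ?_
          have ho := fun i => Tr.tl_mul_obj x ((ψ i).res (χ i))
            (fun j => (ψ i).resFibre (χ i) j (φ (j ≫ (ψ i).ι))) (s i) fun j => t (j ≫ (ψ i).ι)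
          refine HEq.trans (heq_comp (by rw [funext ho]) rfl rfl (A.mulMap_heq (σ ≫ ω) χ rfl rfl
            ho (fun _ => rfl) HEq.rfl fun i => fac _ _ _ _) HEq.rfl) (fac (σ ≫ ω) χ r _)
      unit_right := by
        intro T
        refine ((hA.preserves (𝟙 T) Fibre.ofId).isCoprod_fst (hι T) _).hom_ext fun s => ?_
        have e := fun g : A.unit ⟶ y Arities.U => A.mulMap_comp (𝟙 T) Fibre.ofId (ι T s) (𝟙 _)
          (fun _ => 𝟙 A.unit) fun _ => g
        simp only [Category.comp_id, Category.id_comp] at e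
        refine eq_of_heq ((heq_of_eq ((Category.assoc _ _ _).symm.trans
          (congrArg (· ≫ μ (𝟙 T) Fibre.ofId) (e _).symm))).trans ?_)
        refine (fac _ _ _ _).trans ((ι_congr (Tr.mul_id s)).trans ?_)
        exact ((comp_eqToHom_heq _ _).trans (A.mulMap_unit_right (ι T s))).symm
      unit_left := by
        intro T
        refine ((hA.preserves (bang T) (Fibre.ofBang T)).isCoprod_pi A.unit
          (fun _ => hι T)).hom_ext fun κ => ?_
        obtain ⟨t, rfl⟩ : ∃ t', κ = fun _ => t' :=
          ⟨κ (𝟙 _), funext fun i => by rw [Subsingleton.elim i (𝟙 _)]⟩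
        have e := fun g : A.unit ⟶ y Arities.U => A.mulMap_comp (bang T) (Fibre.ofBang T)
          (𝟙 A.unit) g (fun _ => ι T t) fun _ => 𝟙 _
        simp only [Category.comp_id, Category.id_comp] at e
        refine eq_of_heq ((heq_of_eq ((Category.assoc _ _ _).symm.trans
          (congrArg (· ≫ μ (bang T) (Fibre.ofBang T)) (e _).symm))).trans ?_)
        refine (fac _ _ .unit fun _ => t).trans ((ι_congr (Tr.mul_unit _ (𝟙 _))).trans ?_)
        exact ((comp_eqToHom_heq _ _).trans (A.mulMap_unit_left (ι T t))).symm }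
  have hgen : ∀ T, (Pi.eval _ T : IColl A ⥤ A.obj T).obj x = ((Tr.gen () : Nf T).tl A).obj x :=
    fun T => (Functor.congr_obj (Tr.tl_gen A T) x).symm
  -- The unit is the summand of the one-generator tree. Since a node is a product of its root
  -- generator with its subtrees, induction then identifies each inclusion with the action on that
  -- tree.
  let η : x ⟶ y := fun T => eqToHom (hgen T) ≫ ι T (Tr.gen ())
  refine ⟨a, η, fun T => (hι T).congr fun w => ?_⟩
  induction w with
  | unit => rfl
  | node u σ φ t ih =>
    refine eq_of_heq (HEq.symm ?_)
    refine HEq.trans ?_ (ι_congr (Tr.mul_gen u σ φ t))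
    refine HEq.trans ?_ (fac σ φ (Tr.gen u) t)
    refine heq_comp ?_ rfl rfl (A.mulMap_heq σ φ (hgen _) rfl (fun _ => rfl) (fun _ => rfl)
      (eqToHom_comp_heq _ _) fun i => heq_of_eq (ih i).symm) HEq.rfl
    exact congrArg (fun s => (A.mul σ φ).obj (s, fun i => ((t i).tl A).obj x)) (hgen _)

theorem forgetColl_isRightAdjoint (hA : A.Cocomplete) : (forgetColl A).IsRightAdjoint := by
  have : ∀ x, HasInitial (StructuredArrow x (forgetColl A)) := by
    intro x
    obtain ⟨a, η, h⟩ := IOperad.exists_free hA x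
    have hu := fun b f => IOperad.existsUnique_hom hA h b f
    refine IsInitial.hasInitial (X := StructuredArrow.mk (S := x) (T := forgetColl A) η) ?_
    refine IsInitial.ofUniqueHom (fun Y => StructuredArrow.homMk (hu Y.right Y.hom).choose
      (hu Y.right Y.hom).choose_spec.1) fun Y m => ?_
    refine StructuredArrow.ext _ _ ?_
    exact (hu Y.right Y.hom).choose_spec.2 _ (StructuredArrow.w m)
  exact isRightAdjointOfStructuredArrowInitials _

/-! ### Coproduct formulas for the free operad and its iterates. -/

/-- An arbitrary left adjoint is compared with the explicit free operad: both have the same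
universal property, and the resulting isomorphism is compatible with the actions on trees. -/
theorem isCoprod_ext_unit (hA : A.Cocomplete) (adj : 𝓕 ⊣ forgetColl A) (x : IColl A) (T : Ω) :
    IsCoprod fun w : Nf T => (𝓕.obj x).ext (adj.unit.app x) w := by
  obtain ⟨a, η, h⟩ := IOperad.exists_free hA x
  have hu := fun b f => IOperad.existsUnique_hom hA h b f
  change x ⟶ (forgetColl A).obj a at η
  obtain ⟨g, hg, -⟩ := hu (𝓕.obj x) (adj.unit.app x)
  let k : 𝓕.obj x ⟶ a := (adj.homEquiv x a).symm η
  have hk : adj.unit.app x ≫ (forgetColl A).map k = η :=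
    (adj.homEquiv_unit _ _ _).symm.trans ((adj.homEquiv x a).apply_symm_apply η)
  have hgk : g ≫ k = 𝟙 a := (hu a η).unique
    ((Category.assoc η ((forgetColl A).map g) ((forgetColl A).map k)).symm.trans
      ((congrArg (· ≫ (forgetColl A).map k) hg).trans hk)) (Category.comp_id η)
  have hkg : k ≫ g = 𝟙 (𝓕.obj x) := by
    apply (adj.homEquiv x (𝓕.obj x)).injective
    rw [adj.homEquiv_unit, adj.homEquiv_unit]
    refine Eq.trans ?_ (Category.comp_id (adj.unit.app x)).symm
    exact (Category.assoc (adj.unit.app x) ((forgetColl A).map k) ((forgetColl A).map g)).symm.trans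
      ((congrArg (· ≫ (forgetColl A).map g) hk).trans hg)
  have : IsIso (g.f T) := ⟨k.f T, congrArg (fun m => (forgetColl A).map m T) hgk,
    congrArg (fun m => (forgetColl A).map m T) hkg⟩
  refine ((h T).comp_isIso (g.f T)).congr fun w => ?_
  exact (a.ext_comp η g w).trans (congrArg (fun f => (𝓕.obj x).ext f w) hg)

/-- Distributivity is applied at every node: each generator contributes a choice of tree, and all
these choices together form a decoration. -/
theorem isCoprod_decUnit (hA : A.Cocomplete) (adj : 𝓕 ⊣ forgetColl A) (x : IColl A) {T : Ω}
    (w : Nf T) : IsCoprod fun d : w.Dec => decUnit adj x w d := by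
  induction w with
  | unit => exact IsCoprod.single A.unit
  | node u σ φ t ih => exact IsCoprod.mulMap hA σ φ (isCoprod_ext_unit hA adj x _) ih

/-- Used to pass from inclusions indexed by decorations, or by extended chains, to inclusions
indexed by morphisms, or by chains. -/
theorem exists_extend {K J : Type} {e : K → J} (he : Function.Bijective e) {B : J → Type*}
    (t : ∀ k, B (e k)) : ∃ t' : ∀ j, B j, ∀ k, t' (e k) = t k :=
  ⟨Equiv.piCongrLeft B (Equiv.ofBijective e he) t,
    fun k => Equiv.piCongrLeft_apply_apply B (Equiv.ofBijective e he) t k⟩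

/-- `𝓕(x)_T` is the coproduct of the `x̃(W)`. -/
theorem exists_coprod_tilde (hA : A.Cocomplete) (adj : 𝓕 ⊣ forgetColl A) (T : Ω) :
    ∃ ι : ∀ W : HObj T, tilde A W ⟶ 𝓕 ⋙ forgetColl A ⋙ Pi.eval _ T,
      ∀ x : IColl A, IsCoprod fun W => (ι W).app x := by
  refine ⟨fun W => eqToHom (Tr.tl_nf A W) ≫ extUnit adj W.nf, fun x => ?_⟩
  have hb : Function.Bijective (HObj.nf : HObj T → Nf T) :=
    Function.bijective_iff_has_inverse.2 ⟨Tr.toH, HObj.toH_nf, Tr.nf_toH⟩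
  exact ((isCoprod_ext_unit hA adj x T).reindex hb).isIso_comp
    fun W => (eqToHom (Tr.tl_nf A W)).app x

/-- The value of `𝓕(x)~` at `W` is the coproduct of the `x̃(W')` over all morphisms `W' ⟶ W`. -/
theorem exists_coprod_tilde_over (hA : A.Cocomplete) (adj : 𝓕 ⊣ forgetColl A) {T : Ω}
    (W : HObj T) : ∃ ι : ∀ p : Σ W' : HObj T, W' ⟶ W,
      tilde A p.1 ⟶ (𝓕 ⋙ forgetColl A) ⋙ tilde A W, ∀ x, IsCoprod fun p => (ι p).app x := by
  have e : ∀ d : W.nf.Dec, tilde A (W.homOf d).1 =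
      (W.nf.lab d).val A fun _ V => V.tl A := fun d => by
    change tilde A (W.nf.lab d).src = _
    rw [Tr.val_flat, Tr.tl_nf, Tr.src_eq, Tr.nf_toH]
  let dec : ∀ d : W.nf.Dec, ((W.nf.lab d).val A fun _ V => V.tl A) ⟶
      (𝓕 ⋙ forgetColl A) ⋙ W.nf.tl A := fun d =>
    { app := fun x => decUnit adj x W.nf d
      naturality := fun x y k => decUnit_naturality adj k W.nf d }
  obtain ⟨ι, hι⟩ := exists_extend W.homOf_bijective
    (B := fun p => tilde A p.1 ⟶ (𝓕 ⋙ forgetColl A) ⋙ tilde A W) fun d =>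
    eqToHom (e d) ≫ dec d ≫ Functor.whiskerLeft _ (eqToHom (Tr.tl_nf A W).symm)
  refine ⟨ι, fun x => IsCoprod.of_reindex W.homOf_bijective ?_⟩
  have h₁ : ∀ d, IsIso ((eqToHom (e d)).app x) := fun d => inferInstance
  have h₂ : IsIso ((eqToHom (Tr.tl_nf A W).symm).app (𝓕.obj x).obj) := inferInstance
  refine (((isCoprod_decUnit hA adj x W.nf).comp_isIso
    ((eqToHom (Tr.tl_nf A W).symm).app (𝓕.obj x).obj)).isIso_comp
    fun d => (eqToHom (e d)).app x).congr fun d => ?_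
  exact (congrArg (fun f => f.app x) (hι d)).symm

/-- By definition the extra copy of `M` is applied last; the induction on chains needs it applied
first, to `x` itself. -/
theorem iterate_succ' {C : Type u} [Category.{v} C] (M : C ⥤ C) (k : ℕ) :
    iterate M (k + 1) = M ⋙ iterate M k := by
  induction k with
  | zero => rfl
  | succ k ih => exact congrArg (· ⋙ M) ih

/-- A chain is extended at its left end, the object at which `x̃` is evaluated. -/
theorem precomp_bijective (C : Type) [Category.{0} C] (k : ℕ) : Function.Bijective
    fun p : Σ c : ComposableArrows C k, Σ W : C, W ⟶ c.left => p.1.precomp p.2.2 := by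
  refine ⟨Function.LeftInverse.injective (g := fun c => ⟨c.δ₀, ⟨c.left, c.map' 0 1⟩⟩)
    fun _ => rfl, fun c => ?_⟩
  obtain ⟨c₀, W, f, rfl⟩ := c.precomp_surjective
  exact ⟨⟨c₀, ⟨W, f⟩⟩, rfl⟩

/-- The iterates of `𝓕` are coproducts over chains of morphisms. -/
theorem exists_coprod_chains (hA : A.Cocomplete) (adj : 𝓕 ⊣ forgetColl A) (T : Ω) (k : ℕ) :
    ∃ ι : ∀ c : ComposableArrows (HObj T) k,
      tilde A c.left ⟶ iterate (𝓕 ⋙ forgetColl A) (k + 1) ⋙ Pi.eval _ T,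
      ∀ x : IColl A, IsCoprod fun c => (ι c).app x := by
  induction k with
  | zero =>
    obtain ⟨ι, hι⟩ := exists_coprod_tilde hA adj T
    refine ⟨fun c => ι c.left, fun x => (hι x).reindex
      (e := fun c : ComposableArrows (HObj T) 0 => c.left) ⟨?_, ?_⟩⟩
    · exact fun c c' h => ComposableArrows.ext₀ h
    · exact fun W => ⟨ComposableArrows.mk₀ W, rfl⟩
  | succ k ih =>
    obtain ⟨ι, hι⟩ := ih
    choose κ hκ using fun W : HObj T => exists_coprod_tilde_over hA adj W
    rw [iterate_succ']
    obtain ⟨ι', hι'⟩ := exists_extend (precomp_bijective (HObj T) k)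
      (B := fun c => tilde A c.left ⟶
        ((𝓕 ⋙ forgetColl A) ⋙ iterate (𝓕 ⋙ forgetColl A) (k + 1)) ⋙ Pi.eval _ T)
      fun p => κ p.1.left p.2 ≫ Functor.whiskerLeft (𝓕 ⋙ forgetColl A) (ι p.1)
    refine ⟨ι', fun x => IsCoprod.of_reindex (precomp_bijective (HObj T) k) ?_⟩
    simp only [hι']
    -- The formula for `k` arrows is used at the free operad on `x`; each summand then splits over
    -- the morphisms into `c.left`.
    exact (hι ((𝓕 ⋙ forgetColl A).obj x)).sigma fun c => hκ c.left x

end HigherOperad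

namespace HigherOperad

/-! ## `n`-trees and finite ordinals -/

instance (n : ℕ) : UniqueFibres (NTree n) where
  finite_tip S := by
    refine Finite.of_injective (β := ∀ m, Fin 1 → Fin (S.card m)) (fun i => i.app) fun i j h => ?_
    exact NTree.Hom.ext h
  exists_fibre := NTree.exists_fibre
  fibre_unique := NTree.fibre_unique

instance : UniqueFibres FinOrd where
  finite_tip S := inferInstanceAs (Finite (Fin 1 → Fin S.card))
  exists_fibre := FinOrd.exists_fibre
  fibre_unique := FinOrd.fibre_unique

/-- Bijections act by equivalences. -/
def SymOperad.actEquivalence (A : SymOperad.{v, u}) {T T' : FinOrd} (π : T ≅ T') :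
    A.obj T ≌ A.obj T' :=
  CategoryTheory.Equivalence.mk (A.act π) (A.act π.symm)
    (eqToIso (by rw [← A.act_trans, Iso.self_symm_id, A.act_refl]))
    (eqToIso (by rw [← A.act_trans, Iso.symm_self_id, A.act_refl]))

theorem PreservesColimitsInEachVariable.comp {C E E' : Type u} [Category.{v} C] [Category.{v} E]
    [Category.{v} E'] {I : Type} {D : I → Type u} [∀ i, Category.{v} (D i)]
    {M : C × (∀ i, D i) ⥤ E} (hM : PreservesColimitsInEachVariable M) (N : E ⥤ E')
    [PreservesColimits N] : PreservesColimitsInEachVariable (M ⋙ N) := by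
  refine ⟨fun d => ?_, fun c d i => ?_⟩
  · have := hM.1 d
    exact inferInstanceAs (PreservesColimits
      ((Functor.prod' (𝟭 C) ((Functor.const C).obj d) ⋙ M) ⋙ N))
  · have := hM.2 c d i
    exact inferInstanceAs (PreservesColimits
      ((Functor.prod' ((Functor.const (D i)).obj c) (varyCoord d i) ⋙ M) ⋙ N))

/-- For an arbitrary map the multiplication is that of an order preserving map followed by the
action of a bijection, an equivalence, which preserves colimits. -/
theorem SymOperad.Cocomplete.toS {A : SymOperad.{v, u}} (hA : A.Cocomplete) :
    A.toS.Cocomplete where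
  hasColimits := hA.hasColimits
  preserves {T _} σ _ _ := by
    have : (A.act (FinOrd.sortIso σ).symm).IsEquivalence :=
      (A.actEquivalence (FinOrd.sortIso σ).symm).isEquivalence_functor
    exact (hA.preserves _ _ _).comp (A.act (FinOrd.sortIso σ).symm)

/-- The free internal operad and its iterates, for arities with finitely many tips. -/
theorem exists_isColimit_cofan {Ω : Type} [Category.{0} Ω] [Arities Ω] [UniqueFibres Ω]
    {A : CatOperad.{v, u} Ω} (hA : A.Cocomplete) {𝓕 : IColl A ⥤ IOperad A}
    (adj : 𝓕 ⊣ forgetColl A) (T : Ω) :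
    (∃ ι : ∀ W : HObj T, tilde A W ⟶ 𝓕 ⋙ forgetColl A ⋙ Pi.eval _ T,
      ∀ x : IColl A, Nonempty (IsColimit
        (Cofan.mk ((𝓕.obj x).obj T) fun W => (ι W).app x))) ∧
    ∀ k : ℕ, ∃ ι : ∀ c : ComposableArrows (HObj T) k,
        tilde A c.left ⟶ iterate (𝓕 ⋙ forgetColl A) (k + 1) ⋙ Pi.eval _ T,
      ∀ x : IColl A, Nonempty (IsColimit
        (Cofan.mk ((iterate (𝓕 ⋙ forgetColl A) (k + 1)).obj x T) fun c => (ι c).app x)) := by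
  refine ⟨?_, fun k => ?_⟩
  · obtain ⟨ι, hι⟩ := exists_coprod_tilde hA adj T
    exact ⟨ι, fun x => (isCoprod_iff _).1 (hι x)⟩
  · obtain ⟨ι, hι⟩ := exists_coprod_chains hA adj T k
    exact ⟨ι, fun x => (isCoprod_iff _).1 (hι x)⟩

end HigherOperad

theorem mainTheorem11 :
    -- free internal `n`-operads
    (∀ (n : ℕ) (A : CatOperad.{v, u} (NTree n)), A.Cocomplete →
      (forgetColl A).IsRightAdjoint ∧
      ∀ (𝓕 : IColl A ⥤ IOperad A) (_ : 𝓕 ⊣ forgetColl A) (T : NTree n),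
        -- `𝓕(x)_T` is the coproduct of the `x̃(W)`, naturally in `x`
        (∃ ι : ∀ W : (hOperad (NTree n)).obj T, tilde A W ⟶ 𝓕 ⋙ forgetColl A ⋙ Pi.eval _ T,
          ∀ x : IColl A, Nonempty (IsColimit
            (Cofan.mk ((𝓕.obj x).obj T) fun W => (ι W).app x))) ∧
        -- `𝓕^{k+1}(x)_T` is the coproduct of the `x̃(W_{k+1})` over all chains
        -- `W_{k+1} ⟶ ⋯ ⟶ W_1` of `k` morphisms, naturally in `x`
        ∀ k : ℕ, ∃ ι : ∀ c : ComposableArrows ((hOperad (NTree n)).obj T) k,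
            tilde A c.left ⟶ iterate (𝓕 ⋙ forgetColl A) (k + 1) ⋙ Pi.eval _ T,
          ∀ x : IColl A, Nonempty (IsColimit
            (Cofan.mk ((iterate (𝓕 ⋙ forgetColl A) (k + 1)).obj x T) fun c => (ι c).app x))) ∧
    -- free internal symmetric operads
    (∀ A : SymOperad.{v, u}, A.Cocomplete →
      (forgetColl A.toS).IsRightAdjoint ∧
      ∀ (𝓕 : IColl A.toS ⥤ IOperad A.toS) (_ : 𝓕 ⊣ forgetColl A.toS) (T : FinOrd),
        (∃ ι : ∀ W : (hOperad FinOrd).obj T, tilde A.toS W ⟶ 𝓕 ⋙ forgetColl A.toS ⋙ Pi.eval _ T,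
          ∀ x : IColl A.toS, Nonempty (IsColimit
            (Cofan.mk ((𝓕.obj x).obj T) fun W => (ι W).app x))) ∧
        ∀ k : ℕ, ∃ ι : ∀ c : ComposableArrows ((hOperad FinOrd).obj T) k,
            tilde A.toS c.left ⟶ iterate (𝓕 ⋙ forgetColl A.toS) (k + 1) ⋙ Pi.eval _ T,
          ∀ x : IColl A.toS, Nonempty (IsColimit
            (Cofan.mk ((iterate (𝓕 ⋙ forgetColl A.toS) (k + 1)).obj x T) fun c => (ι c).app x))) := by
  exact ⟨fun n A hA => ⟨forgetColl_isRightAdjoint hA, fun _ adj T =>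
      exists_isColimit_cofan hA adj T⟩,
    fun A hA => ⟨forgetColl_isRightAdjoint hA.toS, fun _ adj T =>
      exists_isColimit_cofan hA.toS adj T⟩⟩
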